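/- **Notation.** Let $n\ge 1$, $\alpha\in[-\infty,+\infty]$, $u\in\mathbb{R}^n$ with $\|u\|=1$, $H=u^\perp$, $R_u(x)=x-2\langle x,u\rangle u$. For a function $f$ put $R_uf=f\circ R_u$; for a set $K$ put $\tau_uK=\frac12K+\frac12R_uK$. For $f:\mathbb{R}^n\to[0,\infty)$ put $\mathrm{supp} f=\{f>0\}$, $\mathrm{lev}_{\ge t}f=\{f\ge t\}$, $J(f)=\int_{\mathbb{R}^n} f\in[0,\infty]$ and $\mathrm{proj}_Hf(x)=\sup_{t\in\mathbb{R}}f(x+tu)$ for $x\in H$. For $a,b>0$ let $M_\alpha^{(s,t)}(a,b)=(sa^\alpha+tb^\alpha)^{1/\alpha}$, read as $a^sb^t$, $\min\{a,b\}$, $\max\{a,b\}$ for $\alpha=0,-\infty,+\infty$. $\mathcal{C}_\alpha$ is the set of all $f:\mathbb{R}^n\to[0,\infty)$, $f\not\equiv0$, that are upper semicontinuous, tend to $0$ as $\|x\|\to\infty$, and have a convex support of dimension $n$ with $f(\lambda x+(1-\lambda)y)\ge M_\alpha^{(\lambda,1-\lambda)}(f(x),f(y))$ for all $x,y\in\mathrm{supp}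 f$, $\lambda\in[0,1]$. $\mathrm{LC}_c$ is defined like $\mathcal{C}_0$ but without the condition on the dimension of the support. For real $\alpha\ne0$ let $\mathrm{base}_\alpha f=(1-f^\alpha)/\alpha$ on the closure of $\mathrm{supp} f$ and $+\infty$ elsewhere (with $0^\alpha=+\infty$ if $\alpha<0$), and let $\mathrm{base}_0f=-\log f$; conversely a base function $\psi$ determines the function $(1-\alpha\psi)_+^{1/\alpha}$ (for $\alpha=0$: $e^{-\psi}$). For real $\alpha$, the functions $f\star_\alpha g$ and $\lambda\cdot_\alpha f$ ($\lambda>0$) are those with base functions $x\mapsto\inf_{y+z=x}(\mathrm{base}_\alpha f(y)+\mathrm{base}_\alpha g(z))$ and $x\mapsto\lambda\,\mathrm{base}_\alpha f(x/\lambda)$. The $\alpha$-Minkowski symmetral is $\tau_u^\alpha f=\frac12\cdot_\alpha f\star_\alpha\frac12\cdot_\alpha R_uf$ for real $\alpha$, and $$\tau_u^{-\infty}f(x)=\sup_{y+z=x}\min\{f(2y),R_uf(2z)\},\qquad \tau_u^{+\infty}f(x)=\sup_{y+z=x,\ f(2y)>0,\ R_uf(2z)>0}\max\{f(2y),R_uf(2z)\}.$$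 For real $\alpha$ let $h_f^{(\alpha)}(x)=\sup_y(\langle x,y\rangle-\mathrm{base}_\alpha f(y))$. The $\alpha$-mean width is $$w_\alpha(f)=\begin{cases}\int_{\mathbb{R}^n}h_f^{(\alpha)}(x)\,\bigl(1-\tfrac{\alpha\|x\|^2}{2}\bigr)_+^{(1-\alpha)/\alpha}\,dx,&\alpha\in\mathbb{R}\setminus\{0\},\\ \frac2n\int_{\mathbb{R}^n}h_f^{(0)}\,d\gamma_n,&\alpha=0,\\ \int_0^\infty w(\mathrm{lev}_{\ge t}f)\,dt,&\alpha=-\infty,\end{cases}$$ where the weight is $0$ where $1-\alpha\|x\|^2/2\le0$, $\gamma_n$ is the standard Gaussian measure, and $w(K)=2\int_{\mathbb{S}^{n-1}}\sup_{x\in K}\langle x,v\rangle\,d\sigma(v)$ with $\sigma$ the normalized surface measure ($w(\varnothing)=0$). Values in $[-\infty,+\infty]$ are allowed; the integral of an extended real function is $\int h^+-\int h^-$, with $\infty-\infty=+\infty$. **Proposition.** Let $f,g\in\mathcal{C}_\alpha$. (i) If $\alpha<+\infty$, then $w_\alpha(\tau_u^\alpha f)=w_\alpha(f)$. (ii) If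 $f\le g$, then $\tau_u^\alpha f\le\tau_u^\alpha g$. (iii) $R_u(\tau_u^\alpha f)=\tau_u^\alpha f$. (iv) $\tau_u^\alpha(\tau_u^\alpha f)=\tau_u^\alpha f$. (v) If $f_H\in\mathcal{C}_\alpha$ satisfies $R_uf_H=f_H$, then $\tau_u^\alpha f_H=f_H$. (vi) $\mathrm{proj}_H\tau_u^\alpha f=\mathrm{proj}_Hf$. (vii) If $\alpha\ge-1/n$, then $J(\tau_u^\alpha\varphi)\ge J(\varphi)$ for every $\varphi\in\mathcal{C}_\alpha$ and, if moreover $\alpha\le0$, also for every $\varphi\in\mathrm{LC}_c$. If $\alpha=0$, then $J(\tau_u^0f)=J(f)$ if and only if there is $x_0\in\mathbb{R}^n$ with $f(x)=R_uf(x-x_0)$ for all $x\in\mathbb{R}^n$. (viii) For every $t>0$, $\mathrm{lev}_{\ge t}\tau_u^{-\infty}f=\tau_u\,\mathrm{lev}_{\ge t}f$. -/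

import Mathlib

open MeasureTheory Topology Filter Set
open scoped ENNReal NNReal Pointwise

noncomputable section

namespace MinkSymm

/-- `ℝⁿ` with its Euclidean structure. -/
abbrev E (n : ℕ) := EuclideanSpace ℝ (Fin n)

variable {n : ℕ}

/-! ### The classes of functions

Functions `ℝⁿ → [0,∞)` are modelled as `[0,∞]`-valued functions that are finite everywhere
(finiteness is a clause of the classes below). -/

/-- The support `{f > 0}` (no closure is taken). -/
def supp (f : E n → ℝ≥0∞) : Set (E n) := {x | 0 < f x}

/-- The `α`-mean `M_α^{(s,t)}(a,b)` of positive numbers `a, b`, for `α ∈ [-∞,+∞]`. -/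
def alphaMean (α : EReal) (s t : ℝ≥0) (a b : ℝ≥0∞) : ℝ≥0∞ :=
  if α = ⊥ then min a b
  else if α = ⊤ then max a b
  else if α = 0 then a ^ (s : ℝ) * b ^ (t : ℝ)
  else (s * a ^ α.toReal + t * b ^ α.toReal) ^ (1 / α.toReal)

/-- `α`-concavity: the support is convex and `f(λx + (1-λ)y) ≥ M_α^{(λ,1-λ)}(f(x), f(y))`
for all `x, y` in the support and all `λ ∈ [0,1]`. -/
def AlphaConcave (α : EReal) (f : E n → ℝ≥0∞) : Prop :=
  Convex ℝ (supp f) ∧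
    ∀ x ∈ supp f, ∀ y ∈ supp f, ∀ s t : ℝ≥0, s + t = 1 →
      alphaMean α s t (f x) (f y) ≤ f ((s : ℝ) • x + (t : ℝ) • y)

/-- The class `C_α(ℝⁿ)`: finite, `α`-concave, not identically zero, upper semicontinuous, with
support of full dimension, and tending to `0` at infinity. -/
structure MemC (α : EReal) (f : E n → ℝ≥0∞) : Prop where
  finite : ∀ x, f x < ∞
  alphaConcave : AlphaConcave α f
  proper : (supp f).Nonempty
  usc : UpperSemicontinuous f
  full_dim : affineSpan ℝ (supp f) = ⊤
  tendsto_zero : Tendsto f (cocompact (E n)) (𝓝 0)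

/-- The class `LC_c(ℝⁿ)` of functions `e^{-ψ}` with `ψ` convex, coercive, proper and lower
semicontinuous; in terms of `f = e^{-ψ}`: finite, log-concave, not identically zero, upper
semicontinuous and tending to `0` at infinity (the support may have lower dimension). -/
structure MemLCc (f : E n → ℝ≥0∞) : Prop where
  finite : ∀ x, f x < ∞
  logConcave : AlphaConcave 0 f
  proper : (supp f).Nonempty
  usc : UpperSemicontinuous f
  tendsto_zero : Tendsto f (cocompact (E n)) (𝓝 0)

/-! ### Base functions and the operations `⋆_α`, `·_α` for real `α` -/

/-- The base function `base_α f`, with values in `(-∞,+∞]`: for `α ≠ 0` it is `(1 - f^α)/α` on the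
closure of the support and `+∞` elsewhere; for `α = 0` it is `-log f`.

For `α ≤ 0` the formulas give `+∞` wherever `f = 0`. For `α > 0` the value `+∞` off the
closed support has to be prescribed: it makes the base function of the characteristic function of
a convex body `K` the indicator function `I_K^∞`, and the base function of every function
of the class `C_α` convex and lower semicontinuous. -/
def base (α : ℝ) (f : E n → ℝ≥0∞) (x : E n) : EReal :=
  open Classical in
  if α = 0 then -ENNReal.log (f x)
  else if x ∈ closure (supp f) then (1 - ((f x ^ α : ℝ≥0∞) : EReal)) / (α : EReal)
  else ⊤

/-- The function with a given base function: `(1 - αψ)_+^{1/α}`, and `e^{-ψ}` if `α = 0`. -/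
def ofBase (α : ℝ) (ψ : E n → EReal) (x : E n) : ℝ≥0∞ :=
  if α = 0 then EReal.exp (-ψ x)
  else (1 - (α : EReal) * ψ x).toENNReal ^ (1 / α)

/-- Infimal convolution `(φ □ ψ)(x) = inf_{y+z=x} (φ(y) + ψ(z))`. -/
def infConv (φ ψ : E n → EReal) (x : E n) : EReal := ⨅ y : E n, φ y + ψ (x - y)

/-- Epi-multiplication `x ↦ c ψ(x/c)`. -/
def epiMul (c : ℝ) (ψ : E n → EReal) (x : E n) : EReal := (c : EReal) * ψ (c⁻¹ • x)

/-- The `α`-Asplund sum `f ⋆_α g`. -/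
def asplund (α : ℝ) (f g : E n → ℝ≥0∞) : E n → ℝ≥0∞ :=
  ofBase α (infConv (base α f) (base α g))

/-- The `(α,c)`-homothety `c ·_α f`. -/
def homothety (α : ℝ) (c : ℝ) (f : E n → ℝ≥0∞) : E n → ℝ≥0∞ :=
  ofBase α (epiMul c (base α f))

/-! ### The operations `⊕_α`, `×_α` for `α = ±∞` -/

/-- `f ⊕_{-∞} g`. -/
def oplusBot (f g : E n → ℝ≥0∞) (x : E n) : ℝ≥0∞ := ⨆ y : E n, min (f y) (g (x - y))

/-- `f ⊕_{+∞} g`; as always for `α`-means, only pairs of points at which both functions are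
positive compete. -/
def oplusTop (f g : E n → ℝ≥0∞) (x : E n) : ℝ≥0∞ :=
  ⨆ (y : E n) (_ : y ∈ supp f) (_ : x - y ∈ supp g), max (f y) (g (x - y))

/-- `c ×_{±∞} f`, i.e. `x ↦ f(x/c)`. -/
def timesInf (c : ℝ) (f : E n → ℝ≥0∞) (x : E n) : ℝ≥0∞ := f (c⁻¹ • x)

/-! ### Reflections, projections, Minkowski symmetrals -/

/-- The reflection `R_u(x) = x - 2⟨x,u⟩u`. -/
def reflPt (u x : E n) : E n := x - (2 * inner ℝ x u) • u

/-- The reflection `R_u f = f ∘ R_u` of a function. -/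
def refl (u : E n) (f : E n → ℝ≥0∞) (x : E n) : ℝ≥0∞ := f (reflPt u x)

/-- The `α`-Minkowski symmetral `τ_u^α f`, for `α ∈ [-∞,+∞]`. -/
def symm (α : EReal) (u : E n) (f : E n → ℝ≥0∞) : E n → ℝ≥0∞ :=
  if α = ⊥ then oplusBot (timesInf (1 / 2) f) (timesInf (1 / 2) (refl u f))
  else if α = ⊤ then oplusTop (timesInf (1 / 2) f) (timesInf (1 / 2) (refl u f))
  else asplund α.toReal (homothety α.toReal (1 / 2) f) (homothety α.toReal (1 / 2) (refl u f))

/-- The Minkowski symmetral `τ_u K = ½K + ½R_u K` of a set. -/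
def symmSet (u : E n) (K : Set (E n)) : Set (E n) :=
  (1 / 2 : ℝ) • K + (1 / 2 : ℝ) • (reflPt u '' K)

/-- The superlevel set `{f ≥ t}`. -/
def superlevel (t : ℝ) (f : E n → ℝ≥0∞) : Set (E n) := {x | ENNReal.ofReal t ≤ f x}

/-- The projection of `f` into `H = u^⊥`, as a function on `H`. -/
def proj (u : E n) (f : E n → ℝ≥0∞) (x : ((Submodule.span ℝ {u})ᗮ : Submodule ℝ (E n))) : ℝ≥0∞ :=
  ⨆ t : ℝ, f ((x : E n) + t • u)

/-- The total mass. -/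
def mass (f : E n → ℝ≥0∞) : ℝ≥0∞ := ∫⁻ x, f x

/-! ### Mean widths -/

/-- The Legendre–Fenchel conjugate. -/
def legendre (ψ : E n → EReal) (x : E n) : EReal :=
  ⨆ y : E n, ((inner ℝ x y : ℝ) : EReal) - ψ y

/-- The `α`-support function `h_f^{(α)}`. -/
def alphaSupport (α : ℝ) (f : E n → ℝ≥0∞) : E n → EReal := legendre (base α f)

/-- The integral of an extended-real-valued function, `∫ h⁺ - ∫ h⁻`, with `∞ - ∞ = +∞`. -/
def extIntegral (μ : Measure (E n)) (h : E n → EReal) : EReal :=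
  if ∫⁻ x, (h x).toENNReal ∂μ = ∞ then ⊤
  else ((∫⁻ x, (h x).toENNReal ∂μ : ℝ≥0∞) : EReal) - ((∫⁻ x, (-h x).toENNReal ∂μ : ℝ≥0∞) : EReal)

/-- The weight `(1 - α‖x‖²/2)_+^{(1-α)/α}`, understood as `0` where `1 - α‖x‖²/2 ≤ 0`. -/
def weight (α : ℝ) (x : E n) : ℝ≥0∞ :=
  if 0 < 1 - α * ‖x‖ ^ 2 / 2 then ENNReal.ofReal ((1 - α * ‖x‖ ^ 2 / 2) ^ ((1 - α) / α)) else 0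

/-- The standard Gaussian measure on `ℝⁿ`. -/
def gaussian (n : ℕ) : Measure (E n) :=
  volume.withDensity fun x =>
    ENNReal.ofReal ((2 * Real.pi) ^ (-(n : ℝ) / 2) * Real.exp (-‖x‖ ^ 2 / 2))

/-- The support function of a set. -/
def suppFun (K : Set (E n)) (v : E n) : ℝ := sSup ((fun x => inner ℝ x v) '' K)

/-- The mean width `w(K) = 2 ∫ h_K dσ`, with `σ` the normalized surface measure of the unit sphere
(so the integral is an average). The empty set gets mean width `0`. -/
def meanWidth (K : Set (E n)) : ℝ :=
  2 * ⨍ v : Metric.sphere (0 : E n) 1, suppFun K v ∂((volume : Measure (E n)).toSphere)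

/-- The `α`-mean width, for `α ∈ [-∞,+∞)`; at `α = +∞`, where the notion is not defined, the
value is irrelevant. -/
def alphaMeanWidth (α : EReal) (f : E n → ℝ≥0∞) : EReal :=
  if α = ⊥ then ((∫⁻ t in Ioi (0 : ℝ), ENNReal.ofReal (meanWidth (superlevel t f)) : ℝ≥0∞) : EReal)
  else if α = ⊤ then 0
  else if α = 0 then ((2 / n : ℝ) : EReal) * extIntegral (gaussian n) (alphaSupport 0 f)
  else extIntegral (volume.withDensity (weight α.toReal)) (alphaSupport α.toReal f)

end MinkSymm

end

noncomputable section

namespace MinkSymm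

/-! ### The midpoint mean -/

/-! Everything rests on one formula, `symm_apply`: for every exponent the symmetral at `x` is the
supremum of the equal-weight means of `f y` and `f z` over the pairs with `x` the midpoint of `y`
and the mirror image of `z`. The pairs range over the effective domain of the base function. For
positive exponents this is the closed support, so boundary points at which `f` vanishes still
compete; elsewhere the base function is `+∞` and contributes nothing. Upper semicontinuity and
compactness make the supremum a maximum (`Tame.exists_eq`). Monotonicity, symmetry, idempotence,
invariance of symmetric functions, projections and superlevel sets then follow from the algebra of
means: they are monotone, symmetric, idempotent and medial.

Mean width: base values average affinely under the mean, so the support function of the symmetral at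
`ξ` is half the sum of that of `f` at `ξ` and at the reflected point (`alphaSupport_symm`). Radial
weights are reflection invariant. The only danger is an infinite positive part that cancels in the
average; a full-dimensional support gives a linearly growing lower bound that excludes this
(`lintegral_halfSum_eq_top`). For `-∞` the same linearity is used on superlevel sets.

Mass: means increase with the exponent, so it suffices to treat `-1/n`. This is the
Borell–Brascamp–Lieb inequality, proved by induction on the dimension from the one-dimensional
Brunn–Minkowski inequality. `MeanStep` records what one integration needs; each integration turns
the exponent `-1/(k+1)` into `-1/k`, and the last one into `-∞`. The function and its reflection
have the same mass, so the final minimum is that mass.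

Equality at exponent zero: the same scheme gives Prékopa–Leindler, hence log-concave marginals in
every direction. On the line, comparing quantiles forces the two marginals to be translates
(`exists_map_add_eq_withDensity`). The shifts are the components of one vector, the difference of
the barycentres, and characteristic functions show that the two measures are translates
(`exists_map_add_eq`). Log-concavity and upper semicontinuity upgrade almost everywhere equality to
equality (`LogConcave.le_of_ae_eq`). -/

/-- The `α`-mean with equal weights. -/
def midMean (α : EReal) (a b : ℝ≥0∞) : ℝ≥0∞ := alphaMean α (1 / 2) (1 / 2) a b

@[simp] lemma midMean_bot (a b : ℝ≥0∞) : midMean ⊥ a b = min a b := by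
  simp [midMean, alphaMean]

@[simp] lemma midMean_top (a b : ℝ≥0∞) : midMean ⊤ a b = max a b := by
  simp [midMean, alphaMean]

lemma midMean_zero (a b : ℝ≥0∞) : midMean 0 a b = a ^ (2⁻¹ : ℝ) * b ^ (2⁻¹ : ℝ) := by
  simp [midMean, alphaMean]

lemma midMean_coe {p : ℝ} (hp : p ≠ 0) (a b : ℝ≥0∞) :
    midMean p a b = (2⁻¹ * a ^ p + 2⁻¹ * b ^ p) ^ p⁻¹ := by
  simp [midMean, alphaMean, hp]

/-- Case distinction on the exponent of a mean. -/
lemma exponent_cases {P : EReal → Prop} (α : EReal) (hbot : P ⊥) (htop : P ⊤) (hzero : P 0)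
    (hcoe : ∀ p : ℝ, p ≠ 0 → P p) : P α := by
  induction α with
  | bot => exact hbot
  | top => exact htop
  | coe p =>
    by_cases hp : p = 0
    · subst hp; exact hzero
    · exact hcoe p hp

lemma midMean_comm (α : EReal) (a b : ℝ≥0∞) : midMean α a b = midMean α b a := by
  induction α using exponent_cases with
  | hbot => simp [min_comm]
  | htop => simp [max_comm]
  | hzero => simp [midMean_zero, mul_comm]
  | hcoe p hp => simp [midMean_coe hp, add_comm]

lemma half_mul_add_half_mul (a : ℝ≥0∞) : 2⁻¹ * a + 2⁻¹ * a = a := by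
  rw [← add_mul, ENNReal.inv_two_add_inv_two, one_mul]

lemma midMean_self (α : EReal) (a : ℝ≥0∞) : midMean α a a = a := by
  induction α using exponent_cases with
  | hbot => simp
  | htop => simp
  | hzero =>
    rw [midMean_zero, ← ENNReal.rpow_add_of_nonneg _ _ (by norm_num) (by norm_num)]
    norm_num
  | hcoe p hp => rw [midMean_coe hp, half_mul_add_half_mul, ENNReal.rpow_rpow_inv hp]

lemma rpow_le_rpow_of_nonpos {a b : ℝ≥0∞} {p : ℝ} (hp : p ≤ 0) (h : a ≤ b) : b ^ p ≤ a ^ p := by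
  obtain ⟨q, rfl⟩ : ∃ q, p = -q := ⟨-p, by simp⟩
  rw [ENNReal.rpow_neg, ENNReal.rpow_neg, ENNReal.inv_le_inv]
  exact ENNReal.rpow_le_rpow h (by linarith)

lemma midMean_mono (α : EReal) {a b c d : ℝ≥0∞} (hac : a ≤ c) (hbd : b ≤ d) :
    midMean α a b ≤ midMean α c d := by
  induction α using exponent_cases with
  | hbot => simpa using ⟨.inl hac, .inr hbd⟩
  | htop => rw [midMean_top, midMean_top]; exact max_le_max hac hbd
  | hzero => rw [midMean_zero, midMean_zero]; gcongr
  | hcoe p hp =>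
    rw [midMean_coe hp, midMean_coe hp]
    rcases lt_or_gt_of_ne hp with h | h
    · refine rpow_le_rpow_of_nonpos (by simpa using h.le) ?_
      exact add_le_add (mul_le_mul' le_rfl (rpow_le_rpow_of_nonpos h.le hac))
        (mul_le_mul' le_rfl (rpow_le_rpow_of_nonpos h.le hbd))
    · gcongr

/-- For real nonzero exponents the mean is the arithmetic mean conjugated by a power, so both sides
average the same four powers. This regrouping is what carries concavity over to the symmetral. -/
lemma midMean_medial (α : EReal) (a b c d : ℝ≥0∞) :
    midMean α (midMean α a b) (midMean α c d) = midMean α (midMean α a c) (midMean α b d) := by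
  induction α using exponent_cases with
  | hbot => simp only [midMean_bot]; exact min_min_min_comm ..
  | htop => simp only [midMean_top]; exact max_max_max_comm ..
  | hzero =>
    simp only [midMean_zero]
    repeat rw [ENNReal.mul_rpow_of_nonneg _ _ (by norm_num : (0 : ℝ) ≤ 2⁻¹)]
    ring
  | hcoe p hp =>
    simp only [midMean_coe hp, ENNReal.rpow_inv_rpow hp]
    congr 1
    ring

lemma le_midMean_of_le (α : EReal) {a b c : ℝ≥0∞} (ha : c ≤ a) (hb : c ≤ b) :
    c ≤ midMean α a b := by
  rw [← midMean_self α c]; exact midMean_mono α ha hb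

lemma midMean_le_of_le (α : EReal) {a b c : ℝ≥0∞} (ha : a ≤ c) (hb : b ≤ c) :
    midMean α a b ≤ c := by
  rw [← midMean_self α c]; exact midMean_mono α ha hb

lemma midMean_pos (α : EReal) {a b : ℝ≥0∞} (ha : 0 < a) (hb : 0 < b) : 0 < midMean α a b :=
  (lt_min ha hb).trans_le (le_midMean_of_le α (min_le_left _ _) (min_le_right _ _))

/-- Finiteness matters only for the exponent zero, where the product `0 * ∞` breaks continuity. -/
lemma continuousAt_midMean (α : EReal) {a b : ℝ≥0∞} (ha : a ≠ ∞) (hb : b ≠ ∞) :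
    ContinuousAt (fun p : ℝ≥0∞ × ℝ≥0∞ => midMean α p.1 p.2) (a, b) := by
  induction α using exponent_cases with
  | hbot => simp only [midMean_bot]; fun_prop
  | htop => simp only [midMean_top]; fun_prop
  | hzero =>
    simp only [midMean_zero]
    refine ENNReal.Tendsto.mul (b := b ^ (2⁻¹ : ℝ)) ?_ (.inr ?_) ?_ (.inr ?_)
    · exact (ENNReal.continuous_rpow_const.comp continuous_fst).continuousAt
    · exact ENNReal.rpow_ne_top_of_nonneg (by norm_num) hb
    · exact (ENNReal.continuous_rpow_const.comp continuous_snd).continuousAt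
    · exact ENNReal.rpow_ne_top_of_nonneg (by norm_num) ha
  | hcoe p hp =>
    simp only [midMean_coe hp]
    have h1 : Continuous fun q : ℝ≥0∞ × ℝ≥0∞ => 2⁻¹ * q.1 ^ p :=
      (ENNReal.continuous_const_mul (by simp)).comp
        (ENNReal.continuous_rpow_const.comp continuous_fst)
    have h2 : Continuous fun q : ℝ≥0∞ × ℝ≥0∞ => 2⁻¹ * q.2 ^ p :=
      (ENNReal.continuous_const_mul (by simp)).comp
        (ENNReal.continuous_rpow_const.comp continuous_snd)
    exact (ENNReal.continuous_rpow_const.comp (h1.add h2)).continuousAt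

lemma midMean_zero_left {α : EReal} (hα : α ≤ 0) (b : ℝ≥0∞) : midMean α 0 b = 0 := by
  induction α using exponent_cases with
  | hbot => simp
  | htop => simp at hα
  | hzero => simp [midMean_zero]
  | hcoe p hp =>
    have h : p < 0 := lt_of_le_of_ne (by exact_mod_cast hα) hp
    rw [midMean_coe hp, ENNReal.zero_rpow_of_neg h, ENNReal.mul_top (by simp), top_add,
      ENNReal.top_rpow_of_neg (by simpa using h)]

lemma midMean_pos_left {α : EReal} (hα : 0 < α) {a : ℝ≥0∞} (ha : 0 < a) (ha' : a ≠ ∞) :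
    0 < midMean α a 0 := by
  induction α using exponent_cases with
  | hbot => simp at hα
  | htop => simpa using ha
  | hzero => simp at hα
  | hcoe p hp =>
    have h : 0 < p := by exact_mod_cast hα
    rw [midMean_coe hp, ENNReal.zero_rpow_of_pos h, mul_zero, add_zero]
    refine ENNReal.rpow_pos ?_ ?_
    · exact ENNReal.mul_pos (by simp) (ENNReal.rpow_pos ha ha').ne'
    · exact ENNReal.mul_ne_top (by simp) (ENNReal.rpow_ne_top_of_nonneg h.le ha')

/-- For `α ≤ 0`, a lower bound on the mean of bounded numbers bounds these numbers from below. -/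
lemma exists_le_of_le_midMean {α : EReal} (hα : α ≤ 0) {C t : ℝ≥0∞} (hC : C ≠ ∞) (ht : 0 < t) :
    ∃ δ > 0, ∀ a b, a ≤ C → b ≤ C → t ≤ midMean α a b → δ ≤ a ∧ δ ≤ b := by
  have h0 : ContinuousAt (fun a : ℝ≥0∞ => midMean α a C) 0 :=
    ContinuousAt.comp (f := fun a : ℝ≥0∞ => (a, C)) (x := 0)
      (continuousAt_midMean α ENNReal.zero_ne_top hC) (by fun_prop)
  have h1 : ∀ᶠ a in 𝓝 (0 : ℝ≥0∞), midMean α a C < t :=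
    h0.eventually_lt continuousAt_const (by rwa [midMean_zero_left hα])
  obtain ⟨δ, hδ, h2⟩ := (ENNReal.nhds_zero_basis.eventually_iff).1 h1
  refine ⟨δ, hδ, fun a b ha hb h => ⟨?_, ?_⟩⟩
  · by_contra! hlt
    exact (h.trans (midMean_mono α le_rfl hb)).not_gt (h2 hlt)
  · by_contra! hlt
    rw [midMean_comm] at h
    exact (h.trans (midMean_mono α le_rfl ha)).not_gt (h2 hlt)

lemma geom_mean_le_half_add_half (a b : ℝ≥0∞) :
    a ^ (2⁻¹ : ℝ) * b ^ (2⁻¹ : ℝ) ≤ 2⁻¹ * a + 2⁻¹ * b := by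
  by_cases ha : a = ∞
  · simp [ha]
  by_cases hb : b = ∞
  · simp [hb]
  lift a to ℝ≥0 using ha
  lift b to ℝ≥0 using hb
  have := NNReal.geom_mean_le_arith_mean2_weighted (1 / 2) (1 / 2) a b (by norm_num)
  rw [← ENNReal.coe_le_coe] at this
  simpa [ENNReal.coe_rpow_of_nonneg] using this

/-- AM–GM for `a ^ (-q)` and `b ^ (-q)`, reversed by raising to the negative power `-1/q`. -/
lemma midMean_neg_le_midMean_zero {q : ℝ} (hq : 0 < q) {a b : ℝ≥0∞} (ha : a ≠ ∞) (hb : b ≠ ∞) :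
    midMean ((-q : ℝ) : EReal) a b ≤ midMean 0 a b := by
  rcases eq_or_ne a 0 with rfl | ha0
  · rw [midMean_zero_left (by exact_mod_cast (neg_lt_zero.2 hq).le)]; exact zero_le
  rcases eq_or_ne b 0 with rfl | hb0
  · rw [midMean_comm, midMean_zero_left (by exact_mod_cast (neg_lt_zero.2 hq).le)]
    exact zero_le
  rw [midMean_coe (neg_ne_zero.2 hq.ne'), midMean_zero]
  have h := rpow_le_rpow_of_nonpos (p := (-q)⁻¹) (by simpa using hq.le)
    (geom_mean_le_half_add_half (a ^ (-q)) (b ^ (-q)))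
  refine h.trans_eq ?_
  rw [ENNReal.mul_rpow_of_ne_zero]
  · simp only [← ENNReal.rpow_mul]
    congr 2 <;> field_simp
  · simp [ha0, ha]
  · simp [hb0, hb]

lemma midMean_zero_le_midMean {q : ℝ} (hq : 0 < q) (a b : ℝ≥0∞) :
    midMean 0 a b ≤ midMean (q : EReal) a b := by
  rw [midMean_coe hq.ne', midMean_zero]
  have h := ENNReal.rpow_le_rpow (z := q⁻¹) (geom_mean_le_half_add_half (a ^ q) (b ^ q))
    (by simpa using hq.le)
  refine le_trans (le_of_eq ?_) h
  rw [ENNReal.mul_rpow_of_nonneg _ _ (by simpa using hq.le)]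
  simp only [← ENNReal.rpow_mul]
  congr 2 <;> field_simp

/-- The means increase with the exponent. -/
lemma midMean_neg_le {q : ℝ} (hq : 0 < q) {α : EReal} (hα : ((-q : ℝ) : EReal) ≤ α)
    {a b : ℝ≥0∞} (ha : a ≠ ∞) (hb : b ≠ ∞) :
    midMean ((-q : ℝ) : EReal) a b ≤ midMean α a b := by
  induction α using exponent_cases with
  | hbot => simp at hα
  | htop =>
    rw [midMean_top]
    exact midMean_le_of_le _ (le_max_left _ _) (le_max_right _ _)
  | hzero => exact midMean_neg_le_midMean_zero hq ha hb
  | hcoe p hp =>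
    rcases lt_or_gt_of_ne hp with h | h
    · have hqp : -q ≤ p := by exact_mod_cast hα
      rw [midMean_coe hp, midMean_coe (neg_ne_zero.2 hq.ne')]
      -- Both exponents are negative here: convexity of the power `q / -p` is applied to `a ^ p` and
      -- `b ^ p`, and the negative outer exponent reverses the inequality.
      have h1 : 1 ≤ q / -p := by rw [le_div_iff₀ (by linarith)]; linarith
      have h2 := ENNReal.rpow_arith_mean_le_arith_mean2_rpow 2⁻¹ 2⁻¹ (a ^ p) (b ^ p)
        ENNReal.inv_two_add_inv_two h1
      have h3 := rpow_le_rpow_of_nonpos (p := (-q)⁻¹) (by simpa using hq.le) h2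
      rw [← ENNReal.rpow_mul, ← ENNReal.rpow_mul, ← ENNReal.rpow_mul] at h3
      have e1 : p * (q / -p) = -q := by field_simp
      have e2 : q / -p * (-q)⁻¹ = p⁻¹ := by field_simp
      rwa [e1, e2] at h3
    · exact (midMean_neg_le_midMean_zero hq ha hb).trans (midMean_zero_le_midMean h a b)

/-! ### The reflection -/

variable {n : ℕ}

/-- The reflection in `u^⊥` as a linear isometry. -/
def reflIso (u : E n) : E n ≃ₗᵢ[ℝ] E n := (Submodule.span ℝ {u})ᗮ.reflection

lemma reflIso_apply {u : E n} (hu : ‖u‖ = 1) (x : E n) : reflIso u x = reflPt u x := by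
  rw [reflIso, Submodule.reflection_orthogonal_apply, Submodule.reflection_singleton_apply,
    reflPt, hu, real_inner_comm]
  simp only [RCLike.ofReal_real_eq_id, id, one_pow, div_one, neg_sub, mul_smul, ← ofNat_smul_eq_nsmul ℝ]

lemma reflPt_eq {u : E n} (hu : ‖u‖ = 1) : reflPt u = reflIso u :=
  funext fun x => (reflIso_apply hu x).symm

@[simp] lemma reflIso_reflIso (u x : E n) : reflIso u (reflIso u x) = x := by
  simp [reflIso]

lemma refl_eq {u : E n} (hu : ‖u‖ = 1) (f : E n → ℝ≥0∞) : refl u f = f ∘ reflIso u := by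
  funext x; simp [refl, reflPt_eq hu]

/-! ### A uniform formula for the symmetral -/

/-- The effective domain of the base function. -/
def dom (α : EReal) (f : E n → ℝ≥0∞) : Set (E n) := if 0 < α then closure (supp f) else supp f

lemma dom_of_pos {α : EReal} (hα : 0 < α) (f : E n → ℝ≥0∞) : dom α f = closure (supp f) :=
  if_pos hα

lemma dom_of_nonpos {α : EReal} (hα : α ≤ 0) (f : E n → ℝ≥0∞) : dom α f = supp f :=
  if_neg hα.not_gt

lemma supp_subset_dom (α : EReal) (f : E n → ℝ≥0∞) : supp f ⊆ dom α f := by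
  unfold dom; split_ifs
  exacts [subset_closure, subset_rfl]

lemma eq_zero_of_notMem_dom {α : EReal} {f : E n → ℝ≥0∞} {x : E n} (hx : x ∉ dom α f) :
    f x = 0 := by
  by_contra h
  exact hx (supp_subset_dom α f (pos_iff_ne_zero.2 h))

lemma dom_mono (α : EReal) {f g : E n → ℝ≥0∞} (h : ∀ x, f x ≤ g x) : dom α f ⊆ dom α g := by
  have : supp f ⊆ supp g := fun x hx => lt_of_lt_of_le hx (h x)
  unfold dom; split_ifs
  exacts [closure_mono this, this]

lemma mem_dom_comp_iff (α : EReal) (f : E n → ℝ≥0∞) (e : E n ≃ₜ E n) (x : E n) :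
    x ∈ dom α (f ∘ e) ↔ e x ∈ dom α f := by
  have h : supp (f ∘ e) = e ⁻¹' supp f := rfl
  unfold dom; split_ifs
  · rw [h, ← e.preimage_closure]; rfl
  · rw [h]; rfl

open Classical in
/-- The mean of `f y` and `f z` if both points lie in the effective domain, and zero otherwise. -/
def pairMean (α : EReal) (f : E n → ℝ≥0∞) (y z : E n) : ℝ≥0∞ :=
  if y ∈ dom α f ∧ z ∈ dom α f then midMean α (f y) (f z) else 0

lemma pairMean_of_mem {α : EReal} {f : E n → ℝ≥0∞} {y z : E n} (hy : y ∈ dom α f)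
    (hz : z ∈ dom α f) : pairMean α f y z = midMean α (f y) (f z) := if_pos ⟨hy, hz⟩

/-- The base function as a function of the value. -/
def baseVal (p : ℝ) (a : ℝ≥0∞) : ℝ :=
  if p = 0 then -Real.log a.toReal else (1 - a.toReal ^ p) / p

/-- The value belonging to a value of the base function. -/
def valOfBase (p : ℝ) (t : EReal) : ℝ≥0∞ :=
  if p = 0 then EReal.exp (-t) else (1 - (p : EReal) * t).toENNReal ^ (1 / p)

lemma valOfBase_top (p : ℝ) : valOfBase p ⊤ = 0 := by
  unfold valOfBase
  split_ifs with h
  · simp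
  · rcases lt_or_gt_of_ne h with h | h
    · rw [EReal.coe_mul_top_of_neg h, EReal.sub_bot (by decide)]
      simp [h]
    · rw [EReal.coe_mul_top_of_pos h, EReal.sub_top]
      simp [h]

lemma valOfBase_coe {p : ℝ} (hp : p ≠ 0) (r : ℝ) :
    valOfBase p r = ENNReal.ofReal (1 - p * r) ^ (1 / p) := by
  unfold valOfBase
  rw [if_neg hp]
  norm_cast

lemma valOfBase_zero_coe (r : ℝ) : valOfBase 0 r = ENNReal.ofReal (Real.exp (-r)) := by
  unfold valOfBase
  rw [if_pos rfl]
  norm_cast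

lemma continuous_valOfBase (p : ℝ) : Continuous (valOfBase p) := by
  unfold valOfBase
  by_cases hp : p = 0
  · simp only [hp, if_true]
    exact ENNReal.continuous_exp.comp continuous_neg
  · simp only [hp, if_false]
    refine ENNReal.continuous_rpow_const.comp (EReal.continuous_toENNReal.comp ?_)
    have h1 : Continuous fun t : EReal => (p : EReal) * t := by
      rw [continuous_iff_continuousAt]
      intro t
      have hp' : (p : EReal) ≠ 0 := by exact_mod_cast hp
      exact ContinuousAt.comp (f := fun t : EReal => ((p : EReal), t)) (x := t)
        (EReal.continuousAt_mul (.inl hp') (.inl hp') (.inl (EReal.coe_ne_bot p))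
          (.inl (EReal.coe_ne_top p))) (by fun_prop)
    have one_ne_top : (1 : EReal) ≠ ⊤ := by decide
    have one_ne_bot : (1 : EReal) ≠ ⊥ := by decide
    have h2 : Continuous fun t : EReal => 1 + -t := by
      rw [continuous_iff_continuousAt]
      intro t
      exact ContinuousAt.comp (f := fun t : EReal => ((1 : EReal), -t)) (x := t)
        (EReal.continuousAt_add (.inl one_ne_top) (.inl one_ne_bot))
        (by fun_prop)
    simp only [sub_eq_add_neg]
    exact h2.comp h1

lemma valOfBase_antitone (p : ℝ) : Antitone (valOfBase p) := by
  intro s t hst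
  unfold valOfBase
  split_ifs with hp
  · exact EReal.exp_monotone (EReal.neg_le_neg_iff.2 hst)
  · rcases lt_or_gt_of_ne hp with h | h
    · refine rpow_le_rpow_of_nonpos (by simpa using h.le) (EReal.toENNReal_le_toENNReal ?_)
      refine EReal.sub_le_sub le_rfl ?_
      rw [← neg_neg (p : EReal), EReal.neg_mul, EReal.neg_mul (-(p : EReal)), EReal.neg_le_neg_iff]
      refine mul_le_mul_of_nonneg_left hst ?_
      exact_mod_cast (neg_pos.2 h).le
    · refine ENNReal.rpow_le_rpow (EReal.toENNReal_le_toENNReal ?_) (by positivity)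
      refine EReal.sub_le_sub le_rfl (mul_le_mul_of_nonneg_left hst ?_)
      exact_mod_cast h.le

/-- An antitone continuous map sending `⊤` to `0` turns the infimal convolution into a supremum. -/
lemma valOfBase_iInf (p : ℝ) {ι : Type*} [Nonempty ι] (t : ι → EReal) :
    valOfBase p (⨅ i, t i) = ⨆ i, valOfBase p (t i) :=
  (valOfBase_antitone p).map_iInf_of_continuousAt (continuous_valOfBase p).continuousAt
    (valOfBase_top p)

/-- A value at which the base function is finite. -/
def Admissible (p : ℝ) (a : ℝ≥0∞) : Prop := a ≠ ∞ ∧ (p ≤ 0 → a ≠ 0)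

/-- The base value is affine in the `p`-th power (in the logarithm for `p = 0`), so averaging base
values averages powers. -/
lemma valOfBase_half_add {p : ℝ} {a b : ℝ≥0∞} (ha : Admissible p a) (hb : Admissible p b) :
    valOfBase p ((2⁻¹ * baseVal p a + 2⁻¹ * baseVal p b : ℝ) : EReal) = midMean p a b := by
  obtain ⟨ha, ha0⟩ := ha
  obtain ⟨hb, hb0⟩ := hb
  by_cases hp : p = 0
  · subst hp
    have ha1 := ENNReal.toReal_pos (ha0 le_rfl) ha
    have hb1 := ENNReal.toReal_pos (hb0 le_rfl) hb
    rw [valOfBase_zero_coe, EReal.coe_zero, midMean_zero]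
    simp only [baseVal, if_true]
    rw [← ENNReal.ofReal_toReal ha, ← ENNReal.ofReal_toReal hb, ENNReal.ofReal_rpow_of_pos ha1,
      ENNReal.ofReal_rpow_of_pos hb1, ← ENNReal.ofReal_mul (by positivity)]
    simp only [ENNReal.toReal_ofReal ha1.le, ENNReal.toReal_ofReal hb1.le]
    rw [Real.rpow_def_of_pos ha1, Real.rpow_def_of_pos hb1, ← Real.exp_add]
    congr 2; ring
  · rw [valOfBase_coe hp, midMean_coe hp, one_div]
    congr 1
    simp only [baseVal, hp, if_false]
    have h1 : 1 - p * (2⁻¹ * ((1 - a.toReal ^ p) / p) + 2⁻¹ * ((1 - b.toReal ^ p) / p))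
        = 2⁻¹ * a.toReal ^ p + 2⁻¹ * b.toReal ^ p := by
      field_simp; ring
    have key : ∀ c : ℝ≥0∞, c ≠ ∞ → (p ≤ 0 → c ≠ 0) → ENNReal.ofReal (c.toReal ^ p) = c ^ p := by
      intro c hc hc0
      rw [← ENNReal.ofReal_toReal (a := c ^ p), ENNReal.toReal_rpow]
      rcases lt_or_gt_of_ne hp with h | h
      · exact ENNReal.rpow_ne_top_of_nonneg' (pos_iff_ne_zero.2 (hc0 h.le)) hc
      · exact ENNReal.rpow_ne_top_of_nonneg h.le hc
    rw [h1, ENNReal.ofReal_add (by positivity) (by positivity), ENNReal.ofReal_mul (by norm_num),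
      ENNReal.ofReal_mul (by norm_num), key a ha ha0, key b hb hb0,
      ENNReal.ofReal_inv_of_pos (by norm_num), ENNReal.ofReal_ofNat]

/-- The value of the homothety with factor `1/2`. -/
lemma valOfBase_half {p : ℝ} {a : ℝ≥0∞} :
    0 < valOfBase p ((2⁻¹ * baseVal p a : ℝ) : EReal) ∧
    valOfBase p ((2⁻¹ * baseVal p a : ℝ) : EReal) ≠ ∞ ∧
    baseVal p (valOfBase p ((2⁻¹ * baseVal p a : ℝ) : EReal)) = 2⁻¹ * baseVal p a := by
  by_cases hp : p = 0
  · subst hp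
    rw [valOfBase_zero_coe]
    refine ⟨by simp [Real.exp_pos], by simp, ?_⟩
    rw [baseVal, if_pos rfl, ENNReal.toReal_ofReal (Real.exp_pos _).le, Real.log_exp, neg_neg]
  · set r := 2⁻¹ * baseVal p a with hr
    have h1 : 0 < 1 - p * r := by
      have : 1 - p * r = 2⁻¹ + 2⁻¹ * a.toReal ^ p := by
        rw [hr]; simp only [baseVal, hp, if_false]; field_simp; ring
      rw [this]; positivity
    rw [valOfBase_coe hp, ENNReal.ofReal_rpow_of_pos h1]
    refine ⟨by simpa using Real.rpow_pos_of_pos h1 _, by simp, ?_⟩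
    rw [baseVal, if_neg hp, ENNReal.toReal_ofReal (by positivity), one_div,
      Real.rpow_inv_rpow h1.le hp]
    field_simp; ring

lemma base_of_mem_dom {p : ℝ} {f : E n → ℝ≥0∞} (hf : ∀ x, f x < ∞) {x : E n} (hx : x ∈ dom p f) :
    base p f x = baseVal p (f x) := by
  unfold base baseVal
  by_cases hp : p = 0
  · subst hp
    have hx0 : 0 < f x := by rwa [dom_of_nonpos (by simp)] at hx
    simp only [if_true]
    rw [ENNReal.log_pos_real hx0.ne' (hf x).ne]
    simp
  · have hx' : x ∈ closure (supp f) := by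
      unfold dom at hx; split_ifs at hx
      exacts [hx, subset_closure hx]
    rw [if_neg hp, if_pos hx', if_neg hp]
    have hne : f x ^ p ≠ ∞ := by
      rcases lt_or_gt_of_ne hp with h | h
      · rw [dom_of_nonpos (by exact_mod_cast h.le)] at hx
        exact ENNReal.rpow_ne_top_of_nonneg' hx (hf x).ne
      · exact ENNReal.rpow_ne_top_of_nonneg h.le (hf x).ne
    rw [← EReal.coe_ennreal_toReal hne, ← ENNReal.toReal_rpow]
    norm_cast

lemma base_of_notMem_dom {p : ℝ} {f : E n → ℝ≥0∞} {x : E n} (hx : x ∉ dom p f) :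
    base p f x = ⊤ := by
  have h0 := eq_zero_of_notMem_dom hx
  unfold base
  by_cases hp : p = 0
  · simp [hp, h0]
  · rw [if_neg hp]
    split_ifs with hc
    · rcases lt_or_gt_of_ne hp with h | h
      · rw [h0, ENNReal.zero_rpow_of_neg h, EReal.coe_ennreal_top, EReal.sub_top]
        exact EReal.bot_div_of_neg_ne_bot (by exact_mod_cast h) (by simp)
      · rw [dom_of_pos (by exact_mod_cast h)] at hx
        exact absurd hc hx
    · rfl

lemma admissible_of_mem_dom {p : ℝ} {f : E n → ℝ≥0∞} (hf : ∀ x, f x < ∞) {x : E n}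
    (hx : x ∈ dom p f) : Admissible p (f x) := by
  refine ⟨(hf x).ne, fun hp => ?_⟩
  rw [dom_of_nonpos (by exact_mod_cast hp)] at hx
  exact (show 0 < f x from hx).ne'

lemma homothety_half_of_mem {p : ℝ} {f : E n → ℝ≥0∞} (hf : ∀ x, f x < ∞) {x : E n}
    (hx : (2 : ℝ) • x ∈ dom p f) :
    homothety p (1 / 2) f x = valOfBase p ((2⁻¹ * baseVal p (f ((2 : ℝ) • x)) : ℝ) : EReal) := by
  show valOfBase p (epiMul (1 / 2) (base p f) x) = _
  rw [epiMul, one_div, inv_inv, base_of_mem_dom hf hx, EReal.coe_mul]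

lemma homothety_half_of_notMem {p : ℝ} {f : E n → ℝ≥0∞} {x : E n}
    (hx : (2 : ℝ) • x ∉ dom p f) : homothety p (1 / 2) f x = 0 := by
  show valOfBase p (epiMul (1 / 2) (base p f) x) = _
  rw [epiMul, one_div, inv_inv, base_of_notMem_dom hx, EReal.coe_mul_top_of_pos (by norm_num),
    valOfBase_top]

/-- For `p > 0` a boundary zero of `f` has base value `1/p`; halving it gives a positive value
again. The support of the homothety is therefore the whole rescaled effective domain. -/
lemma mem_supp_homothety_half {p : ℝ} {f : E n → ℝ≥0∞} (hf : ∀ x, f x < ∞) {x : E n} :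
    x ∈ supp (homothety p (1 / 2) f) ↔ (2 : ℝ) • x ∈ dom p f := by
  by_cases hx : (2 : ℝ) • x ∈ dom p f
  · simp only [hx, iff_true, supp, mem_ofPred_eq, homothety_half_of_mem hf hx]
    exact valOfBase_half.1
  · simp only [hx, supp, mem_ofPred_eq, homothety_half_of_notMem hx, lt_irrefl]

/-- For `p > 0` the new support is already closed, so taking the closure in `dom` a second time adds
no point. -/
lemma mem_dom_homothety_half {p : ℝ} {f : E n → ℝ≥0∞} (hf : ∀ x, f x < ∞) {x : E n} :
    x ∈ dom p (homothety p (1 / 2) f) ↔ (2 : ℝ) • x ∈ dom p f := by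
  have h : supp (homothety p (1 / 2) f) = (fun x : E n => (2 : ℝ) • x) ⁻¹' dom p f :=
    Set.ext fun x => mem_supp_homothety_half hf
  rcases lt_or_ge (0 : EReal) p with hp | hp
  · have : IsClosed (dom p f) := by rw [dom_of_pos hp]; exact isClosed_closure
    rw [dom_of_pos hp, h, (this.preimage (by fun_prop)).closure_eq]
    rfl
  · rw [dom_of_nonpos hp, h]
    rfl

lemma base_homothety_half_of_mem {p : ℝ} {f : E n → ℝ≥0∞} (hf : ∀ x, f x < ∞) {x : E n}
    (hx : (2 : ℝ) • x ∈ dom p f) :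
    base p (homothety p (1 / 2) f) x = ((2⁻¹ * baseVal p (f ((2 : ℝ) • x)) : ℝ) : EReal) := by
  have hfin : ∀ x, homothety p (1 / 2) f x < ∞ := by
    intro x
    by_cases hx : (2 : ℝ) • x ∈ dom p f
    · rw [homothety_half_of_mem hf hx]; exact valOfBase_half.2.1.lt_top
    · rw [homothety_half_of_notMem hx]; simp
  rw [base_of_mem_dom hfin ((mem_dom_homothety_half hf).2 hx), homothety_half_of_mem hf hx,
    valOfBase_half.2.2]

lemma base_homothety_half_of_notMem {p : ℝ} {f : E n → ℝ≥0∞} (hf : ∀ x, f x < ∞) {x : E n}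
    (hx : (2 : ℝ) • x ∉ dom p f) : base p (homothety p (1 / 2) f) x = ⊤ :=
  base_of_notMem_dom (by rwa [mem_dom_homothety_half hf])

lemma mem_dom_refl {α : EReal} {u : E n} (hu : ‖u‖ = 1) {f : E n → ℝ≥0∞} {x : E n} :
    x ∈ dom α (refl u f) ↔ reflIso u x ∈ dom α f := by
  rw [refl_eq hu]
  exact mem_dom_comp_iff α f (reflIso u).toHomeomorph x

/-- The symmetral as a supremum of means. -/
lemma symm_apply {α : EReal} {u : E n} (hu : ‖u‖ = 1) {f : E n → ℝ≥0∞} (hf : ∀ x, f x < ∞)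
    (hcl : α = ⊤ → IsClosed (supp f)) (x : E n) :
    symm α u f x = ⨆ y, pairMean α f y (reflIso u ((2 : ℝ) • x - y)) := by
  have hsurj : Function.Surjective fun y : E n => (2 : ℝ) • y :=
    fun y => ⟨(2⁻¹ : ℝ) • y, by simp⟩
  -- Substituting `2y` for `y` matches the dilation hidden in the factor `1/2` of the homotheties.
  rw [← hsurj.iSup_comp]
  simp only [← smul_sub]
  induction α with
  | bot =>
    rw [symm, if_pos rfl]
    simp only [oplusBot, timesInf, refl_eq hu, one_div, inv_inv, Function.comp]
    refine iSup_congr fun y => ?_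
    unfold pairMean
    rw [dom_of_nonpos bot_le, midMean_bot]
    split_ifs with h
    · rfl
    · simp only [supp, mem_ofPred_eq, pos_iff_ne_zero, not_and_or, not_not] at h
      rcases h with h | h <;> simp only [h, min_eq_left, min_eq_right, zero_le]
  | top =>
    rw [symm, if_neg (by decide), if_pos rfl]
    simp only [oplusTop, timesInf, refl_eq hu, one_div, inv_inv, Function.comp, supp, mem_ofPred_eq]
    refine iSup_congr fun y => ?_
    unfold pairMean
    -- The definition at `+∞` uses the support, the formula its closure; closedness of the support
    -- reconciles them.
    rw [dom_of_pos (by simp), (hcl rfl).closure_eq, midMean_top]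
    by_cases h1 : (2 : ℝ) • y ∈ supp f
    · by_cases h2 : reflIso u ((2 : ℝ) • (x - y)) ∈ supp f
      · rw [if_pos ⟨h1, h2⟩]
        exact (iSup_pos h1).trans (iSup_pos h2)
      · rw [if_neg fun h => h2 h.2]
        exact (iSup_pos h1).trans (iSup_neg h2)
    · rw [if_neg fun h => h1 h.1]
      exact iSup_neg h1
  | coe p =>
    rw [symm, if_neg (by simp), if_neg (by simp), EReal.toReal_coe]
    show valOfBase p (infConv _ _ x) = _
    rw [infConv, valOfBase_iInf]
    have hf' : ∀ x, refl u f x < ∞ := fun x => hf _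
    refine iSup_congr fun y => ?_
    unfold pairMean
    by_cases h1 : (2 : ℝ) • y ∈ dom p f
    · by_cases h2 : reflIso u ((2 : ℝ) • (x - y)) ∈ dom p f
      · rw [if_pos ⟨h1, h2⟩, base_homothety_half_of_mem hf h1,
          base_homothety_half_of_mem hf' ((mem_dom_refl hu).2 h2), ← EReal.coe_add, refl_eq hu,
          Function.comp, valOfBase_half_add (admissible_of_mem_dom hf h1)
          (admissible_of_mem_dom hf h2)]
      · rw [if_neg (by tauto), base_homothety_half_of_mem hf h1,
          base_homothety_half_of_notMem hf' (by rwa [mem_dom_refl hu]), EReal.coe_add_top,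
          valOfBase_top]
    · rw [if_neg (by tauto), base_homothety_half_of_notMem hf h1]
      by_cases h2 : reflIso u ((2 : ℝ) • (x - y)) ∈ dom p f
      · rw [base_homothety_half_of_mem hf' ((mem_dom_refl hu).2 h2), EReal.top_add_coe,
          valOfBase_top]
      · rw [base_homothety_half_of_notMem hf' (by rwa [mem_dom_refl hu]), EReal.top_add_top,
          valOfBase_top]

/-! ### Attainment of the supremum -/

/-- The regularity of a function that makes the supremum in the `α`-symmetral a maximum. -/
structure Tame (α : EReal) (f : E n → ℝ≥0∞) : Prop where
  finite : ∀ x, f x < ∞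
  usc : UpperSemicontinuous f
  tendsto_zero : Tendsto f (cocompact (E n)) (𝓝 0)
  isBounded_supp : 0 < α → Bornology.IsBounded (supp f)
  isClosed_supp : α = ⊤ → IsClosed (supp f)

lemma isCompact_le_of_tendsto_zero {f : E n → ℝ≥0∞} (husc : UpperSemicontinuous f)
    (h0 : Tendsto f (cocompact (E n)) (𝓝 0)) {t : ℝ≥0∞} (ht : 0 < t) :
    IsCompact {x | t ≤ f x} := by
  obtain ⟨K, hK, hsub⟩ := mem_cocompact.1 (h0.eventually_lt_const ht)
  refine hK.of_isClosed_subset (husc.isClosed_preimage t) fun x hx => ?_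
  by_contra hxK
  have hlt : f x < t := hsub hxK
  exact hlt.not_ge hx

lemma Tame.isCompact_le {α : EReal} {f : E n → ℝ≥0∞} (hf : Tame α f) {t : ℝ≥0∞} (ht : 0 < t) :
    IsCompact {x | t ≤ f x} := isCompact_le_of_tendsto_zero hf.usc hf.tendsto_zero ht

lemma Tame.exists_bound {α : EReal} {f : E n → ℝ≥0∞} (hf : Tame α f) :
    ∃ C : ℝ≥0∞, C ≠ ∞ ∧ ∀ x, f x ≤ C := by
  rcases ({x | 1 ≤ f x} : Set (E n)).eq_empty_or_nonempty with h | h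
  · refine ⟨1, by simp, fun x => ?_⟩
    by_contra! hx
    exact (h ▸ (show x ∈ {x | 1 ≤ f x} from hx.le) : x ∈ (∅ : Set (E n)))
  · obtain ⟨x₀, hx₀, hmax⟩ := (hf.usc.upperSemicontinuousOn _).exists_isMaxOn h
      (hf.isCompact_le one_pos)
    refine ⟨f x₀, (hf.finite x₀).ne, fun x => ?_⟩
    by_cases hx : 1 ≤ f x
    · exact hmax hx
    · exact (not_le.1 hx).le.trans hx₀

/-- By continuity of the mean there are `a > f y` and `b > f z` whose mean is still below the given
bound. Near `(y, z)` the values stay below `a` and `b`, and monotonicity concludes. -/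
lemma upperSemicontinuous_midMean (α : EReal) {f : E n → ℝ≥0∞} (hfin : ∀ x, f x < ∞)
    (husc : UpperSemicontinuous f) :
    UpperSemicontinuous fun q : E n × E n => midMean α (f q.1) (f q.2) := by
  rintro ⟨y, z⟩ c hc
  have h := (continuousAt_midMean α (hfin y).ne (hfin z).ne).eventually_lt_const hc
  rw [nhds_prod_eq] at h
  have : (𝓝[>] (f y)).NeBot := nhdsGT_neBot_of_exists_gt ⟨∞, hfin y⟩
  have : (𝓝[>] (f z)).NeBot := nhdsGT_neBot_of_exists_gt ⟨∞, hfin z⟩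
  have h' : ∀ᶠ p in 𝓝[>] (f y) ×ˢ 𝓝[>] (f z), midMean α p.1 p.2 < c :=
    h.filter_mono (Filter.prod_mono nhdsWithin_le_nhds nhdsWithin_le_nhds)
  have h1 : ∀ᶠ p in 𝓝[>] (f y) ×ˢ 𝓝[>] (f z), f y < p.1 ∧ f z < p.2 :=
    (eventually_mem_nhdsWithin (a := f y) (s := Ioi (f y))).prod_mk
      (eventually_mem_nhdsWithin (a := f z) (s := Ioi (f z)))
  obtain ⟨⟨a, b⟩, hab, ha, hb⟩ := (h'.and h1).exists
  have e1 : ∀ᶠ q : E n × E n in 𝓝 (y, z), f q.1 < a :=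
    (continuous_fst.tendsto (y, z)).eventually (husc y a ha)
  have e2 : ∀ᶠ q : E n × E n in 𝓝 (y, z), f q.2 < b :=
    (continuous_snd.tendsto (y, z)).eventually (husc z b hb)
  filter_upwards [e1, e2] with q h1 h2
  exact (midMean_mono α h1.le h2.le).trans_lt hab

/-- The pairs of points at which the mean of the values is at least `t`. -/
def pairSet (α : EReal) (f : E n → ℝ≥0∞) (t : ℝ≥0∞) : Set (E n × E n) :=
  {q | q.1 ∈ dom α f ∧ q.2 ∈ dom α f ∧ t ≤ midMean α (f q.1) (f q.2)}

/-- For `α > 0` the closed support is compact, so the threshold may be zero. For `α ≤ 0` a positive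
threshold for the mean bounds both values from below, which confines the pairs to a product of
compact superlevel sets. -/
lemma Tame.isCompact_pairSet {α : EReal} {f : E n → ℝ≥0∞} (hf : Tame α f) {t : ℝ≥0∞}
    (ht : 0 < t ∨ 0 < α) : IsCompact (pairSet α f t) := by
  have hcl : IsClosed {q : E n × E n | t ≤ midMean α (f q.1) (f q.2)} :=
    (upperSemicontinuous_midMean α hf.finite hf.usc).isClosed_preimage t
  rcases lt_or_ge 0 α with hα | hα
  · have hK : IsCompact (closure (supp f)) := (hf.isBounded_supp hα).isCompact_closure
    have : pairSet α f t = (closure (supp f) ×ˢ closure (supp f)) ∩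
        {q : E n × E n | t ≤ midMean α (f q.1) (f q.2)} := by
      ext q
      simp only [pairSet, dom_of_pos hα, mem_inter_iff, mem_prod, and_assoc]
      rfl
    rw [this]
    exact (hK.prod hK).inter_right hcl
  · have ht : 0 < t := ht.resolve_right hα.not_gt
    obtain ⟨C, hC, hfC⟩ := hf.exists_bound
    obtain ⟨δ, hδ, h⟩ := exists_le_of_le_midMean hα hC ht
    have : pairSet α f t = ({x | δ ≤ f x} ×ˢ {x | δ ≤ f x}) ∩
        {q : E n × E n | t ≤ midMean α (f q.1) (f q.2)} := by
      ext q
      simp only [pairSet, dom_of_nonpos hα, mem_inter_iff, mem_prod]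
      constructor
      · rintro ⟨-, -, h3⟩
        exact ⟨h _ _ (hfC _) (hfC _) h3, h3⟩
      · rintro ⟨⟨h1, h2⟩, h3⟩
        exact ⟨hδ.trans_le h1, hδ.trans_le h2, h3⟩
    rw [this]
    exact ((hf.isCompact_le hδ).prod (hf.isCompact_le hδ)).inter_right hcl

/-- The midpoint of `y` and of the mirror image of `z`. -/
def mixPt (u : E n) (q : E n × E n) : E n := (2⁻¹ : ℝ) • (q.1 + reflIso u q.2)

lemma continuous_mixPt (u : E n) : Continuous (mixPt u) := by
  unfold mixPt; fun_prop

lemma mixPt_reflIso_sub (u x y : E n) : mixPt u (y, reflIso u ((2 : ℝ) • x - y)) = x := by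
  simp [mixPt]

lemma reflIso_two_smul_mixPt_sub (u y z : E n) :
    reflIso u ((2 : ℝ) • mixPt u (y, z) - y) = z := by
  simp [mixPt]

lemma reflIso_mixPt (u y z : E n) : reflIso u (mixPt u (y, z)) = mixPt u (z, y) := by
  simp [mixPt, add_comm]

section Symmetral

variable {α : EReal} {u : E n} {f : E n → ℝ≥0∞}

lemma midMean_le_symm (hu : ‖u‖ = 1) (hf : ∀ x, f x < ∞) (hcl : α = ⊤ → IsClosed (supp f))
    {y z : E n} (hy : y ∈ dom α f) (hz : z ∈ dom α f) :
    midMean α (f y) (f z) ≤ symm α u f (mixPt u (y, z)) := by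
  rw [symm_apply hu hf hcl]
  refine le_iSup_of_le y ?_
  rw [reflIso_two_smul_mixPt_sub, pairMean_of_mem hy hz]

lemma symm_le (hu : ‖u‖ = 1) (hf : ∀ x, f x < ∞) (hcl : α = ⊤ → IsClosed (supp f))
    {x : E n} {c : ℝ≥0∞}
    (h : ∀ y ∈ dom α f, ∀ z ∈ dom α f, mixPt u (y, z) = x → midMean α (f y) (f z) ≤ c) :
    symm α u f x ≤ c := by
  rw [symm_apply hu hf hcl]
  refine iSup_le fun y => ?_
  unfold pairMean
  split_ifs with hm
  · exact h _ hm.1 _ hm.2 (mixPt_reflIso_sub u x y)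
  · exact zero_le

/-- The fibre of `mixPt u` over `x` inside the compact set of pairs is compact, so the mean has a
maximum there; pairs below the threshold `t` cannot exceed it. -/
lemma Tame.exists_eq_of_mem_image (hu : ‖u‖ = 1) (hf : Tame α f) {t : ℝ≥0∞} (ht : 0 < t ∨ 0 < α)
    {x : E n} (hx : x ∈ mixPt u '' pairSet α f t) :
    ∃ y ∈ dom α f, ∃ z ∈ dom α f, mixPt u (y, z) = x ∧ t ≤ midMean α (f y) (f z) ∧
      symm α u f x = midMean α (f y) (f z) := by
  obtain ⟨q, hq, rfl⟩ := hx
  have hcomp : IsCompact (pairSet α f t ∩ mixPt u ⁻¹' {mixPt u q}) :=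
    (hf.isCompact_pairSet ht).inter_right (isClosed_singleton.preimage (continuous_mixPt u))
  obtain ⟨⟨y, z⟩, ⟨⟨hy, hz, hyz⟩, hmix⟩, hmax⟩ :=
    ((upperSemicontinuous_midMean α hf.finite hf.usc).upperSemicontinuousOn _).exists_isMaxOn
      (⟨q, hq, rfl⟩ : (pairSet α f t ∩ mixPt u ⁻¹' {mixPt u q}).Nonempty) hcomp
  have hmix' : mixPt u (y, z) = mixPt u q := hmix
  refine ⟨y, hy, z, hz, hmix, hyz, le_antisymm ?_ ?_⟩
  · refine symm_le hu hf.finite hf.isClosed_supp fun y' hy' z' hz' h' => ?_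
    by_cases hle : t ≤ midMean α (f y') (f z')
    · exact hmax (⟨⟨hy', hz', hle⟩, h'⟩ : (y', z') ∈ pairSet α f t ∩ mixPt u ⁻¹' {mixPt u q})
    · exact (not_le.1 hle).le.trans hyz
  · rw [← hmix']
    exact midMean_le_symm hu hf.finite hf.isClosed_supp hy hz

lemma Tame.mem_image_of_pos (hu : ‖u‖ = 1) (hf : Tame α f) {x : E n} (hx : 0 < symm α u f x) :
    ∃ t > 0, x ∈ mixPt u '' pairSet α f t := by
  rw [symm_apply hu hf.finite hf.isClosed_supp] at hx
  obtain ⟨y, hy⟩ := lt_iSup_iff.1 hx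
  refine ⟨_, hy, (y, reflIso u ((2 : ℝ) • x - y)), ?_, mixPt_reflIso_sub u x y⟩
  unfold pairMean at hy ⊢
  split_ifs at hy ⊢ with h
  · exact ⟨h.1, h.2, le_rfl⟩
  · simp at hy

/-- On the effective domain of the symmetral the supremum is attained. -/
lemma Tame.exists_eq (hu : ‖u‖ = 1) (hf : Tame α f) {x : E n} (hx : x ∈ dom α (symm α u f)) :
    ∃ y ∈ dom α f, ∃ z ∈ dom α f, mixPt u (y, z) = x ∧
      symm α u f x = midMean α (f y) (f z) := by
  rcases lt_or_ge 0 α with hα | hα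
  · have hcl : IsClosed (mixPt u '' pairSet α f 0) :=
      ((hf.isCompact_pairSet (.inr hα)).image (continuous_mixPt u)).isClosed
    have hsub : supp (symm α u f) ⊆ mixPt u '' pairSet α f 0 := by
      intro x hx
      obtain ⟨t, -, ht⟩ := hf.mem_image_of_pos hu hx
      have hsub : pairSet α f t ⊆ pairSet α f 0 := fun q hq => ⟨hq.1, hq.2.1, zero_le⟩
      exact image_mono hsub ht
    rw [dom_of_pos hα] at hx
    obtain ⟨y, hy, z, hz, h1, -, h2⟩ :=
      hf.exists_eq_of_mem_image hu (.inr hα) (hcl.closure_subset_iff.2 hsub hx)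
    exact ⟨y, hy, z, hz, h1, h2⟩
  · rw [dom_of_nonpos hα] at hx
    obtain ⟨t, ht, hxt⟩ := hf.mem_image_of_pos hu hx
    obtain ⟨y, hy, z, hz, h1, -, h2⟩ := hf.exists_eq_of_mem_image hu (.inl ht) hxt
    exact ⟨y, hy, z, hz, h1, h2⟩

/-- Immediate for support points; for `α > 0` it passes to closures because `mixPt u` is continuous.
-/
lemma mixPt_mem_dom_symm (hu : ‖u‖ = 1) (hf : ∀ x, f x < ∞) (hcl : α = ⊤ → IsClosed (supp f))
    {y z : E n} (hy : y ∈ dom α f) (hz : z ∈ dom α f) : mixPt u (y, z) ∈ dom α (symm α u f) := by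
  have key : ∀ y ∈ supp f, ∀ z ∈ supp f, mixPt u (y, z) ∈ supp (symm α u f) := fun y hy z hz =>
    (midMean_pos α hy hz).trans_le
      (midMean_le_symm hu hf hcl (supp_subset_dom α f hy) (supp_subset_dom α f hz))
  rcases lt_or_ge 0 α with hα | hα
  · rw [dom_of_pos hα] at *
    exact map_mem_closure₂ (f := fun y z => mixPt u (y, z)) (continuous_mixPt u) hy hz key
  · rw [dom_of_nonpos hα] at *
    exact key y hy z hz

/-- Equality needs the maximum to be attained. It makes the superlevel sets images of compact sets,
which yields measurability and the formula for `-∞`. -/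
lemma Tame.le_symm_eq_image (hu : ‖u‖ = 1) (hf : Tame α f) {t : ℝ≥0∞} (ht : 0 < t) :
    {x | t ≤ symm α u f x} = mixPt u '' pairSet α f t := by
  ext x
  constructor
  · intro hx
    obtain ⟨s, hs, hxs⟩ := hf.mem_image_of_pos hu (ht.trans_le hx)
    obtain ⟨y, hy, z, hz, h1, -, h2⟩ := hf.exists_eq_of_mem_image hu (.inl hs) hxs
    exact ⟨(y, z), ⟨hy, hz, h2 ▸ hx⟩, h1⟩
  · rintro ⟨⟨y, z⟩, ⟨hy, hz, h⟩, rfl⟩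
    exact h.trans (midMean_le_symm hu hf.finite hf.isClosed_supp hy hz)

lemma Tame.measurable_symm (hu : ‖u‖ = 1) (hf : Tame α f) : Measurable (symm α u f) := by
  refine measurable_of_Ici fun t => ?_
  rcases eq_or_ne t 0 with rfl | ht
  · simp
  · have : symm α u f ⁻¹' Ici t = {x | t ≤ symm α u f x} := rfl
    rw [this, hf.le_symm_eq_image hu (pos_iff_ne_zero.2 ht)]
    exact ((hf.isCompact_pairSet (.inl (pos_iff_ne_zero.2 ht))).image
      (continuous_mixPt u)).isClosed.measurableSet

lemma Tame.finite_symm (hu : ‖u‖ = 1) (hf : Tame α f) (x : E n) : symm α u f x < ∞ := by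
  obtain ⟨C, hC, h⟩ := hf.exists_bound
  refine lt_of_le_of_lt (symm_le hu hf.finite hf.isClosed_supp fun y _ z _ _ => ?_) hC.lt_top
  exact midMean_le_of_le α (h y) (h z)

lemma Tame.isClosed_supp_symm (hu : ‖u‖ = 1) (hf : Tame α f) (hα : α = ⊤) :
    IsClosed (supp (symm α u f)) := by
  refine isClosed_of_closure_subset fun x hx => ?_
  rw [← dom_of_pos (α := α) (by simp [hα])] at hx
  obtain ⟨y, hy, z, hz, -, h⟩ := hf.exists_eq hu hx
  rw [dom_of_pos (by simp [hα]), (hf.isClosed_supp hα).closure_eq] at hy hz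
  show 0 < symm α u f x
  rw [h]
  exact midMean_pos α hy hz

/-! ### Monotonicity, symmetry and idempotence -/

/-- Midpoint `α`-concavity on the effective domain. -/
def MidConcave (α : EReal) (f : E n → ℝ≥0∞) : Prop :=
  ∀ y ∈ dom α f, ∀ z ∈ dom α f, (2⁻¹ : ℝ) • (y + z) ∈ dom α f ∧
    midMean α (f y) (f z) ≤ f ((2⁻¹ : ℝ) • (y + z))

lemma symm_mono (hu : ‖u‖ = 1) {g : E n → ℝ≥0∞} (hf : ∀ x, f x < ∞)
    (hclf : α = ⊤ → IsClosed (supp f)) (hg : ∀ x, g x < ∞) (hclg : α = ⊤ → IsClosed (supp g))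
    (h : ∀ x, f x ≤ g x) (x : E n) : symm α u f x ≤ symm α u g x := by
  refine symm_le hu hf hclf fun y hy z hz hx => ?_
  rw [← hx]
  exact (midMean_mono α (h y) (h z)).trans
    (midMean_le_symm hu hg hclg (dom_mono α h hy) (dom_mono α h hz))

/-- Exchanging the two points of a pair reflects its midpoint and keeps its mean. -/
lemma refl_symm (hu : ‖u‖ = 1) (hf : ∀ x, f x < ∞) (hcl : α = ⊤ → IsClosed (supp f)) :
    refl u (symm α u f) = symm α u f := by
  have key : ∀ x, symm α u f (reflIso u x) ≤ symm α u f x := by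
    intro x
    refine symm_le hu hf hcl fun y hy z hz h => ?_
    have hx : x = mixPt u (z, y) := by rw [← reflIso_mixPt, h, reflIso_reflIso]
    rw [hx, midMean_comm]
    exact midMean_le_symm hu hf hcl hz hy
  rw [refl_eq hu]
  funext x
  refine le_antisymm (key x) ?_
  simpa using key (reflIso u x)

/-- Concavity bounds every competing mean by `f x`; the pair of `x` and its mirror image attains
this value. -/
lemma symm_eq_self (hu : ‖u‖ = 1) (hf : ∀ x, f x < ∞) (hcl : α = ⊤ → IsClosed (supp f))
    (hmid : MidConcave α f) (hR : refl u f = f) : symm α u f = f := by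
  have hfR : ∀ x, f (reflIso u x) = f x := fun x => by
    conv_rhs => rw [← hR, refl_eq hu]
    rfl
  have hdom : ∀ x, x ∈ dom α f → reflIso u x ∈ dom α f := fun x hx => by
    rwa [← mem_dom_refl hu, hR]
  funext x
  refine le_antisymm (symm_le hu hf hcl fun y hy z hz h => ?_) ?_
  · rw [← hfR z, ← h]
    exact (hmid y hy _ (hdom z hz)).2
  · by_cases hx : x ∈ dom α f
    · have := midMean_le_symm (u := u) hu hf hcl hx (hdom x hx)
      have hxx : mixPt u (x, reflIso u x) = x := by
        simp only [mixPt, reflIso_reflIso, ← two_smul ℝ x, smul_smul]; norm_num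
      rwa [hxx, hfR, midMean_self] at this
    · rw [eq_zero_of_notMem_dom hx]; exact zero_le

/-- Averaging the maximizing pairs of two points componentwise gives a competitor at their midpoint,
and mediality regroups the four values so that concavity of `f` applies. -/
lemma Tame.midConcave_symm (hu : ‖u‖ = 1) (hf : Tame α f) (hmid : MidConcave α f) :
    MidConcave α (symm α u f) := by
  intro x₁ h₁ x₂ h₂
  obtain ⟨y₁, hy₁, z₁, hz₁, rfl, e₁⟩ := hf.exists_eq hu h₁
  obtain ⟨y₂, hy₂, z₂, hz₂, rfl, e₂⟩ := hf.exists_eq hu h₂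
  obtain ⟨hy, hy'⟩ := hmid y₁ hy₁ y₂ hy₂
  obtain ⟨hz, hz'⟩ := hmid z₁ hz₁ z₂ hz₂
  have hx : (2⁻¹ : ℝ) • (mixPt u (y₁, z₁) + mixPt u (y₂, z₂)) =
      mixPt u ((2⁻¹ : ℝ) • (y₁ + y₂), (2⁻¹ : ℝ) • (z₁ + z₂)) := by
    simp only [mixPt, map_smul, map_add]; module
  rw [hx, e₁, e₂, midMean_medial]
  exact ⟨mixPt_mem_dom_symm hu hf.finite hf.isClosed_supp hy hz,
    (midMean_mono α hy' hz').trans (midMean_le_symm hu hf.finite hf.isClosed_supp hy hz)⟩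

lemma Tame.symm_symm (hu : ‖u‖ = 1) (hf : Tame α f) (hmid : MidConcave α f) :
    symm α u (symm α u f) = symm α u f :=
  symm_eq_self hu (hf.finite_symm hu) (hf.isClosed_supp_symm hu) (hf.midConcave_symm hu hmid)
    (refl_symm hu hf.finite hf.isClosed_supp)

/-- The points `mixPt u (y, z)` and `(y + z)/2` differ by the multiple `⟨z, u⟩` of `u`, hence lie on
the same line orthogonal to the hyperplane. The converse inequality uses the pair `(p, p)`, whose
image is the foot of `p` on the hyperplane. -/
lemma proj_symm (hu : ‖u‖ = 1) (hf : ∀ x, f x < ∞) (hcl : α = ⊤ → IsClosed (supp f))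
    (hmid : MidConcave α f) : proj u (symm α u f) = proj u f := by
  have hR : ∀ z, reflIso u z = z - (2 * inner ℝ z u) • u := fun z => reflIso_apply hu z
  funext x
  refine le_antisymm (iSup_le fun t => ?_) (iSup_le fun t => ?_)
  · refine symm_le hu hf hcl fun y hy z hz h => ?_
    refine (hmid y hy z hz).2.trans (le_iSup_of_le (t + inner ℝ z u) (le_of_eq ?_))
    congr 1
    have h2 : (x : E n) = mixPt u (y, z) - t • u := by rw [h]; simp
    rw [h2, mixPt, hR]
    module
  · set p : E n := (x : E n) + t • u with hp
    by_cases hx : p ∈ dom α f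
    · have := midMean_le_symm (u := u) hu hf hcl hx hx
      rw [midMean_self] at this
      refine this.trans (le_iSup_of_le (t - inner ℝ p u) (le_of_eq ?_))
      congr 1
      have h2 : (x : E n) = p - t • u := by rw [hp]; simp
      rw [mixPt, hR, h2]
      module
    · rw [eq_zero_of_notMem_dom hx]; exact zero_le

lemma superlevel_symm_bot (hu : ‖u‖ = 1) (hf : Tame ⊥ f) {t : ℝ} (ht : 0 < t) :
    superlevel t (symm ⊥ u f) = symmSet u (superlevel t f) := by
  have ht' : 0 < ENNReal.ofReal t := by simpa using ht
  rw [superlevel, hf.le_symm_eq_image hu ht', symmSet, reflPt_eq hu]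
  ext x
  simp only [mem_image, Set.mem_add, mem_smul_set, superlevel, mem_ofPred_eq, pairSet, midMean_bot,
    le_min_iff, dom_of_nonpos bot_le, Prod.exists, mixPt, one_div]
  constructor
  · rintro ⟨y, z, ⟨-, -, hy, hz⟩, rfl⟩
    exact ⟨_, ⟨y, hy, rfl⟩, _, ⟨_, ⟨z, hz, rfl⟩, rfl⟩, by module⟩
  · rintro ⟨_, ⟨y, hy, rfl⟩, _, ⟨_, ⟨z, hz, rfl⟩, rfl⟩, rfl⟩
    exact ⟨y, z, ⟨ht'.trans_le hy, ht'.trans_le hz, hy, hz⟩, by module⟩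

end Symmetral

/-! ### The classes of functions -/

lemma MemC.midMean_le {α : EReal} {f : E n → ℝ≥0∞} (hf : MemC α f) {y z : E n} (hy : y ∈ supp f)
    (hz : z ∈ supp f) : midMean α (f y) (f z) ≤ f ((2⁻¹ : ℝ) • (y + z)) := by
  have := hf.alphaConcave.2 y hy z hz (1 / 2) (1 / 2) (by norm_num)
  simpa [midMean, smul_add] using this

lemma half_smul_add_mem {s : Set (E n)} (hs : Convex ℝ s) {y z : E n} (hy : y ∈ s) (hz : z ∈ s) :
    (2⁻¹ : ℝ) • (y + z) ∈ s := by
  rw [smul_add]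
  exact hs hy hz (by norm_num) (by norm_num) (by norm_num)

lemma MemC.tame_of_nonpos {α β : EReal} {f : E n → ℝ≥0∞} (hf : MemC α f) (hβ : β ≤ 0) :
    Tame β f where
  finite := hf.finite
  usc := hf.usc
  tendsto_zero := hf.tendsto_zero
  isBounded_supp h := absurd h hβ.not_gt
  isClosed_supp h := by simp [h] at hβ

lemma MemLCc.tame_of_nonpos {β : EReal} {f : E n → ℝ≥0∞} (hf : MemLCc f) (hβ : β ≤ 0) :
    Tame β f where
  finite := hf.finite
  usc := hf.usc
  tendsto_zero := hf.tendsto_zero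
  isBounded_supp h := absurd h hβ.not_gt
  isClosed_supp h := by simp [h] at hβ

lemma MemC.tame {α : EReal} {f : E n → ℝ≥0∞} (hf : MemC α f) : Tame α f where
  finite := hf.finite
  usc := hf.usc
  tendsto_zero := hf.tendsto_zero
  isBounded_supp hα := by
    obtain ⟨x₀, hx₀⟩ := hf.proper
    have hpos : 0 < midMean α (f x₀) 0 := midMean_pos_left hα hx₀ (hf.finite x₀).ne
    have hK := isCompact_le_of_tendsto_zero hf.usc hf.tendsto_zero hpos
    -- The midpoint of `x₀` and any support point lies in a fixed compact superlevel set; doubling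
    -- it and subtracting `x₀` recovers the point.
    refine (hK.image (f := fun w => (2 : ℝ) • w - x₀) (by fun_prop)).isBounded.subset ?_
    intro x hx
    refine ⟨(2⁻¹ : ℝ) • (x₀ + x), ?_, by simp⟩
    exact (midMean_mono α le_rfl zero_le).trans (hf.midMean_le hx₀ hx)
  isClosed_supp hα := by
    obtain ⟨x₀, hx₀⟩ := hf.proper
    have : supp f = {x | f x₀ ≤ f x} := by
      ext x
      refine ⟨fun hx => ?_, fun hx => show 0 < f x from lt_of_lt_of_le hx₀ hx⟩
      -- At `+∞` the mean is the maximum whatever the weights, so even the weights `0, 1` bound `f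
      -- x` below by `f x₀`.
      have := hf.alphaConcave.2 x₀ hx₀ x hx 0 1 (by simp)
      simp only [alphaMean, hα, if_true, NNReal.coe_zero, NNReal.coe_one, zero_smul, one_smul,
        zero_add] at this
      show f x₀ ≤ f x
      simpa using this
    rw [this]
    exact hf.usc.isClosed_preimage (f x₀)

lemma MemC.midConcave {α : EReal} {f : E n → ℝ≥0∞} (hf : MemC α f) : MidConcave α f := by
  intro y hy z hz
  rcases lt_or_ge 0 α with hα | hα
  · rw [dom_of_pos hα] at *
    refine ⟨half_smul_add_mem hf.alphaConcave.1.closure hy hz, ?_⟩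
    by_contra! hlt
    have hev : ∀ᶠ q : E n × E n in 𝓝 (y, z),
        f ((2⁻¹ : ℝ) • (q.1 + q.2)) < midMean α (f y) (f z) :=
      ((by fun_prop : Continuous fun q : E n × E n => (2⁻¹ : ℝ) • (q.1 + q.2)).tendsto
        (y, z)).eventually (hf.usc _ _ hlt)
    -- A closed-support point is approached by support points with no smaller value: any of them if
    -- `f w = 0`, otherwise `w` itself. Concavity at such points contradicts the upper
    -- semicontinuity bound at the midpoint.
    have happrox : ∀ w ∈ closure (supp f), ∃ᶠ w' in 𝓝 w, w' ∈ supp f ∧ f w ≤ f w' := by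
      intro w hw
      by_cases h0 : f w = 0
      · exact (mem_closure_iff_frequently.1 hw).mono fun w' hw' => ⟨hw', h0 ▸ zero_le⟩
      · have : w ∈ supp f ∧ f w ≤ f w := ⟨pos_iff_ne_zero.2 h0, le_rfl⟩
        exact fun hcon => hcon.self_of_nhds this
    rw [nhds_prod_eq] at hev
    obtain ⟨P, hP, Q, hQ, hPQ⟩ := eventually_prod_iff.1 hev
    obtain ⟨y', ⟨hy', hyy'⟩, hPy⟩ := ((happrox y hy).and_eventually hP).exists
    obtain ⟨z', ⟨hz', hzz'⟩, hQz⟩ := ((happrox z hz).and_eventually hQ).exists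
    exact (hPQ hPy hQz).not_ge
      ((midMean_mono α hyy' hzz').trans (hf.midMean_le hy' hz'))
  · rw [dom_of_nonpos hα] at *
    exact ⟨half_smul_add_mem hf.alphaConcave.1 hy hz, hf.midMean_le hy hz⟩

/-! ### The support function of the symmetral -/

lemma baseVal_midMean {p : ℝ} {a b : ℝ≥0∞} (ha : Admissible p a) (hb : Admissible p b) :
    baseVal p (midMean p a b) = 2⁻¹ * baseVal p a + 2⁻¹ * baseVal p b := by
  obtain ⟨ha, ha0⟩ := ha
  obtain ⟨hb, hb0⟩ := hb
  by_cases hp : p = 0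
  · subst hp
    have ha1 := ENNReal.toReal_pos (ha0 le_rfl) ha
    have hb1 := ENNReal.toReal_pos (hb0 le_rfl) hb
    simp only [baseVal, if_true, EReal.coe_zero, midMean_zero, ENNReal.toReal_mul,
      ← ENNReal.toReal_rpow]
    rw [Real.log_mul (by positivity) (by positivity), Real.log_rpow ha1, Real.log_rpow hb1]
    ring
  · have key : ∀ c : ℝ≥0∞, c ≠ ∞ → (p ≤ 0 → c ≠ 0) → 2⁻¹ * c ^ p ≠ ∞ := by
      intro c hc hc0
      refine ENNReal.mul_ne_top (by simp) ?_
      rcases lt_or_gt_of_ne hp with h | h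
      · exact ENNReal.rpow_ne_top_of_nonneg' (pos_iff_ne_zero.2 (hc0 h.le)) hc
      · exact ENNReal.rpow_ne_top_of_nonneg h.le hc
    simp only [baseVal, hp, if_false]
    rw [ENNReal.toReal_rpow, midMean_coe hp, ENNReal.rpow_inv_rpow hp,
      ENNReal.toReal_add (key a ha ha0) (key b hb hb0), ENNReal.toReal_mul, ENNReal.toReal_mul,
      ← ENNReal.toReal_rpow, ← ENNReal.toReal_rpow]
    simp only [ENNReal.toReal_inv, ENNReal.toReal_ofNat]
    field_simp; ring

lemma baseVal_anti {p : ℝ} {a b : ℝ≥0∞} (ha : Admissible p a) (hb : Admissible p b) (hab : a ≤ b) :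
    baseVal p b ≤ baseVal p a := by
  have h := ENNReal.toReal_mono hb.1 hab
  unfold baseVal
  split_ifs with hp
  · subst hp
    exact neg_le_neg (Real.log_le_log (ENNReal.toReal_pos (ha.2 le_rfl) ha.1) h)
  · rcases lt_or_gt_of_ne hp with h' | h'
    · have := Real.rpow_le_rpow_of_nonpos (ENNReal.toReal_pos (ha.2 h'.le) ha.1) h h'.le
      exact div_le_div_of_nonpos_of_le h'.le (by linarith)
    · have := Real.rpow_le_rpow ENNReal.toReal_nonneg h h'.le
      exact div_le_div_of_nonneg_right (by linarith) h'.le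

lemma le_alphaSupport {p : ℝ} {f : E n → ℝ≥0∞} (hf : ∀ x, f x < ∞) {y : E n} (hy : y ∈ dom p f)
    (ξ : E n) : ((inner ℝ ξ y - baseVal p (f y) : ℝ) : EReal) ≤ alphaSupport p f ξ := by
  refine le_iSup_of_le y ?_
  rw [base_of_mem_dom hf hy, EReal.coe_sub]

lemma continuous_half_mul : Continuous fun t : EReal => ((2⁻¹ : ℝ) : EReal) * t := by
  rw [continuous_iff_continuousAt]
  intro t
  have h : ((2⁻¹ : ℝ) : EReal) ≠ 0 := by norm_num
  exact ContinuousAt.comp (f := fun t : EReal => (((2⁻¹ : ℝ) : EReal), t)) (x := t)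
    (EReal.continuousAt_mul (.inl h) (.inl h) (.inl (EReal.coe_ne_bot _))
      (.inl (EReal.coe_ne_top _))) (by fun_prop)

lemma monotone_half_mul : Monotone fun t : EReal => ((2⁻¹ : ℝ) : EReal) * t :=
  fun _ _ h => mul_le_mul_of_nonneg_left h (by norm_num)

lemma exists_of_lt_half_alphaSupport {p : ℝ} {f : E n → ℝ≥0∞} (hf : ∀ x, f x < ∞) {ξ : E n}
    {a : EReal} (ha : a < ((2⁻¹ : ℝ) : EReal) * alphaSupport p f ξ) :
    ∃ y ∈ dom p f, a < ((2⁻¹ * (inner ℝ ξ y - baseVal p (f y)) : ℝ) : EReal) := by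
  rw [alphaSupport, legendre, monotone_half_mul.map_iSup_of_continuousAt
    continuous_half_mul.continuousAt (EReal.coe_mul_bot_of_pos (by norm_num))] at ha
  obtain ⟨y, hy⟩ := lt_iSup_iff.1 ha
  by_cases hd : y ∈ dom p f
  · refine ⟨y, hd, ?_⟩
    simp only [base_of_mem_dom hf hd] at hy
    exact_mod_cast hy
  · simp only [base_of_notMem_dom hd, EReal.sub_top,
      EReal.coe_mul_bot_of_pos (by norm_num : (0 : ℝ) < 2⁻¹)] at hy
    exact absurd hy not_lt_bot

lemma inner_reflIso (u ξ z : E n) : inner ℝ ξ (reflIso u z) = inner ℝ (reflIso u ξ) z := by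
  rw [← (reflIso u).inner_map_map ξ, reflIso_reflIso]

/-- Both the inner product with `mixPt u (y, z)` and the base value of the mean split into halves.
The upper bound uses a maximizing pair; the lower bound uses points nearly optimal for each summand
and the antitonicity of the base value. -/
lemma alphaSupport_symm {p : ℝ} {u : E n} (hu : ‖u‖ = 1) {f : E n → ℝ≥0∞} (hf : Tame p f)
    (ξ : E n) : alphaSupport p (symm p u f) ξ =
      ((2⁻¹ : ℝ) : EReal) * alphaSupport p f ξ +
        ((2⁻¹ : ℝ) : EReal) * alphaSupport p f (reflIso u ξ) := by
  have hinner : ∀ y z, inner ℝ ξ (mixPt u (y, z)) =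
      2⁻¹ * inner ℝ ξ y + 2⁻¹ * inner ℝ (reflIso u ξ) z := fun y z => by
    rw [mixPt, inner_smul_right, inner_add_right, inner_reflIso]; ring
  refine le_antisymm (iSup_le fun x => ?_) (EReal.add_le_of_forall_lt fun a ha b hb => ?_)
  · by_cases hx : x ∈ dom p (symm p u f)
    · rw [base_of_mem_dom (hf.finite_symm hu) hx]
      obtain ⟨y, hy, z, hz, rfl, hM⟩ := hf.exists_eq hu hx
      rw [hM, baseVal_midMean (admissible_of_mem_dom hf.finite hy)
        (admissible_of_mem_dom hf.finite hz), hinner]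
      refine le_trans (le_of_eq ?_) (add_le_add (monotone_half_mul (le_alphaSupport hf.finite hy ξ))
        (monotone_half_mul (le_alphaSupport hf.finite hz (reflIso u ξ))))
      simp only [← EReal.coe_mul, ← EReal.coe_add, ← EReal.coe_sub, EReal.coe_eq_coe_iff]
      ring
    · rw [base_of_notMem_dom hx, EReal.sub_top]; exact bot_le
  · obtain ⟨y, hy, hay⟩ := exists_of_lt_half_alphaSupport hf.finite ha
    obtain ⟨z, hz, hbz⟩ := exists_of_lt_half_alphaSupport hf.finite hb
    have hd := mixPt_mem_dom_symm hu hf.finite hf.isClosed_supp hy hz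
    refine (add_le_add hay.le hbz.le).trans (le_trans ?_ (le_alphaSupport (hf.finite_symm hu) hd ξ))
    have h1 := midMean_le_symm hu hf.finite hf.isClosed_supp hy hz
    have hy' := admissible_of_mem_dom hf.finite hy
    have hz' := admissible_of_mem_dom hf.finite hz
    have h2 : Admissible p (midMean p (f y) (f z)) :=
      ⟨(h1.trans_lt (hf.finite_symm hu _)).ne, fun hp => (midMean_pos _
        (pos_iff_ne_zero.2 (hy'.2 hp)) (pos_iff_ne_zero.2 (hz'.2 hp))).ne'⟩
    have h3 := baseVal_anti h2 (admissible_of_mem_dom (hf.finite_symm hu) hd) h1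
    rw [baseVal_midMean hy' hz'] at h3
    rw [hinner]
    norm_cast
    linarith

lemma measurable_legendre (ψ : E n → EReal) : Measurable (legendre ψ) := by
  refine LowerSemicontinuous.measurable ?_
  refine lowerSemicontinuous_iSup fun y => ?_
  refine Continuous.lowerSemicontinuous ?_
  induction h : ψ y with
  | bot => simp only [EReal.coe_sub_bot]; exact continuous_const
  | top => simp only [EReal.sub_top]; exact continuous_const
  | coe r => simp only [← EReal.coe_sub]; exact continuous_coe_real_ereal.comp (by fun_prop)

/-! ### Integrals of extended real functions -/

/-- Additivity of positive minus negative parts, rearranged without subtraction so that it survives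
the value `⊤`. -/
lemma toENNReal_half_identity {x y : EReal} (hx : x ≠ ⊥) (hy : y ≠ ⊥) :
    (((2⁻¹ : ℝ) : EReal) * x + ((2⁻¹ : ℝ) : EReal) * y).toENNReal +
        (2⁻¹ * (-x).toENNReal + 2⁻¹ * (-y).toENNReal) =
      (-(((2⁻¹ : ℝ) : EReal) * x + ((2⁻¹ : ℝ) : EReal) * y)).toENNReal +
        (2⁻¹ * x.toENNReal + 2⁻¹ * y.toENNReal) := by
  have h2 : (0 : ℝ) < 2⁻¹ := by norm_num
  induction x with
  | bot => exact absurd rfl hx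
  | top =>
    have : ((2⁻¹ : ℝ) : EReal) * y ≠ ⊥ := by
      induction y with
      | bot => exact absurd rfl hy
      | top => rw [EReal.coe_mul_top_of_pos h2]; decide
      | coe y => exact_mod_cast EReal.coe_ne_bot _
    rw [EReal.coe_mul_top_of_pos h2, EReal.top_add_of_ne_bot this, EReal.toENNReal_top, top_add,
      ENNReal.mul_top (by simp), top_add, add_top]
  | coe x =>
    induction y with
    | bot => exact absurd rfl hy
    | top =>
      rw [EReal.coe_mul_top_of_pos h2, EReal.add_top_of_ne_bot (by exact_mod_cast EReal.coe_ne_bot _),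
        EReal.toENNReal_top, top_add, ENNReal.mul_top (by simp), add_top, add_top]
    | coe y =>
      have h3 : (2⁻¹ : ℝ≥0∞) = ENNReal.ofReal 2⁻¹ := by
        rw [ENNReal.ofReal_inv_of_pos (by norm_num), ENNReal.ofReal_ofNat]
      have h4 : ∀ t : ℝ, ENNReal.ofReal t = ENNReal.ofReal (max t 0) := fun t => by simp
      rw [← EReal.coe_mul, ← EReal.coe_mul, ← EReal.coe_add, ← EReal.coe_neg, ← EReal.coe_neg,
        ← EReal.coe_neg]
      simp only [EReal.toENNReal_of_ne_top (EReal.coe_ne_top _), EReal.toReal_coe]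
      rw [h4 (2⁻¹ * x + 2⁻¹ * y), h4 (-x), h4 (-y), h4 (-(2⁻¹ * x + 2⁻¹ * y)), h4 x, h4 y, h3]
      rw [← ENNReal.ofReal_mul (by positivity), ← ENNReal.ofReal_mul (by positivity),
        ← ENNReal.ofReal_mul (by positivity), ← ENNReal.ofReal_mul (by positivity),
        ← ENNReal.ofReal_add (by positivity) (by positivity),
        ← ENNReal.ofReal_add (by positivity) (by positivity),
        ← ENNReal.ofReal_add (by positivity) (by positivity),
        ← ENNReal.ofReal_add (by positivity) (by positivity)]
      congr 1
      have h5 : ∀ t : ℝ, max t 0 = t + max (-t) 0 := fun t => by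
        rcases le_total 0 t with h | h <;> simp [h]
      rw [h5 (2⁻¹ * x + 2⁻¹ * y), h5 x, h5 y]
      ring

/-- The mean of `h` and its reflection. -/
def halfSum (R : E n ≃ₗᵢ[ℝ] E n) (h : E n → EReal) (x : E n) : EReal :=
  ((2⁻¹ : ℝ) : EReal) * h x + ((2⁻¹ : ℝ) : EReal) * h (R x)

section ExtIntegral

variable {μ : Measure (E n)} {R : E n ≃ₗᵢ[ℝ] E n} {h : E n → EReal}

lemma lintegral_half_add (hR : MeasurePreserving R μ μ) {F : E n → ℝ≥0∞} (hF : Measurable F) :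
    ∫⁻ x, (2⁻¹ * F x + 2⁻¹ * F (R x)) ∂μ = ∫⁻ x, F x ∂μ := by
  rw [lintegral_add_left (by fun_prop), lintegral_const_mul _ hF,
    lintegral_const_mul (f := fun x => F (R x)) _ (hF.comp R.continuous.measurable),
    hR.lintegral_comp hF,
    half_mul_add_half_mul]

lemma measurable_halfSum (hm : Measurable h) : Measurable (halfSum R h) := by
  have h1 : Measurable fun x => ((2⁻¹ : ℝ) : EReal) * h x := continuous_half_mul.measurable.comp hm
  have h2 : Measurable fun x => ((2⁻¹ : ℝ) : EReal) * h (R x) :=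
    h1.comp R.continuous.measurable
  exact h1.add h2

lemma lintegral_halfSum_identity (hR : MeasurePreserving R μ μ) (hm : Measurable h)
    (hbot : ∀ x, h x ≠ ⊥) :
    ∫⁻ x, (halfSum R h x).toENNReal ∂μ + ∫⁻ x, (-h x).toENNReal ∂μ =
      ∫⁻ x, (-halfSum R h x).toENNReal ∂μ + ∫⁻ x, (h x).toENNReal ∂μ := by
  have hm' := measurable_halfSum (R := R) hm
  have e1 := lintegral_half_add hR (F := fun x => (-h x).toENNReal) (by fun_prop)
  have e2 := lintegral_half_add hR (F := fun x => (h x).toENNReal) (by fun_prop)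
  rw [← e1, ← e2, ← lintegral_add_left (by fun_prop), ← lintegral_add_left (by fun_prop)]
  exact lintegral_congr fun x => toENNReal_half_identity (hbot x) (hbot (R x))

lemma lintegral_halfSum_le (hR : MeasurePreserving R μ μ) (hm : Measurable h) :
    ∫⁻ x, (halfSum R h x).toENNReal ∂μ ≤ ∫⁻ x, (h x).toENNReal ∂μ := by
  rw [← lintegral_half_add hR (F := fun x => (h x).toENNReal) (by fun_prop)]
  refine lintegral_mono fun x => ?_
  refine EReal.toENNReal_add_le.trans (add_le_add ?_ ?_) <;>
  · rw [EReal.toENNReal_mul (by norm_num)]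
    refine mul_le_mul' (le_of_eq ?_) le_rfl
    rw [EReal.toENNReal_of_ne_top (EReal.coe_ne_top _), EReal.toReal_coe,
      ENNReal.ofReal_inv_of_pos (by norm_num), ENNReal.ofReal_ofNat]

/-- If the positive part of `h` is integrable, the subtraction-free identity compares the two
integrals. Otherwise the convention gives `⊤` for `h`, and `htop` guarantees that averaging has not
made the positive part integrable. -/
lemma extIntegral_halfSum (hR : MeasurePreserving R μ μ) (hm : Measurable h)
    (hbot : ∀ x, h x ≠ ⊥)
    (htop : ∫⁻ x, (h x).toENNReal ∂μ = ∞ → ∫⁻ x, (halfSum R h x).toENNReal ∂μ = ∞) :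
    extIntegral μ (halfSum R h) = extIntegral μ h := by
  have hid := lintegral_halfSum_identity hR hm hbot
  have hle := lintegral_halfSum_le hR hm (μ := μ)
  unfold extIntegral
  generalize ∫⁻ x, (halfSum R h x).toENNReal ∂μ = P' at *
  generalize ∫⁻ x, (h x).toENNReal ∂μ = P at *
  generalize ∫⁻ x, (-halfSum R h x).toENNReal ∂μ = N' at *
  generalize ∫⁻ x, (-h x).toENNReal ∂μ = N at *
  by_cases hP : P = ∞
  · rw [if_pos hP, if_pos (htop hP)]
  · have hP' : P' ≠ ∞ := (hle.trans_lt (lt_top_iff_ne_top.2 hP)).ne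
    rw [if_neg hP, if_neg hP']
    by_cases hN : N = ∞
    · have : N' = ∞ := by
        rw [hN, add_top] at hid
        exact (ENNReal.add_eq_top.1 hid.symm).resolve_right hP
      rw [hN, this, EReal.coe_ennreal_top, EReal.sub_top, EReal.sub_top]
    · have hN' : N' ≠ ∞ := by
        rintro rfl
        rw [top_add] at hid
        exact (ENNReal.add_ne_top.2 ⟨hP', hN⟩) hid
      lift P to ℝ≥0 using hP
      lift P' to ℝ≥0 using hP'
      lift N to ℝ≥0 using hN
      lift N' to ℝ≥0 using hN'
      have hid' : (P' : ℝ) + N = N' + P := by exact_mod_cast hid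
      have : ((P' - N' : ℝ) : EReal) = ((P - N : ℝ) : EReal) := by
        rw [EReal.coe_eq_coe_iff]; linarith
      simpa only [EReal.coe_nnreal_eq_coe_real, EReal.coe_sub] using this

/-- The average inherits the growth bound, with `y₂` in place of `y₁`. Were its positive part
integrable, `c‖x‖ - C` would have integrable positive part on the half-space `⟨x, y₂⟩ ≥ 0`, and by
evenness of the measure everywhere. This controls the negative part of `h`, and the identity for the
parts becomes contradictory. -/
lemma lintegral_halfSum_eq_top (hR : MeasurePreserving R μ μ)
    (hneg : MeasurePreserving (fun x : E n => -x) μ μ) (hball : ∀ r, μ (Metric.closedBall 0 r) < ∞)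
    (hm : Measurable h) {y₁ : E n} {c C : ℝ} (hc : 0 < c)
    (hlow : ∀ x, ((inner ℝ x y₁ + c * ‖x‖ - C : ℝ) : EReal) ≤ h x)
    (htop : ∫⁻ x, (h x).toENNReal ∂μ = ∞) : ∫⁻ x, (halfSum R h x).toENNReal ∂μ = ∞ := by
  by_contra hfin
  have hbot : ∀ x, h x ≠ ⊥ := fun x hx =>
    (EReal.bot_lt_coe _).not_ge (hx ▸ hlow x)
  set y₂ : E n := (2⁻¹ : ℝ) • (y₁ + R.symm y₁) with hy₂
  have hlow' : ∀ x, ((inner ℝ x y₂ + c * ‖x‖ - C : ℝ) : EReal) ≤ halfSum R h x := by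
    intro x
    refine le_trans (le_of_eq ?_)
      (add_le_add (monotone_half_mul (hlow x)) (monotone_half_mul (hlow (R x))))
    have e1 : inner ℝ (R x) y₁ = inner ℝ x (R.symm y₁) := by
      rw [← R.inner_map_map x, R.apply_symm_apply]
    rw [e1, R.norm_map, hy₂, inner_smul_right, inner_add_right]
    simp only [← EReal.coe_mul, ← EReal.coe_add, EReal.coe_eq_coe_iff]
    ring
  set G : E n → ℝ≥0∞ := fun x => ENNReal.ofReal (c * ‖x‖ - C) with hG
  have hGm : Measurable G := by fun_prop
  have hS : MeasurableSet {x : E n | 0 ≤ inner ℝ x y₂} :=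
    measurableSet_le measurable_const (by fun_prop)
  have hGS : ∫⁻ x in {x : E n | 0 ≤ inner ℝ x y₂}, G x ∂μ ≤
      ∫⁻ x, (halfSum R h x).toENNReal ∂μ := by
    refine (setLIntegral_mono' hS fun x hx => ?_).trans (setLIntegral_le_lintegral _ _)
    have hx : 0 ≤ inner ℝ x y₂ := hx
    have := EReal.toENNReal_le_toENNReal (hlow' x)
    rw [EReal.toENNReal_of_ne_top (EReal.coe_ne_top _), EReal.toReal_coe] at this
    exact (ENNReal.ofReal_le_ofReal (by linarith)).trans this
  have hGS' : ∫⁻ x in {x : E n | 0 ≤ inner ℝ x y₂}ᶜ, G x ∂μ ≤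
      ∫⁻ x in {x : E n | 0 ≤ inner ℝ x y₂}, G x ∂μ := by
    rw [← hneg.setLIntegral_comp_preimage hS hGm]
    simp only [hG, norm_neg]
    refine lintegral_mono_set fun x hx => ?_
    have hx : ¬ 0 ≤ inner ℝ x y₂ := hx
    show 0 ≤ inner ℝ (-x) y₂
    rw [inner_neg_left]; linarith
  have hGfin : ∫⁻ x, G x ∂μ < ∞ := by
    rw [← lintegral_add_compl _ hS]
    exact ENNReal.add_lt_top.2 ⟨hGS.trans_lt (lt_top_iff_ne_top.2 hfin),
      (hGS'.trans hGS).trans_lt (lt_top_iff_ne_top.2 hfin)⟩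
  -- Outside the ball of radius `r` one has `c‖x‖ ≤ 2(c‖x‖ - C)` and `C ≤ c‖x‖ - C`. In `A` the
  -- first summand therefore pays for `‖y₁‖‖x‖` and the `1` for `C`.
  set r := 2 * C / c with hr
  set A := 2 * ‖y₁‖ / c + 1 with hA
  have hNfin : ∫⁻ x, (-h x).toENNReal ∂μ < ∞ := by
    have hbd : ∀ x, (-h x).toENNReal ≤ ENNReal.ofReal A * G x +
        (Metric.closedBall 0 r).indicator (fun _ => ENNReal.ofReal (‖y₁‖ * r + C)) x := by
      intro x
      have h1 : -h x ≤ ((‖y₁‖ * ‖x‖ + C : ℝ) : EReal) := by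
        rw [EReal.neg_le]
        refine le_trans ?_ (hlow x)
        norm_cast
        have := abs_real_inner_le_norm x y₁
        have := neg_abs_le (inner ℝ x y₁)
        nlinarith [norm_nonneg x]
      have h2 := EReal.toENNReal_le_toENNReal h1
      rw [EReal.toENNReal_of_ne_top (EReal.coe_ne_top _), EReal.toReal_coe] at h2
      refine h2.trans ?_
      by_cases hx : x ∈ Metric.closedBall (0 : E n) r
      · rw [indicator_of_mem hx]
        rw [mem_closedBall_zero_iff] at hx
        refine le_add_of_nonneg_of_le zero_le (ENNReal.ofReal_le_ofReal ?_)
        gcongr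
      · rw [indicator_of_notMem hx, add_zero, hG, ← ENNReal.ofReal_mul (by positivity)]
        rw [mem_closedBall_zero_iff, not_le, hr, div_lt_iff₀ hc] at hx
        refine ENNReal.ofReal_le_ofReal ?_
        have e : 2 * ‖y₁‖ / c * (c * ‖x‖ - C) = ‖y₁‖ / c * (2 * (c * ‖x‖ - C)) := by ring
        have e2 : ‖y₁‖ * ‖x‖ = ‖y₁‖ / c * (c * ‖x‖) := by field_simp
        have e3 : ‖y₁‖ / c * (c * ‖x‖) ≤ ‖y₁‖ / c * (2 * (c * ‖x‖ - C)) :=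
          mul_le_mul_of_nonneg_left (by linarith) (by positivity)
        rw [hA, add_mul, e, e2]
        linarith
    refine (lintegral_mono hbd).trans_lt ?_
    rw [lintegral_add_left (by fun_prop), lintegral_const_mul _ hGm,
      lintegral_indicator_const Metric.isClosed_closedBall.measurableSet]
    exact ENNReal.add_lt_top.2 ⟨ENNReal.mul_lt_top (by simp) hGfin,
      ENNReal.mul_lt_top (by simp) (hball r)⟩
  have hid := lintegral_halfSum_identity hR hm hbot
  rw [htop, add_top] at hid
  exact (ENNReal.add_ne_top.2 ⟨hfin, hNfin.ne⟩) hid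

end ExtIntegral

/-! ### Balls on which a function of the class is bounded below -/

lemma le_alphaMean (α : EReal) {s t : ℝ≥0} (hst : s + t = 1) {a b c : ℝ≥0∞} (ha : c ≤ a)
    (hb : c ≤ b) : c ≤ alphaMean α s t a b := by
  have hst' : (s : ℝ≥0∞) + t = 1 := by exact_mod_cast hst
  have hst'' : (s : ℝ) + t = 1 := by exact_mod_cast hst
  induction α using exponent_cases with
  | hbot => simpa [alphaMean] using ⟨ha, hb⟩
  | htop => simpa [alphaMean] using .inl ha
  | hzero =>
    simp only [alphaMean, EReal.zero_ne_bot, EReal.zero_ne_top, if_false, if_true]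
    calc c = c ^ (s : ℝ) * c ^ (t : ℝ) := by
          rw [← ENNReal.rpow_add_of_nonneg _ _ s.coe_nonneg t.coe_nonneg, hst'', ENNReal.rpow_one]
      _ ≤ _ := by gcongr
  | hcoe p hp =>
    simp only [alphaMean, EReal.coe_ne_bot, EReal.coe_ne_top, if_false, EReal.toReal_coe,
      EReal.coe_eq_zero, hp, one_div]
    have hc : c = (s * c ^ p + t * c ^ p) ^ p⁻¹ := by
      rw [← add_mul, hst', one_mul, ENNReal.rpow_rpow_inv hp]
    nth_rewrite 1 [hc]
    rcases lt_or_gt_of_ne hp with h | h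
    · refine rpow_le_rpow_of_nonpos (by simpa using h.le) ?_
      exact add_le_add (mul_le_mul' le_rfl (rpow_le_rpow_of_nonpos h.le ha))
        (mul_le_mul' le_rfl (rpow_le_rpow_of_nonpos h.le hb))
    · gcongr

lemma AlphaConcave.convex_le {α : EReal} {f : E n → ℝ≥0∞} (hf : AlphaConcave α f) {δ : ℝ≥0∞}
    (hδ : 0 < δ) : Convex ℝ {x | δ ≤ f x} := by
  intro x hx y hy a b ha hb hab
  have hx : δ ≤ f x := hx
  have hy : δ ≤ f y := hy
  lift a to ℝ≥0 using ha
  lift b to ℝ≥0 using hb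
  have hab' : a + b = 1 := by exact_mod_cast hab
  exact (le_alphaMean α hab' hx hy).trans
    (hf.2 x (hδ.trans_le hx) y (hδ.trans_le hy) a b hab')

/-- The support contains the vertices of a full-dimensional simplex. Superlevel sets are convex, so
on the simplex `f` is at least its smallest vertex value, and the centroid is interior. -/
lemma MemC.exists_closedBall {α : EReal} {f : E n → ℝ≥0∞} (hf : MemC α f) :
    ∃ y₁ : E n, ∃ c > 0, ∃ δ > 0, ∀ y ∈ Metric.closedBall y₁ c, δ ≤ f y := by
  obtain ⟨s, hs, b, hb⟩ := AffineBasis.exists_affine_subbasis hf.full_dim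
  have hfin : Finite s := b.finite
  have : Fintype s := Fintype.ofFinite s
  have hne : Nonempty s := b.nonempty
  obtain ⟨i₀, hi₀⟩ := Finite.exists_min fun i : s => f i
  have hδ : 0 < f i₀ := hs i₀.2
  have hsub : convexHull ℝ (range b) ⊆ {x | f i₀ ≤ f x} := by
    refine convexHull_min ?_ (hf.alphaConcave.convex_le hδ)
    rintro _ ⟨i, rfl⟩
    rw [hb]
    exact hi₀ i
  have hint := interior_mono hsub b.centroid_mem_interior_convexHull
  obtain ⟨c, hc, hball⟩ := Metric.nhds_basis_closedBall.mem_iff.1 (mem_interior_iff_mem_nhds.1 hint)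
  exact ⟨_, c, hc, _, hδ, fun y hy => hball hy⟩

lemma MemC.alphaSupport_lower {p : ℝ} {f : E n → ℝ≥0∞} (hf : MemC p f) :
    ∃ y₁ : E n, ∃ c > 0, ∃ C : ℝ, ∀ ξ,
      ((inner ℝ ξ y₁ + c * ‖ξ‖ - C : ℝ) : EReal) ≤ alphaSupport p f ξ := by
  obtain ⟨y₁, c, hc, δ, hδ, hball⟩ := hf.exists_closedBall
  refine ⟨y₁, c, hc, baseVal p δ, fun ξ => ?_⟩
  -- The point of the ball farthest in direction `ξ`; for `ξ = 0` it is `y₁`, because `0⁻¹ = 0`.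
  set y := y₁ + (c * ‖ξ‖⁻¹) • ξ with hy
  have hyb : y ∈ Metric.closedBall y₁ c := by
    rw [hy, mem_closedBall_iff_norm, add_sub_cancel_left, norm_smul, Real.norm_of_nonneg (by positivity),
      mul_assoc]
    exact mul_le_of_le_one_right hc.le inv_mul_le_one
  have hyf := hball y hyb
  have hyd : y ∈ dom p f := supp_subset_dom _ _ (hδ.trans_le hyf)
  refine le_trans ?_ (le_alphaSupport hf.finite hyd ξ)
  have h1 : baseVal p (f y) ≤ baseVal p δ :=
    baseVal_anti ⟨(hyf.trans_lt (hf.finite y)).ne, fun _ => hδ.ne'⟩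
      (admissible_of_mem_dom hf.finite hyd) hyf
  have h2 : inner ℝ ξ y = inner ℝ ξ y₁ + c * ‖ξ‖ := by
    rw [hy, inner_add_right, inner_smul_right, real_inner_self_eq_norm_sq]
    rcases eq_or_ne ‖ξ‖ 0 with h | h
    · simp [h]
    · field_simp
  norm_cast
  rw [h2]
  linarith

/-! ### The weights -/

lemma measurePreserving_withDensity {W : E n → ℝ≥0∞} (hW : Measurable W) {T : E n → E n}
    (hT : MeasurePreserving T volume volume) (hWT : ∀ x, W (T x) = W x) :
    MeasurePreserving T (volume.withDensity W) (volume.withDensity W) := by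
  refine ⟨hT.measurable, Measure.ext fun s hs => ?_⟩
  rw [Measure.map_apply hT.measurable hs, withDensity_apply _ (hT.measurable hs),
    withDensity_apply _ hs, ← hT.setLIntegral_comp_preimage hs hW]
  simp only [hWT]

/-- Invariance of the mean width for a radial weight. -/
lemma extIntegral_alphaSupport_symm {p : ℝ} {u : E n} (hu : ‖u‖ = 1) {f : E n → ℝ≥0∞}
    (hf : MemC p f) {W : E n → ℝ≥0∞} (hW : Measurable W) (hrad : ∀ x y, ‖x‖ = ‖y‖ → W x = W y)
    (hball : ∀ r, (volume.withDensity W) (Metric.closedBall 0 r) < ∞) :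
    extIntegral (volume.withDensity W) (alphaSupport p (symm p u f)) =
      extIntegral (volume.withDensity W) (alphaSupport p f) := by
  have h : alphaSupport p (symm p u f) = halfSum (reflIso u) (alphaSupport p f) :=
    funext fun ξ => alphaSupport_symm hu hf.tame ξ
  have hR := measurePreserving_withDensity hW (reflIso u).measurePreserving
    fun x => hrad _ _ ((reflIso u).norm_map x)
  have hneg := measurePreserving_withDensity hW (Measure.measurePreserving_neg (volume : Measure (E n)))
    fun x => hrad _ _ (norm_neg x)
  obtain ⟨y₁, c, hc, C, hlow⟩ := hf.alphaSupport_lower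
  have hm : Measurable (alphaSupport p f) := measurable_legendre _
  rw [h]
  exact extIntegral_halfSum hR hm (fun x hx => (EReal.bot_lt_coe _).not_ge (hx ▸ hlow x))
    (lintegral_halfSum_eq_top hR hneg hball hm hc hlow)

lemma withDensity_closedBall_lt_top_of_le {W : E n → ℝ≥0∞} {C : ℝ≥0∞} (hC : C ≠ ∞)
    (h : ∀ x, W x ≤ C) (r : ℝ) : (volume.withDensity W) (Metric.closedBall 0 r) < ∞ := by
  rw [withDensity_apply _ Metric.isClosed_closedBall.measurableSet]
  refine (lintegral_mono h).trans_lt ?_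
  rw [lintegral_const, Measure.restrict_apply_univ]
  exact ENNReal.mul_lt_top hC.lt_top measure_closedBall_lt_top

lemma measurable_weight (α : ℝ) : Measurable (weight (n := n) α) := by
  unfold weight
  refine Measurable.ite (measurableSet_lt measurable_const (by fun_prop)) ?_ measurable_const
  exact ENNReal.measurable_ofReal.comp (Measurable.pow_const (by fun_prop) _)

lemma weight_le_one {α : ℝ} (hα0 : α ≠ 0) (hα : α ≤ 1) (x : E n) : weight α x ≤ 1 := by
  unfold weight
  split_ifs with h
  · rw [← ENNReal.ofReal_one]
    refine ENNReal.ofReal_le_ofReal ?_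
    rcases lt_or_gt_of_ne hα0 with h0 | h0
    · refine Real.rpow_le_one_of_one_le_of_nonpos ?_ ?_
      · nlinarith [sq_nonneg ‖x‖]
      · exact div_nonpos_of_nonneg_of_nonpos (by linarith) h0.le
    · refine Real.rpow_le_one h.le ?_ (div_nonneg (by linarith) h0.le)
      nlinarith [sq_nonneg ‖x‖]
  · exact zero_le

lemma integrableOn_rpow_sub {ρ s : ℝ} (hs : -1 < s) :
    IntegrableOn (fun r => (ρ - r) ^ s) (Ioo 0 ρ) := by
  rcases le_or_gt ρ 0 with h | h
  · rw [Ioo_eq_empty h.not_gt]; exact integrableOn_empty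
  · have := (intervalIntegral.intervalIntegrable_rpow' hs (a := 0) (b := ρ)).comp_sub_left ρ
    rw [sub_zero, sub_self] at this
    rw [← integrableOn_Ioc_iff_integrableOn_Ioo,
      ← intervalIntegrable_iff_integrableOn_Ioc_of_le h.le]
    exact this.symm

/-- The exponent lies in `(-1, 0)`, so the weight blows up on the sphere of radius `ρ = √(2/α)`. In
polar coordinates it is dominated by a constant times `(ρ - r) ^ s`, which is integrable because `s
> -1`. -/
lemma lintegral_weight_lt_top (hn : n ≠ 0) {α : ℝ} (hα : 1 < α) :
    ∫⁻ x : E n, weight α x < ∞ := by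
  set s := (1 - α) / α with hs
  have hs1 : -1 < s := by rw [hs, lt_div_iff₀ (by linarith)]; linarith
  have hs0 : s < 0 := div_neg_of_neg_of_pos (by linarith) (by linarith)
  set w : ℝ → ℝ := fun r => if 0 < 1 - α * r ^ 2 / 2 then (1 - α * r ^ 2 / 2) ^ s else 0 with hw
  have hw0 : ∀ r, 0 ≤ w r := fun r => by
    simp only [hw]; split_ifs with h
    exacts [(Real.rpow_pos_of_pos h _).le, le_rfl]
  have hwm : Measurable w :=
    Measurable.ite (measurableSet_lt measurable_const (by fun_prop))
      (Measurable.pow_const (by fun_prop) _) measurable_const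
  have hW : ∀ x : E n, weight α x = ENNReal.ofReal (w ‖x‖) := fun x => by
    simp only [weight, hw]; split_ifs <;> simp [hs]
  have : NeZero n := ⟨hn⟩
  have : Nontrivial (E n) := by
    refine Module.nontrivial_of_finrank_pos (R := ℝ) ?_
    rw [finrank_euclideanSpace_fin]; exact Nat.pos_of_ne_zero hn
  have hint : Integrable fun x : E n => w ‖x‖ := by
    rw [integrable_fun_norm_addHaar]
    set ρ := √(2 / α) with hρ
    have hρ0 : 0 < ρ := Real.sqrt_pos.2 (by positivity)
    have hρ2 : α * ρ ^ 2 = 2 := by rw [hρ, Real.sq_sqrt (by positivity)]; field_simp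
    have hsupp : ∀ r ∈ Ioi (0 : ℝ) \ Ioo 0 ρ,
        r ^ (Module.finrank ℝ (E n) - 1) • w r = 0 := by
      rintro r ⟨hr0, hr⟩
      have hr0 : 0 < r := hr0
      have hr : ρ ≤ r := not_lt.1 fun h => hr ⟨hr0, h⟩
      have : ¬ 0 < 1 - α * r ^ 2 / 2 := by
        have : ρ ^ 2 ≤ r ^ 2 := by gcongr
        nlinarith
      simp only [hw, if_neg this, smul_zero]
    refine IntegrableOn.of_forall_sdiff_eq_zero ?_ measurableSet_Ioi hsupp
    have hdom : IntegrableOn (fun r => ρ ^ (Module.finrank ℝ (E n) - 1) * (ρ ^ (-s) * (ρ - r) ^ s))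
        (Ioo 0 ρ) := ((integrableOn_rpow_sub hs1).const_mul _).const_mul _
    refine Integrable.mono' hdom
      ((measurable_id.pow_const _).smul hwm).aestronglyMeasurable ?_
    refine (ae_restrict_iff' measurableSet_Ioo).2 (ae_of_all _ fun r hr => ?_)
    have hr1 : 0 < ρ - r := sub_pos.2 hr.2
    have hle : (ρ - r) / ρ ≤ 1 - α * r ^ 2 / 2 := by
      have e : 1 - α * r ^ 2 / 2 = (ρ ^ 2 - r ^ 2) / ρ ^ 2 := by
        have : α = 2 / ρ ^ 2 := by field_simp; linarith
        rw [this]; field_simp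
      rw [e, div_le_div_iff₀ hρ0 (by positivity)]
      nlinarith [mul_pos hr1 hρ0, mul_pos (mul_pos hr1 hρ0) hr.1]
    have hpos : 0 < (ρ - r) / ρ := by positivity
    rw [norm_smul, Real.norm_of_nonneg (pow_nonneg hr.1.le _), Real.norm_of_nonneg (hw0 r)]
    refine mul_le_mul (pow_le_pow_left₀ hr.1.le hr.2.le _) ?_ (hw0 r) (by positivity)
    simp only [hw, hpos.trans_le hle, if_true]
    refine (Real.rpow_le_rpow_of_nonpos hpos hle hs0.le).trans_eq ?_
    rw [Real.div_rpow hr1.le hρ0.le, Real.rpow_neg hρ0.le, div_eq_inv_mul]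
  simp only [hW]
  exact hint.lintegral_lt_top

lemma measurable_gaussian_density : Measurable fun x : E n =>
    ENNReal.ofReal ((2 * Real.pi) ^ (-(n : ℝ) / 2) * Real.exp (-‖x‖ ^ 2 / 2)) := by
  refine ENNReal.measurable_ofReal.comp (measurable_const.mul (Real.measurable_exp.comp ?_))
  exact (measurable_norm.pow_const 2).neg.div_const 2

lemma alphaMeanWidth_symm_coe {p : ℝ} {u : E n} (hu : ‖u‖ = 1) {f : E n → ℝ≥0∞}
    (hf : MemC p f) : alphaMeanWidth p (symm p u f) = alphaMeanWidth p f := by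
  have hn : n ≠ 0 := by
    rintro rfl
    rw [Subsingleton.elim u 0, norm_zero] at hu
    exact zero_ne_one hu
  simp only [alphaMeanWidth, EReal.coe_ne_bot, EReal.coe_ne_top, if_false, EReal.toReal_coe,
    EReal.coe_eq_zero]
  by_cases hp : p = 0
  · subst hp
    simp only [if_true]
    congr 1
    refine extIntegral_alphaSupport_symm hu hf measurable_gaussian_density
      (fun x y h => by rw [h]) ?_
    refine withDensity_closedBall_lt_top_of_le (C := ENNReal.ofReal ((2 * Real.pi) ^ (-(n : ℝ) / 2)))
      (by simp) fun x => ENNReal.ofReal_le_ofReal ?_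
    refine mul_le_of_le_one_right (by positivity) (Real.exp_le_one_iff.2 ?_)
    have := sq_nonneg ‖x‖
    linarith
  · simp only [hp, if_false]
    refine extIntegral_alphaSupport_symm hu hf (measurable_weight p)
      (fun x y h => by simp only [weight, h]) ?_
    rcases le_or_gt p 1 with h1 | h1
    · exact withDensity_closedBall_lt_top_of_le (by simp) (weight_le_one hp h1)
    · intro r
      refine (measure_mono (subset_univ _)).trans_lt ?_
      rw [withDensity_apply _ MeasurableSet.univ, setLIntegral_univ]
      exact lintegral_weight_lt_top hn h1

/-! ### The mean width of sets -/

/-- A linear isometry restricted to the unit sphere. -/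
def sphereMap (R : E n ≃ₗᵢ[ℝ] E n) (v : Metric.sphere (0 : E n) 1) : Metric.sphere (0 : E n) 1 :=
  ⟨R v, by simp⟩

lemma continuous_sphereMap (R : E n ≃ₗᵢ[ℝ] E n) : Continuous (sphereMap R) := by
  unfold sphereMap; fun_prop

/-- The surface measure is defined through volumes of cones over subsets of the sphere, and `R` maps
cones to cones preserving volume. -/
lemma measurePreserving_sphereMap (R : E n ≃ₗᵢ[ℝ] E n) :
    MeasurePreserving (sphereMap R) (volume : Measure (E n)).toSphere
      (volume : Measure (E n)).toSphere := by
  refine ⟨(continuous_sphereMap R).measurable, Measure.ext fun s hs => ?_⟩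
  have hm := (continuous_sphereMap R).measurable hs
  rw [Measure.map_apply (continuous_sphereMap R).measurable hs, Measure.toSphere_apply' _ hm,
    Measure.toSphere_apply' _ hs, ← (show MeasurePreserving R.toMeasurableEquiv volume volume from
      R.measurePreserving).measure_preimage_equiv (Ioo (0 : ℝ) 1 • (Subtype.val '' s))]
  congr 2
  ext x
  simp only [Set.mem_smul, mem_preimage, mem_image]
  constructor
  · rintro ⟨r, hr, _, ⟨v, hv, rfl⟩, rfl⟩
    exact ⟨r, hr, _, ⟨_, hv, rfl⟩, by simp [sphereMap]⟩
  · rintro ⟨r, hr, _, ⟨v, hv, rfl⟩, h⟩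
    refine ⟨r, hr, R.symm v, ⟨sphereMap R.symm v, ?_, rfl⟩, ?_⟩
    · convert hv using 1
      ext1
      simp [sphereMap]
    · apply R.injective
      rw [map_smul, R.apply_symm_apply]
      exact h

lemma suppFun_eq_of_isMax {K : Set (E n)} {v x : E n} (hx : x ∈ K)
    (h : ∀ y ∈ K, inner ℝ y v ≤ inner ℝ x v) : suppFun K v = inner ℝ x v :=
  IsGreatest.csSup_eq ⟨⟨x, hx, rfl⟩, by rintro _ ⟨y, hy, rfl⟩; exact h y hy⟩

/-- Maximizers for the directions `v` and `reflIso u v` combine to a maximizer on the symmetral; for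
the empty set all terms are the default `0` of `sSup`. -/
lemma suppFun_symmSet {u : E n} (hu : ‖u‖ = 1) {K : Set (E n)} (hK : IsCompact K) (v : E n) :
    suppFun (symmSet u K) v = 2⁻¹ * suppFun K v + 2⁻¹ * suppFun K (reflIso u v) := by
  rcases K.eq_empty_or_nonempty with rfl | hne
  · simp [symmSet, suppFun]
  have hmax : ∀ v, ∃ x ∈ K, ∀ y ∈ K, inner ℝ y v ≤ inner ℝ x v := fun v =>
    hK.exists_isMaxOn hne (f := fun x => inner ℝ x v)
      (Continuous.continuousOn (continuous_id.inner continuous_const))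
  obtain ⟨x, hx, hxm⟩ := hmax v
  obtain ⟨z, hz, hzm⟩ := hmax (reflIso u v)
  have hinner : ∀ z, inner ℝ (reflIso u z) v = inner ℝ z (reflIso u v) := fun z => by
    rw [real_inner_comm, inner_reflIso, real_inner_comm]
  rw [suppFun_eq_of_isMax hx hxm, suppFun_eq_of_isMax hz hzm, symmSet, reflPt_eq hu]
  rw [suppFun_eq_of_isMax (x := (1 / 2 : ℝ) • x + (1 / 2 : ℝ) • reflIso u z)]
  · rw [inner_add_left, real_inner_smul_left, real_inner_smul_left, hinner, one_div]
  · exact Set.add_mem_add (smul_mem_smul_set hx) (smul_mem_smul_set ⟨z, hz, rfl⟩)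
  · rintro _ ⟨_, ⟨y, hy, rfl⟩, _, ⟨_, ⟨y', hy', rfl⟩, rfl⟩, rfl⟩
    have h1 := hxm y hy
    have h2 := hzm y' hy'
    simp only [inner_add_left, real_inner_smul_left, hinner]
    linarith

lemma meanWidth_symmSet {u : E n} (hu : ‖u‖ = 1) {K : Set (E n)} (hK : IsCompact K) :
    meanWidth (symmSet u K) = meanWidth K := by
  unfold meanWidth
  congr 1
  set σ := (volume : Measure (E n)).toSphere
  have hK' : Continuous (suppFun K) :=
    hK.continuous_sSup (f := fun (v : E n) x => inner ℝ x v) (continuous_snd.inner continuous_fst)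
  have hcont : Continuous fun v : Metric.sphere (0 : E n) 1 => suppFun K v :=
    hK'.comp continuous_subtype_val
  have hint : ∀ F : Metric.sphere (0 : E n) 1 → ℝ, Continuous F → Integrable F σ := fun F hF => by
    rw [← integrableOn_univ]
    exact hF.continuousOn.integrableOn_compact isCompact_univ
  have hcont' : Continuous fun v : Metric.sphere (0 : E n) 1 => suppFun K (reflIso u v) :=
    hK'.comp ((reflIso u).continuous.comp continuous_subtype_val)
  simp only [suppFun_symmSet hu hK, average_eq]
  rw [integral_add ((hint _ hcont).const_mul _) ((hint _ hcont').const_mul _), integral_const_mul]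
  have h2 : ∫ v : Metric.sphere (0 : E n) 1, 2⁻¹ * suppFun K (reflIso u v) ∂σ =
      2⁻¹ * ∫ v : Metric.sphere (0 : E n) 1, suppFun K v ∂σ := by
    rw [integral_const_mul]
    congr 1
    have hmp : MeasurePreserving (sphereMap (reflIso u)) σ σ := measurePreserving_sphereMap _
    conv_rhs => rw [← hmp.map_eq]
    rw [integral_map (continuous_sphereMap _).measurable.aemeasurable
      hcont.aestronglyMeasurable]
    rfl
  rw [h2]
  congr 1
  ring

/-- The symmetral has the same mean width. -/
lemma MemC.alphaMeanWidth_symm {α : EReal} (hα : α ≠ ⊤) {u : E n} (hu : ‖u‖ = 1)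
    {f : E n → ℝ≥0∞} (hf : MemC α f) : alphaMeanWidth α (symm α u f) = alphaMeanWidth α f := by
  induction α with
  | bot =>
    simp only [alphaMeanWidth, if_true]
    congr 1
    refine setLIntegral_congr_fun measurableSet_Ioi fun t ht => ?_
    have ht : 0 < t := ht
    rw [superlevel_symm_bot hu hf.tame ht,
      meanWidth_symmSet hu (K := superlevel t f) (hf.tame.isCompact_le (by simpa using ht))]
  | top => exact absurd rfl hα
  | coe p => exact alphaMeanWidth_symm_coe hu hf

/-! ### The one-dimensional Brunn–Minkowski inequality -/

section BrunnMinkowski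

variable {s t : ℝ}

lemma volume_vadd_smul (c : ℝ) (hs : 0 ≤ s) (A : Set ℝ) :
    volume (c +ᵥ s • A) = ENNReal.ofReal s * volume A := by
  rw [measure_vadd, Measure.addHaar_smul]
  simp [abs_of_nonneg hs]

/-- With `a₀ = max A` and `b₀ = min B`, the translates `tb₀ + sA` and `sa₀ + tB` both lie in `C` and
meet only at `sa₀ + tb₀`. -/
lemma brunn_minkowski_compact (hs : 0 < s) (ht : 0 < t) {A B C : Set ℝ} (hA : IsCompact A)
    (hB : IsCompact B) (hA0 : A.Nonempty) (hB0 : B.Nonempty)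
    (h : ∀ a ∈ A, ∀ b ∈ B, s * a + t * b ∈ C) :
    ENNReal.ofReal s * volume A + ENNReal.ofReal t * volume B ≤ volume C := by
  obtain ⟨a₀, ha₀, ha⟩ := hA.exists_isGreatest hA0
  obtain ⟨b₀, hb₀, hb⟩ := hB.exists_isLeast hB0
  rw [← volume_vadd_smul (t * b₀) hs.le A, ← volume_vadd_smul (s * a₀) ht.le B]
  have hdisj : AEDisjoint volume ((t * b₀) +ᵥ s • A) ((s * a₀) +ᵥ t • B) := by
    refine measure_mono_null (t := {s * a₀ + t * b₀}) ?_ (by simp)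
    rintro _ ⟨⟨_, ⟨a, haA, rfl⟩, rfl⟩, ⟨_, ⟨b, hbB, rfl⟩, hab⟩⟩
    simp only [vadd_eq_add, smul_eq_mul, mem_singleton_iff] at hab ⊢
    have h1 := mul_le_mul_of_nonneg_left (ha haA) hs.le
    have h2 := mul_le_mul_of_nonneg_left (hb hbB) ht.le
    linarith
  have hBm : MeasurableSet ((s * a₀) +ᵥ t • B) := ((hB.smul t).vadd (s * a₀)).isClosed.measurableSet
  rw [← measure_union₀ hBm.nullMeasurableSet hdisj]
  refine measure_mono (union_subset ?_ ?_)
  · rintro _ ⟨_, ⟨a, haA, rfl⟩, rfl⟩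
    simpa [add_comm] using h a haA b₀ hb₀
  · rintro _ ⟨_, ⟨b, hbB, rfl⟩, rfl⟩
    simpa using h a₀ ha₀ b hbB

lemma mul_measure_le_of_compact {A : Set ℝ} (hA : MeasurableSet A) (hA0 : A.Nonempty)
    {c d e : ℝ≥0∞} (h : ∀ K ⊆ A, IsCompact K → K.Nonempty → c * volume K + d ≤ e) :
    c * volume A + d ≤ e := by
  obtain ⟨a, ha⟩ := hA0
  rw [hA.measure_eq_iSup_isCompact, ENNReal.mul_iSup, ENNReal.iSup_add]
  refine iSup_le fun K => ?_
  by_cases hK : K ⊆ A ∧ IsCompact K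
  · rw [iSup_pos hK.1, iSup_pos hK.2]
    -- The approximating compact set may be empty; adjoining a point of `A` repairs this without
    -- decreasing the measure.
    refine le_trans ?_ (h (insert a K) (insert_subset ha hK.1) (hK.2.insert a) (insert_nonempty a K))
    gcongr
    exact subset_insert a K
  · have h0 : (⨆ (_ : K ⊆ A) (_ : IsCompact K), volume K) = 0 := by
      simp only [← bot_eq_zero, iSup_eq_bot]
      exact fun h1 h2 => absurd ⟨h1, h2⟩ hK
    rw [h0]
    refine le_trans ?_ (h {a} (by simpa) isCompact_singleton (singleton_nonempty a))
    gcongr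
    exact zero_le

lemma brunn_minkowski_real (hs : 0 < s) (ht : 0 < t) {A B C : Set ℝ} (hA : MeasurableSet A)
    (hB : MeasurableSet B) (hA0 : A.Nonempty) (hB0 : B.Nonempty)
    (h : ∀ a ∈ A, ∀ b ∈ B, s * a + t * b ∈ C) :
    ENNReal.ofReal s * volume A + ENNReal.ofReal t * volume B ≤ volume C := by
  refine mul_measure_le_of_compact hA hA0 fun K hKA hK hK0 => ?_
  rw [add_comm]
  refine mul_measure_le_of_compact hB hB0 fun L hLB hL hL0 => ?_
  rw [add_comm]
  exact brunn_minkowski_compact hs ht hK hL hK0 hL0 fun a ha b hb => h a (hKA ha) b (hLB hb)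

end BrunnMinkowski

/-! ### Functional inequalities on the line -/

section Line

variable {s t : ℝ} {f g h : ℝ → ℝ≥0∞}

lemma lintegral_eq_lintegral_meas_lt_of_le_one {f : ℝ → ℝ≥0∞} (hf : Measurable f)
    (hf1 : ∀ x, f x ≤ 1) :
    ∫⁻ x, f x = ∫⁻ τ in Ioi (0 : ℝ), volume {x | τ < (f x).toReal} := by
  rw [← lintegral_eq_lintegral_meas_lt volume (ae_of_all _ fun x => ENNReal.toReal_nonneg)
    hf.ennreal_toReal.aemeasurable]
  exact lintegral_congr fun x =>
    (ENNReal.ofReal_toReal ((hf1 x).trans_lt ENNReal.one_lt_top).ne).symm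

/-- Layer-cake formula. Since both suprema are `1`, the superlevel sets of `f` and `g` are nonempty
at exactly the levels below `1`, and there Brunn–Minkowski applies; `h` is truncated at `1`. -/
lemma lintegral_le_of_min_le_of_iSup_eq_one (hs : 0 < s) (ht : 0 < t) (hf : Measurable f)
    (hg : Measurable g) (hh : Measurable h) (hf1 : ⨆ x, f x = 1) (hg1 : ⨆ x, g x = 1)
    (hle : ∀ x y, min (f x) (g y) ≤ h (s * x + t * y)) :
    ENNReal.ofReal s * (∫⁻ x, f x) + ENNReal.ofReal t * (∫⁻ x, g x) ≤ ∫⁻ x, h x := by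
  have hf1' : ∀ x, f x ≤ 1 := fun x => hf1 ▸ le_iSup f x
  have hg1' : ∀ x, g x ≤ 1 := fun x => hg1 ▸ le_iSup g x
  have hmeas : ∀ F : ℝ → ℝ≥0∞, Measurable F → ∀ τ : ℝ, MeasurableSet {x | τ < (F x).toReal} :=
    fun F hF τ => measurableSet_lt measurable_const hF.ennreal_toReal
  have hmeas' : ∀ F : ℝ → ℝ≥0∞, Measurable fun τ : ℝ => volume {x | τ < (F x).toReal} := fun F =>
    Antitone.measurable fun a b hab => measure_mono fun x hx => lt_of_le_of_lt hab hx
  have hemp : ∀ F : ℝ → ℝ≥0∞, (∀ x, F x ≤ 1) → ∀ τ : ℝ, 1 ≤ τ → {x | τ < (F x).toReal} = ∅ := by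
    intro F hF τ hτ
    ext x
    simp only [mem_ofPred_eq, mem_empty_iff_false, iff_false, not_lt]
    exact (ENNReal.toReal_mono ENNReal.one_ne_top (hF x)).trans (by simpa using hτ)
  have hnon : ∀ F : ℝ → ℝ≥0∞, ⨆ x, F x = 1 → (∀ x, F x ≤ 1) → ∀ τ : ℝ, 0 < τ → τ < 1 →
      {x | τ < (F x).toReal}.Nonempty := by
    intro F hF hF' τ h0 hτ
    have h1 : ENNReal.ofReal τ < ⨆ x, F x := by rw [hF]; simpa using hτ
    obtain ⟨x, hx⟩ := lt_iSup_iff.1 h1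
    exact ⟨x, (ENNReal.ofReal_lt_iff_lt_toReal h0.le ((hF' x).trans_lt ENNReal.one_lt_top).ne).1 hx⟩
  calc _ = ∫⁻ τ in Ioi (0 : ℝ), (ENNReal.ofReal s * volume {x | τ < (f x).toReal} +
        ENNReal.ofReal t * volume {x | τ < (g x).toReal}) := by
        rw [lintegral_add_left ((hmeas' f).const_mul _), lintegral_const_mul _ (hmeas' f),
          lintegral_const_mul _ (hmeas' g), lintegral_eq_lintegral_meas_lt_of_le_one hf hf1',
          lintegral_eq_lintegral_meas_lt_of_le_one hg hg1']
    _ ≤ ∫⁻ τ in Ioi (0 : ℝ), volume {x | τ < (min (h x) 1).toReal} := by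
        refine setLIntegral_mono' measurableSet_Ioi fun τ hτ => ?_
        rcases lt_or_ge τ 1 with h1 | h1
        · refine brunn_minkowski_real hs ht (hmeas f hf τ) (hmeas g hg τ) (hnon f hf1 hf1' τ hτ h1)
            (hnon g hg1 hg1' τ hτ h1) fun a ha b hb => ?_
          have hlt : τ < (min (f a) (g b)).toReal := by
            rcases min_choice (f a) (g b) with e | e <;> rw [e]
            exacts [ha, hb]
          refine hlt.trans_le (ENNReal.toReal_mono ?_ (le_min (hle a b) ?_))
          · exact ((min_le_right _ _).trans_lt ENNReal.one_lt_top).ne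
          · exact (min_le_left _ _).trans (hf1' a)
        · rw [hemp f hf1' τ h1, hemp g hg1' τ h1]; simp
    _ = ∫⁻ x, min (h x) 1 :=
        (lintegral_eq_lintegral_meas_lt_of_le_one (by fun_prop) fun x => min_le_right _ _).symm
    _ ≤ ∫⁻ x, h x := lintegral_mono fun x => min_le_left _ _

/-- The inequality on the line, in terms of the suprema `a, b` of the functions. -/
lemma mul_lintegral_le_of_mul_min_le (hs : 0 < s) (ht : 0 < t) (hf : Measurable f)
    (hg : Measurable g) (hh : Measurable h) {a b m : ℝ≥0∞} (hfa : ⨆ x, f x = a)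
    (hgb : ⨆ x, g x = b) (ha0 : a ≠ 0) (ha : a ≠ ∞) (hb0 : b ≠ 0) (hb : b ≠ ∞) (hm : m ≠ ∞)
    (hle : ∀ x y, m * min (f x / a) (g y / b) ≤ h (s * x + t * y)) :
    m * (ENNReal.ofReal s * ((∫⁻ x, f x) / a) + ENNReal.ofReal t * ((∫⁻ x, g x) / b)) ≤
      ∫⁻ x, h x := by
  rcases eq_or_ne m 0 with rfl | hm0
  · simp
  have h1 := lintegral_le_of_min_le_of_iSup_eq_one hs ht (f := fun x => f x / a)
    (g := fun x => g x / b) (h := fun x => h x / m) (by fun_prop) (by fun_prop) (by fun_prop)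
    (by rw [← ENNReal.iSup_div, hfa, ENNReal.div_self ha0 ha])
    (by rw [← ENNReal.iSup_div, hgb, ENNReal.div_self hb0 hb])
    (fun x y => by
      rw [ENNReal.le_div_iff_mul_le (.inl hm0) (.inl hm), mul_comm]
      exact hle x y)
  simp only [div_eq_mul_inv] at h1 ⊢
  rw [lintegral_mul_const _ hf, lintegral_mul_const _ hg, lintegral_mul_const _ hh,
    ← div_eq_mul_inv (∫⁻ x, h x), ENNReal.le_div_iff_mul_le (.inl hm0) (.inl hm)] at h1
  rwa [mul_comm m]

end Line

/-! ### Induction on the dimension -/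

/-- The properties of a pair of means that make the integral inequality for `m` on the line yield
a lower bound by `m'` of the integrals. -/
structure MeanStep (s t : ℝ) (m m' : ℝ≥0∞ → ℝ≥0∞ → ℝ≥0∞) : Prop where
  mono : ∀ {a b c d}, a ≤ c → b ≤ d → m a b ≤ m c d
  ne_top : ∀ {a b}, a ≠ ∞ → b ≠ ∞ → m a b ≠ ∞
  mul_le : ∀ (r : ℝ≥0∞) {a b}, r ≠ ∞ → r * m a b ≤ m (r * a) (r * b)
  holder : ∀ {a b A B}, a ≠ 0 → a ≠ ∞ → b ≠ 0 → b ≠ ∞ →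
    m' A B ≤ m a b * (ENNReal.ofReal s * (A / a) + ENNReal.ofReal t * (B / b))
  iSup_le : ∀ {A B : ℕ → ℝ≥0∞}, Monotone A → Monotone B →
    m' (⨆ k, A k) (⨆ k, B k) ≤ ⨆ k, m' (A k) (B k)
  zero_left : ∀ B, m' 0 B = 0
  zero_right : ∀ A, m' A 0 = 0

section MeanStep

variable {s t : ℝ} {m m' : ℝ≥0∞ → ℝ≥0∞ → ℝ≥0∞} {f g h : ℝ → ℝ≥0∞}

lemma MeanStep.mul_min_le (hm : MeanStep s t m m') {x y a b : ℝ≥0∞} (ha0 : a ≠ 0) (ha : a ≠ ∞)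
    (hb0 : b ≠ 0) (hb : b ≠ ∞) (hx : x ≠ ∞) : m a b * min (x / a) (y / b) ≤ m x y := by
  rw [mul_comm]
  have hr : min (x / a) (y / b) ≠ ∞ :=
    ((min_le_left _ _).trans_lt (ENNReal.div_lt_top hx ha0)).ne
  refine (hm.mul_le _ hr).trans (hm.mono ?_ ?_)
  · exact (mul_le_mul' (min_le_left _ _) le_rfl).trans_eq (ENNReal.div_mul_cancel ha0 ha)
  · exact (mul_le_mul' (min_le_right _ _) le_rfl).trans_eq (ENNReal.div_mul_cancel hb0 hb)

/-- Dividing by the suprema gives a bound by an arithmetic mean of normalized integrals times the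
mean `m` of the suprema; the field `holder` trades this product for `m'`. -/
lemma MeanStep.lintegral_le_of_bounded (hm : MeanStep s t m m') (hs : 0 < s) (ht : 0 < t)
    (hf : Measurable f) (hg : Measurable g) (hh : Measurable h) {C : ℝ≥0∞} (hC : C ≠ ∞)
    (hfC : ∀ x, f x ≤ C) (hgC : ∀ x, g x ≤ C) (hle : ∀ x y, m (f x) (g y) ≤ h (s * x + t * y)) :
    m' (∫⁻ x, f x) (∫⁻ x, g x) ≤ ∫⁻ x, h x := by
  have ha : ⨆ x, f x ≠ ∞ := ((_root_.iSup_le hfC).trans_lt hC.lt_top).ne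
  have hb : ⨆ x, g x ≠ ∞ := ((_root_.iSup_le hgC).trans_lt hC.lt_top).ne
  by_cases ha0 : ⨆ x, f x = 0
  · simp [ENNReal.iSup_eq_zero.1 ha0, hm.zero_left]
  by_cases hb0 : ⨆ x, g x = 0
  · simp [ENNReal.iSup_eq_zero.1 hb0, hm.zero_right]
  refine (hm.holder ha0 ha hb0 hb).trans
    (mul_lintegral_le_of_mul_min_le hs ht hf hg hh rfl rfl ha0 ha hb0 hb (hm.ne_top ha hb) ?_)
  exact fun x y => (hm.mul_min_le ha0 ha hb0 hb ((hfC x).trans_lt hC.lt_top).ne).trans (hle x y)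

lemma lintegral_eq_iSup_min {f : ℝ → ℝ≥0∞} (hf : Measurable f) :
    ∫⁻ x, f x = ⨆ k : ℕ, ∫⁻ x, min (f x) k := by
  rw [← lintegral_iSup (f := fun (k : ℕ) x => min (f x) k) (fun k => by fun_prop)
    fun i j hij x => min_le_min le_rfl (by exact_mod_cast hij)]
  refine lintegral_congr fun x => ?_
  rw [← inf_iSup_eq, ENNReal.iSup_natCast]
  simp

lemma MeanStep.lintegral_le (hm : MeanStep s t m m') (hs : 0 < s) (ht : 0 < t)
    (hf : Measurable f) (hg : Measurable g) (hh : Measurable h)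
    (hle : ∀ x y, m (f x) (g y) ≤ h (s * x + t * y)) :
    m' (∫⁻ x, f x) (∫⁻ x, g x) ≤ ∫⁻ x, h x := by
  have hmono : ∀ F : ℝ → ℝ≥0∞, Monotone fun k : ℕ => ∫⁻ x, min (F x) k := fun F i j hij =>
    lintegral_mono fun x => min_le_min le_rfl (by exact_mod_cast hij)
  rw [lintegral_eq_iSup_min hf, lintegral_eq_iSup_min hg]
  refine (hm.iSup_le (hmono f) (hmono g)).trans (_root_.iSup_le fun k => ?_)
  exact hm.lintegral_le_of_bounded hs ht (by fun_prop) (by fun_prop) hh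
    (ENNReal.natCast_ne_top k) (fun x => min_le_right _ _) (fun x => min_le_right _ _)
    fun x y => (hm.mono (min_le_left _ _) (min_le_left _ _)).trans (hle x y)

lemma lintegral_fin_succ {n : ℕ} {f : (Fin (n + 1) → ℝ) → ℝ≥0∞} (hf : Measurable f) :
    ∫⁻ x, f x = ∫⁻ r : ℝ, ∫⁻ y : Fin n → ℝ, f (Fin.cons r y) := by
  have hmp := (volume_preserving_piFinSuccAbove (fun _ : Fin (n + 1) => ℝ) 0).symm
  rw [← hmp.lintegral_comp hf, Measure.volume_eq_prod, lintegral_prod _ (by fun_prop)]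
  simp [MeasurableEquiv.piFinSuccAbove, Fin.insertNthEquiv]

lemma measurable_cons {n : ℕ} :
    Measurable fun p : ℝ × (Fin n → ℝ) => (Fin.cons p.1 p.2 : Fin (n + 1) → ℝ) := by
  refine measurable_pi_lambda _ fun i => ?_
  refine Fin.cases ?_ (fun i => ?_) i
  · simpa using measurable_fst
  · simpa [Function.comp_def] using (measurable_pi_apply i).comp measurable_snd

/-- Fubini: integrating out all coordinates but the first lowers the index of the mean from `k + n +
1` to `k + 1`, and integrating the first lowers it to `k`. The index `k` stays general for the
induction. -/
lemma lintegral_le_of_meanStep {M : ℕ → ℝ≥0∞ → ℝ≥0∞ → ℝ≥0∞}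
    (hM : ∀ k, MeanStep s t (M (k + 1)) (M k)) (hs : 0 < s) (ht : 0 < t) {n : ℕ} (k : ℕ)
    {f g h : (Fin n → ℝ) → ℝ≥0∞} (hf : Measurable f) (hg : Measurable g) (hh : Measurable h)
    (hle : ∀ x y, M (k + n) (f x) (g y) ≤ h (s • x + t • y)) :
    M k (∫⁻ x, f x) (∫⁻ x, g x) ≤ ∫⁻ x, h x := by
  induction n generalizing k with
  | zero =>
    simp only [lintegral_unique, volume_pi, Measure.pi_univ, Finset.univ_eq_empty,
      Finset.prod_empty, mul_one]
    convert hle default default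
    exact (add_zero k).symm
  | succ n ih =>
    rw [lintegral_fin_succ hf, lintegral_fin_succ hg, lintegral_fin_succ hh]
    have hmeas : ∀ F : (Fin (n + 1) → ℝ) → ℝ≥0∞, Measurable F →
        Measurable fun r : ℝ => ∫⁻ y : Fin n → ℝ, F (Fin.cons r y) := fun F hF =>
      Measurable.lintegral_prod_right' (hF.comp measurable_cons)
    refine (hM k).lintegral_le hs ht (hmeas f hf) (hmeas g hg) (hmeas h hh) fun x y => ?_
    have hsec : ∀ F : (Fin (n + 1) → ℝ) → ℝ≥0∞, Measurable F → ∀ r : ℝ,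
        Measurable fun y : Fin n → ℝ => F (Fin.cons r y) := fun F hF r =>
      hF.comp (measurable_cons.comp measurable_prodMk_left)
    refine ih (k + 1) (hsec f hf _) (hsec g hg _) (hsec h hh _) fun x' y' => ?_
    have := hle (Fin.cons x x') (Fin.cons y y')
    have hc : s • (Fin.cons x x' : Fin (n + 1) → ℝ) + t • (Fin.cons y y' : Fin (n + 1) → ℝ) =
        Fin.cons (s * x + t * y) (s • x' + t • y') := by
      ext i
      refine Fin.cases ?_ (fun i => ?_) i <;> simp
    rwa [hc, show k + (n + 1) = k + 1 + n by ring] at this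

end MeanStep

/-! ### The Prékopa–Leindler inequality -/

section PrekopaLeindler

variable {s t : ℝ}

lemma geom_mean_le_arith_mean (hs : 0 < s) (ht : 0 < t) (hst : s + t = 1) (a b : ℝ≥0∞) :
    a ^ s * b ^ t ≤ ENNReal.ofReal s * a + ENNReal.ofReal t * b := by
  by_cases ha : a = ∞
  · simp [ha, ENNReal.mul_top, hs]
  by_cases hb : b = ∞
  · simp [hb, ENNReal.mul_top, ht]
  lift a to ℝ≥0 using ha
  lift b to ℝ≥0 using hb
  lift s to ℝ≥0 using hs.le
  lift t to ℝ≥0 using ht.le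
  have := NNReal.geom_mean_le_arith_mean2_weighted s t a b (by exact_mod_cast hst)
  rw [← ENNReal.coe_le_coe] at this
  simpa [ENNReal.coe_rpow_of_nonneg] using this

lemma meanStep_geom (hs : 0 < s) (ht : 0 < t) (hst : s + t = 1) :
    MeanStep s t (fun a b => a ^ s * b ^ t) (fun a b => a ^ s * b ^ t) where
  mono h1 h2 := mul_le_mul' (ENNReal.rpow_le_rpow h1 hs.le) (ENNReal.rpow_le_rpow h2 ht.le)
  ne_top ha hb := ENNReal.mul_ne_top (ENNReal.rpow_ne_top_of_nonneg hs.le ha)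
    (ENNReal.rpow_ne_top_of_nonneg ht.le hb)
  mul_le r a b hr := by
    rw [ENNReal.mul_rpow_of_nonneg _ _ hs.le, ENNReal.mul_rpow_of_nonneg _ _ ht.le]
    have : r = r ^ s * r ^ t := by
      rw [← ENNReal.rpow_add_of_nonneg _ _ hs.le ht.le, hst, ENNReal.rpow_one]
    nth_rewrite 1 [this]
    exact le_of_eq (by ring)
  holder := by
    intro a b A B ha0 ha hb0 hb
    refine le_trans (le_of_eq ?_)
      (mul_le_mul' le_rfl (geom_mean_le_arith_mean hs ht hst (A / a) (B / b)))
    rw [mul_mul_mul_comm, ← ENNReal.mul_rpow_of_nonneg _ _ hs.le,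
      ← ENNReal.mul_rpow_of_nonneg _ _ ht.le, ENNReal.mul_div_cancel ha0 ha,
      ENNReal.mul_div_cancel hb0 hb]
  iSup_le := by
    intro A B hA hB
    rcases eq_or_ne (⨆ k, A k) 0 with h | hA0
    · simp [h, hs]
    rcases eq_or_ne (⨆ k, B k) 0 with h | hB0
    · simp [h, ht]
    have h1 := (ENNReal.continuous_rpow_const (y := s)).continuousAt.tendsto.comp
      (tendsto_atTop_iSup hA)
    have h2 := (ENNReal.continuous_rpow_const (y := t)).continuousAt.tendsto.comp
      (tendsto_atTop_iSup hB)
    refine le_of_tendsto' (ENNReal.Tendsto.mul h1 (.inl ?_) h2 (.inl ?_)) fun k =>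
      le_iSup (fun k => A k ^ s * B k ^ t) k
    · simp [ENNReal.rpow_eq_zero_iff, hA0, hs.not_gt]
    · simp [ENNReal.rpow_eq_zero_iff, hB0, ht.not_gt]
  zero_left B := by simp [hs]
  zero_right A := by simp [ht]

lemma prekopa_leindler (hs : 0 < s) (ht : 0 < t) (hst : s + t = 1) {n : ℕ}
    {f g h : (Fin n → ℝ) → ℝ≥0∞} (hf : Measurable f) (hg : Measurable g) (hh : Measurable h)
    (hle : ∀ x y, f x ^ s * g y ^ t ≤ h (s • x + t • y)) :
    (∫⁻ x, f x) ^ s * (∫⁻ x, g x) ^ t ≤ ∫⁻ x, h x :=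
  lintegral_le_of_meanStep (M := fun _ a b => a ^ s * b ^ t) (fun _ => meanStep_geom hs ht hst)
    hs ht 0 hf hg hh hle

end PrekopaLeindler

/-! ### The inequality of Borell, Brascamp and Lieb for equal masses -/

lemma continuous_midMean {p : ℝ} (hp : p ≠ 0) :
    Continuous (fun q : ℝ≥0∞ × ℝ≥0∞ => midMean p q.1 q.2) := by
  simp only [midMean_coe hp]
  have h1 : Continuous fun q : ℝ≥0∞ × ℝ≥0∞ => 2⁻¹ * q.1 ^ p :=
    (ENNReal.continuous_const_mul (by simp)).comp
      (ENNReal.continuous_rpow_const.comp continuous_fst)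
  have h2 : Continuous fun q : ℝ≥0∞ × ℝ≥0∞ => 2⁻¹ * q.2 ^ p :=
    (ENNReal.continuous_const_mul (by simp)).comp
      (ENNReal.continuous_rpow_const.comp continuous_snd)
  exact ENNReal.continuous_rpow_const.comp (h1.add h2)

/-- The exponent `-1/k`, read as `-∞` for `k = 0`. -/
def bblExponent (k : ℕ) : EReal := if k = 0 then ⊥ else ((-(1 / (k : ℝ)) : ℝ) : EReal)

lemma bblExponent_zero : bblExponent 0 = ⊥ := if_pos rfl

lemma bblExponent_of_ne {k : ℕ} (hk : k ≠ 0) : bblExponent k = ((-(1 / (k : ℝ)) : ℝ) : EReal) :=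
  if_neg hk

lemma bblExponent_nonpos (k : ℕ) : bblExponent k ≤ 0 := by
  unfold bblExponent
  split_ifs
  · exact bot_le
  · rw [← EReal.coe_zero, EReal.coe_le_coe_iff, neg_nonpos]; positivity

lemma continuous_midMean_bblExponent (k : ℕ) :
    Continuous (fun q : ℝ≥0∞ × ℝ≥0∞ => midMean (bblExponent k) q.1 q.2) := by
  by_cases hk : k = 0
  · simp only [hk, bblExponent_zero, midMean_bot]; fun_prop
  · rw [bblExponent_of_ne hk]
    exact continuous_midMean (by simpa using hk)

/-- Hölder's inequality with exponents `1/θ` and `1/(1-θ)` for sums of two terms. -/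
lemma half_concave_geom {θ : ℝ} (h0 : 0 < θ) (h1 : θ < 1) (x y v w : ℝ≥0∞) :
    2⁻¹ * (x ^ θ * v ^ (1 - θ)) + 2⁻¹ * (y ^ θ * w ^ (1 - θ)) ≤
      (2⁻¹ * x + 2⁻¹ * y) ^ θ * (2⁻¹ * v + 2⁻¹ * w) ^ (1 - θ) := by
  have h1' : 0 < 1 - θ := by linarith
  have hpq : (θ⁻¹).HolderConjugate ((1 - θ)⁻¹) := by
    rw [Real.holderConjugate_iff]
    exact ⟨(one_lt_inv₀ h0).2 h1, by simp⟩
  have h := ENNReal.inner_le_Lp_mul_Lq Finset.univ ![(2⁻¹ * x) ^ θ, (2⁻¹ * y) ^ θ]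
    ![(2⁻¹ * v) ^ (1 - θ), (2⁻¹ * w) ^ (1 - θ)] hpq
  simp only [Fin.sum_univ_two, Matrix.cons_val_zero, Matrix.cons_val_one, one_div, inv_inv,
    ENNReal.rpow_rpow_inv h0.ne', ENNReal.rpow_rpow_inv h1'.ne'] at h
  refine le_trans (le_of_eq ?_) h
  have e : ∀ a b : ℝ≥0∞, (2⁻¹ * a) ^ θ * (2⁻¹ * b) ^ (1 - θ) = 2⁻¹ * (a ^ θ * b ^ (1 - θ)) := by
    intro a b
    rw [ENNReal.mul_rpow_of_nonneg _ _ h0.le, ENNReal.mul_rpow_of_nonneg _ _ h1'.le,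
      mul_mul_mul_comm, ← ENNReal.rpow_add_of_nonneg _ _ h0.le h1'.le]
    norm_num
  rw [e, e]

/-- For `k = 0` the minimum is simply compared with `A` and with `B`. For `k > 0` it is Hölder's
inequality raised to the negative power `-(k+1)`, which reverses it. -/
lemma bbl_holder {k : ℕ} {a b A B : ℝ≥0∞} (ha0 : a ≠ 0) (ha : a ≠ ∞) (hb0 : b ≠ 0) (hb : b ≠ ∞)
    (hA0 : A ≠ 0) (hA : A ≠ ∞) (hB0 : B ≠ 0) (hB : B ≠ ∞) :
    midMean (bblExponent k) A B ≤
      midMean (bblExponent (k + 1)) a b * (2⁻¹ * (A / a) + 2⁻¹ * (B / b)) := by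
  have hU0 : A / a ≠ 0 := (ENNReal.div_pos hA0 ha).ne'
  have hU : A / a ≠ ∞ := ENNReal.div_ne_top hA ha0
  have hV : B / b ≠ ∞ := ENNReal.div_ne_top hB hb0
  set Q := 2⁻¹ * (A / a) + 2⁻¹ * (B / b) with hQ
  have hQ0 : Q ≠ 0 := by simp [hQ, hA0, ha]
  have hQt : Q ≠ ∞ :=
    ENNReal.add_ne_top.2 ⟨ENNReal.mul_ne_top (by simp) hU, ENNReal.mul_ne_top (by simp) hV⟩
  have hk1 : bblExponent (k + 1) = ((-(1 / ((k : ℝ) + 1)) : ℝ) : EReal) := by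
    rw [bblExponent_of_ne k.succ_ne_zero]; push_cast; rfl
  have hp : -(1 / ((k : ℝ) + 1)) ≠ 0 := neg_ne_zero.2 (by positivity)
  rw [hk1, midMean_coe hp]
  rcases Nat.eq_zero_or_pos k with rfl | hk
  · simp only [Nat.cast_zero, zero_add, div_one, bblExponent_zero, midMean_bot, ENNReal.rpow_neg_one]
    have e : ((-1 : ℝ))⁻¹ = -1 := by norm_num
    rw [e, ENNReal.rpow_neg_one, mul_comm, ← div_eq_mul_inv,
      ENNReal.le_div_iff_mul_le (.inl (by simp [ha])) (.inl (by simp [ha0, hb0, ENNReal.mul_eq_top])),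
      mul_add, hQ]
    refine add_le_add ?_ ?_
    · rw [mul_left_comm, div_eq_mul_inv]
      exact mul_le_mul' le_rfl (mul_le_mul' (min_le_left _ _) le_rfl)
    · rw [mul_left_comm, div_eq_mul_inv]
      exact mul_le_mul' le_rfl (mul_le_mul' (min_le_right _ _) le_rfl)
  · have hkr : (0 : ℝ) < k := by exact_mod_cast hk
    set p : ℝ := -(1 / (k : ℝ)) with hpdef
    have hp0 : p ≠ 0 := neg_ne_zero.2 (by positivity)
    rw [bblExponent_of_ne hk.ne', midMean_coe hp0]
    -- Chosen so that the powers of `C` cancel in `(C ^ p) ^ θ * (C / c) ^ (1 - θ)`, leaving `c ^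
    -- (-1/(k+1))`.
    set θ : ℝ := k / (k + 1) with hθ
    have hθ0 : 0 < θ := by positivity
    have hθ1 : θ < 1 := by rw [hθ, div_lt_one (by positivity)]; linarith
    have hconc := half_concave_geom hθ0 hθ1 (A ^ p) (B ^ p) (A / a) (B / b)
    have key : ∀ C c : ℝ≥0∞, C ≠ 0 → C ≠ ∞ → c ≠ 0 → c ≠ ∞ →
        (C ^ p) ^ θ * (C / c) ^ (1 - θ) = c ^ (-(1 / ((k : ℝ) + 1))) := by
      intro C c hC0 hC hc0 hc
      have e1 : p * θ = -(1 / ((k : ℝ) + 1)) := by rw [hpdef, hθ]; field_simp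
      have e2 : 1 - θ = 1 / ((k : ℝ) + 1) := by rw [hθ]; field_simp; ring
      rw [← ENNReal.rpow_mul, e1, e2, ENNReal.div_rpow_of_nonneg _ _ (by positivity),
        ENNReal.rpow_neg, ENNReal.rpow_neg, div_eq_mul_inv (C ^ _), ← mul_assoc,
        ENNReal.inv_mul_cancel, one_mul]
      · simp [ENNReal.rpow_eq_zero_iff, hC0, hC]
      · exact ENNReal.rpow_ne_top_of_nonneg (by positivity) hC
    rw [key A a hA0 hA ha0 ha, key B b hB0 hB hb0 hb] at hconc
    set X := 2⁻¹ * A ^ p + 2⁻¹ * B ^ p with hX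
    have hAp0 : A ^ p ≠ 0 := (ENNReal.rpow_pos (pos_iff_ne_zero.2 hA0) hA).ne'
    have hX0 : X ≠ 0 := by simp [hX, hAp0]
    have hpos : ∀ x : ℝ≥0∞, x ≠ 0 → x ≠ ∞ → ∀ r : ℝ, x ^ r ≠ 0 := fun x h0 h r =>
      (ENNReal.rpow_pos (pos_iff_ne_zero.2 h0) h).ne'
    have hXt : X ≠ ∞ := by
      refine ENNReal.add_ne_top.2 ⟨ENNReal.mul_ne_top (by simp) ?_, ENNReal.mul_ne_top (by simp) ?_⟩
      · exact ENNReal.rpow_ne_top_of_nonneg' (pos_iff_ne_zero.2 hA0) hA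
      · exact ENNReal.rpow_ne_top_of_nonneg' (pos_iff_ne_zero.2 hB0) hB
    have h2 := rpow_le_rpow_of_nonpos (p := (-(1 / ((k : ℝ) + 1)))⁻¹)
      (inv_nonpos.2 (neg_nonpos.2 (by positivity))) hconc
    refine le_trans (le_of_eq ?_) (mul_le_mul' h2 le_rfl)
    rw [ENNReal.mul_rpow_of_ne_zero (hpos _ hX0 hXt _) (hpos _ hQ0 hQt _), ← ENNReal.rpow_mul,
      ← ENNReal.rpow_mul]
    have e1 : θ * (-(1 / ((k : ℝ) + 1)))⁻¹ = p⁻¹ := by rw [hpdef, hθ]; field_simp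
    have e2 : (1 - θ) * (-(1 / ((k : ℝ) + 1)))⁻¹ = -1 := by rw [hθ]; field_simp; ring
    rw [e1, e2, ENNReal.rpow_neg_one, mul_assoc, ENNReal.inv_mul_cancel hQ0 hQt, mul_one]

lemma ofReal_half : ENNReal.ofReal (1 / 2) = 2⁻¹ := by
  rw [one_div, ENNReal.ofReal_inv_of_pos (by norm_num), ENNReal.ofReal_ofNat]

lemma meanStep_midMean (k : ℕ) : MeanStep (1 / 2) (1 / 2) (midMean (bblExponent (k + 1)))
    (midMean (bblExponent k)) where
  mono := midMean_mono _
  ne_top ha hb := ((midMean_le_of_le _ (le_max_left _ _) (le_max_right _ _)).trans_lt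
    (max_lt ha.lt_top hb.lt_top)).ne
  mul_le := by
    intro r a b hr
    rcases eq_or_ne r 0 with rfl | hr0
    · simp
    rcases eq_or_ne a 0 with rfl | ha0
    · simp [midMean_zero_left (bblExponent_nonpos (k + 1))]
    rcases eq_or_ne b 0 with rfl | hb0
    · simp [midMean_comm _ a, midMean_zero_left (bblExponent_nonpos (k + 1))]
    rw [bblExponent_of_ne k.succ_ne_zero]
    have hp : -(1 / ((k + 1 : ℕ) : ℝ)) ≠ 0 := neg_ne_zero.2 (by positivity)
    set p := -(1 / ((k + 1 : ℕ) : ℝ))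
    rw [midMean_coe hp, midMean_coe hp, ENNReal.mul_rpow_of_ne_zero hr0 ha0,
      ENNReal.mul_rpow_of_ne_zero hr0 hb0, mul_left_comm 2⁻¹ (r ^ p) (a ^ p),
      mul_left_comm 2⁻¹ (r ^ p) (b ^ p), ← mul_add (r ^ p)]
    -- The sum of negative powers vanishes only for `a = b = ∞`, where the product rule for powers
    -- is unavailable.
    rcases eq_or_ne (2⁻¹ * a ^ p + 2⁻¹ * b ^ p) 0 with h0 | h0
    · rw [h0, mul_zero, ENNReal.zero_rpow_of_neg, ENNReal.mul_top hr0]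
      exact inv_lt_zero.2 (neg_lt_zero.2 (by positivity))
    · rw [ENNReal.mul_rpow_of_ne_zero (ENNReal.rpow_pos (pos_iff_ne_zero.2 hr0) hr).ne' h0,
        ENNReal.rpow_rpow_inv hp]
  holder := by
    intro a b A B ha0 ha hb0 hb
    rw [ofReal_half]
    rcases eq_or_ne A 0 with rfl | hA0
    · rw [midMean_zero_left (bblExponent_nonpos k)]; exact zero_le
    rcases eq_or_ne B 0 with rfl | hB0
    · rw [midMean_comm, midMean_zero_left (bblExponent_nonpos k)]; exact zero_le
    have hm0 : midMean (bblExponent (k + 1)) a b ≠ 0 :=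
      (midMean_pos _ (pos_iff_ne_zero.2 ha0) (pos_iff_ne_zero.2 hb0)).ne'
    rcases eq_or_ne A ∞ with rfl | hA
    · rw [ENNReal.top_div_of_ne_top ha, ENNReal.mul_top (by simp), top_add, ENNReal.mul_top hm0]
      exact le_top
    rcases eq_or_ne B ∞ with rfl | hB
    · rw [ENNReal.top_div_of_ne_top hb, ENNReal.mul_top (by simp), add_top, ENNReal.mul_top hm0]
      exact le_top
    exact bbl_holder ha0 ha hb0 hb hA0 hA hB0 hB
  iSup_le := by
    intro A B hA hB
    have h := ((continuous_midMean_bblExponent k).tendsto (⨆ k, A k, ⨆ k, B k)).comp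
      ((tendsto_atTop_iSup hA).prodMk_nhds (tendsto_atTop_iSup hB))
    exact le_of_tendsto' h fun i => le_iSup (fun i => midMean (bblExponent k) (A i) (B i)) i
  zero_left := midMean_zero_left (bblExponent_nonpos k)
  zero_right A := by rw [midMean_comm, midMean_zero_left (bblExponent_nonpos k)]

/-! ### The total mass of the symmetral -/

lemma lintegral_toLp {f : E n → ℝ≥0∞} :
    ∫⁻ x : Fin n → ℝ, f (WithLp.toLp 2 x) = ∫⁻ x, f x :=
  (EuclideanSpace.volume_preserving_symm_measurableEquiv_toLp (Fin n)).symm.lintegral_comp_emb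
    (MeasurableEquiv.measurableEmbedding _) f

lemma lintegral_comp_linearIsometryEquiv (R : E n ≃ₗᵢ[ℝ] E n) (f : E n → ℝ≥0∞) :
    ∫⁻ x, f (R x) = ∫⁻ x, f x :=
  R.measurePreserving.lintegral_comp_emb R.toHomeomorph.measurableEmbedding f

/-- The inequality is applied to `f` and its reflection, whose masses agree, so the minimum of the
masses is the mass. Concavity of `f` plays no role, only regularity; this is why the log-concave
functions with lower-dimensional support are covered. -/
lemma Tame.mass_le_mass_symm {α : EReal} {u : E n} (hu : ‖u‖ = 1) {f : E n → ℝ≥0∞}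
    (hf : Tame α f) (hα : ((-(1 / (n : ℝ)) : ℝ) : EReal) ≤ α) : mass f ≤ mass (symm α u f) := by
  have hn : n ≠ 0 := by
    rintro rfl
    rw [Subsingleton.elim u 0, norm_zero] at hu
    exact zero_ne_one hu
  have hn' : (0 : ℝ) < 1 / n := by positivity
  have hle : ∀ y z, midMean (bblExponent n) (f y) (f z) ≤ symm α u f (mixPt u (y, z)) := by
    intro y z
    rcases eq_or_ne (f y) 0 with hy | hy
    · rw [hy, midMean_zero_left (bblExponent_nonpos n)]; exact zero_le
    rcases eq_or_ne (f z) 0 with hz | hz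
    · rw [hz, midMean_comm, midMean_zero_left (bblExponent_nonpos n)]; exact zero_le
    rw [bblExponent_of_ne hn]
    refine (midMean_neg_le hn' hα (hf.finite y).ne (hf.finite z).ne).trans ?_
    exact midMean_le_symm hu hf.finite hf.isClosed_supp
      (supp_subset_dom _ _ (pos_iff_ne_zero.2 hy)) (supp_subset_dom _ _ (pos_iff_ne_zero.2 hz))
  have hfm : Measurable f := hf.usc.measurable
  have htoLp : Measurable fun x : Fin n → ℝ => (WithLp.toLp 2 x : E n) :=
    WithLp.measurable_toLp 2 _
  have h := lintegral_le_of_meanStep (M := fun k => midMean (bblExponent k)) meanStep_midMean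
    one_half_pos one_half_pos 0 (f := fun x : Fin n → ℝ => f (WithLp.toLp 2 x))
    (g := fun x : Fin n → ℝ => f (reflIso u (WithLp.toLp 2 x)))
    (h := fun x : Fin n → ℝ => symm α u f (WithLp.toLp 2 x)) (hfm.comp htoLp)
    (hfm.comp ((reflIso u).continuous.measurable.comp htoLp)) ((hf.measurable_symm hu).comp htoLp) ?_
  · have e1 : ∫⁻ x : Fin n → ℝ, f (reflIso u (WithLp.toLp 2 x)) = ∫⁻ x, f x :=
      (lintegral_toLp (f := fun x => f (reflIso u x))).trans
        (lintegral_comp_linearIsometryEquiv (reflIso u) f)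
    rw [e1, lintegral_toLp, lintegral_toLp, midMean_self] at h
    exact h
  · intro x y
    rw [zero_add]
    refine (hle _ _).trans_eq ?_
    congr 1
    simp [mixPt, smul_add]

/-! ### Log-concave densities on the line -/

/-- Log-concavity of a nonnegative function on a real vector space. -/
def LogConcave {V : Type*} [AddCommGroup V] [Module ℝ V] (F : V → ℝ≥0∞) : Prop :=
  ∀ x y, ∀ s t : ℝ, 0 < s → 0 < t → s + t = 1 → F x ^ s * F y ^ t ≤ F (s • x + t • y)

section Line

variable {F : ℝ → ℝ≥0∞}

lemma LogConcave.convex_pos (hF : LogConcave F) : Convex ℝ {x | 0 < F x} := by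
  refine convex_iff_forall_pos.2 fun x hx y hy s t hs ht hst => ?_
  refine lt_of_lt_of_le ?_ (hF x y s t hs ht hst)
  exact ENNReal.mul_pos (ENNReal.rpow_pos_of_nonneg hx hs.le).ne'
    (ENNReal.rpow_pos_of_nonneg hy ht.le).ne'

/-- One infinite value and one further nonzero value would make `F` infinite on the open segment
between them. -/
lemma LogConcave.lt_top (hF : LogConcave F) (h0 : ∫⁻ x, F x ≠ 0) (hI : ∫⁻ x, F x ≠ ∞) (x : ℝ) :
    F x < ∞ := by
  by_contra! hx
  rw [top_le_iff] at hx
  obtain ⟨y, hy, hxy⟩ : ∃ y, F y ≠ 0 ∧ y ≠ x := by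
    by_contra! h
    refine h0 ?_
    rw [lintegral_eq_zero_of_ae_eq_zero]
    have : ∀ᵐ y : ℝ, y ≠ x := Measure.ae_ne volume x
    filter_upwards [this] with y hy
    by_contra hy'
    exact hy (h y hy')
  have hseg : ∀ z ∈ openSegment ℝ x y, F z = ∞ := by
    rintro z ⟨s, t, hs, ht, hst, rfl⟩
    have := hF x y s t hs ht hst
    rw [hx, ENNReal.top_rpow_of_pos hs, ENNReal.top_mul] at this
    · exact top_le_iff.1 this
    · exact (ENNReal.rpow_pos_of_nonneg (pos_iff_ne_zero.2 hy) ht.le).ne'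
  refine hI (top_le_iff.1 ?_)
  have hvol : volume (openSegment ℝ x y) ≠ 0 := by
    rw [openSegment_eq_Ioo' hxy.symm]
    simpa using fun h => lt_of_le_of_ne h hxy
  have hm : MeasurableSet (openSegment ℝ x y) := by
    rw [openSegment_eq_Ioo' hxy.symm]
    exact measurableSet_Ioo
  calc ∞ = ∫⁻ z in openSegment ℝ x y, ∞ := by
        rw [setLIntegral_const, ENNReal.top_mul hvol]
    _ = ∫⁻ z in openSegment ℝ x y, F z := setLIntegral_congr_fun hm fun z hz => (hseg z hz).symm
    _ ≤ ∫⁻ z, F z := setLIntegral_le_lintegral _ _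

lemma LogConcave.continuousAt (hF : LogConcave F) (hfin : ∀ x, F x < ∞) {x a b : ℝ} (ha : 0 < F a)
    (hb : 0 < F b) (hx : x ∈ Ioo a b) : ContinuousAt (fun x => (F x).toReal) x := by
  have hpos : ∀ y ∈ Ioo a b, 0 < F y := fun y hy =>
    hF.convex_pos.ordConnected.out ha hb (Ioo_subset_Icc_self hy)
  have hpos' : ∀ y ∈ Ioo a b, 0 < (F y).toReal := fun y hy =>
    ENNReal.toReal_pos (hpos y hy).ne' (hfin y).ne
  have hconc : ConcaveOn ℝ (Ioo a b) fun y => Real.log (F y).toReal := by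
    refine concaveOn_iff_forall_pos.2 ⟨convex_Ioo a b, fun y hy z hz s t hs ht hst => ?_⟩
    have h := ENNReal.toReal_mono (hfin _).ne (hF y z s t hs ht hst)
    rw [ENNReal.toReal_mul, ← ENNReal.toReal_rpow, ← ENNReal.toReal_rpow] at h
    have h2 := Real.log_le_log (mul_pos (Real.rpow_pos_of_pos (hpos' y hy) s)
      (Real.rpow_pos_of_pos (hpos' z hz) t)) h
    rw [Real.log_mul (Real.rpow_pos_of_pos (hpos' y hy) s).ne'
      (Real.rpow_pos_of_pos (hpos' z hz) t).ne', Real.log_rpow (hpos' y hy),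
      Real.log_rpow (hpos' z hz)] at h2
    simpa using h2
  have hc := (hconc.continuousOn isOpen_Ioo).continuousAt (isOpen_Ioo.mem_nhds hx)
  refine (Real.continuous_exp.continuousAt.comp hc).congr ?_
  filter_upwards [isOpen_Ioo.mem_nhds hx] with y hy
  exact Real.exp_log (hpos' y hy)

/-- The quantile function inverts the distribution function `Φ`. There is mass on both sides of an
inner quantile, so by log-concavity the density is positive and continuous near it, and the inverse
is differentiable with the reciprocal derivative. -/
lemma exists_quantile (hFm : Measurable F) (hF : LogConcave F) {I : ℝ} (hI : 0 < I)
    (hint : ∫⁻ x, F x = ENNReal.ofReal I) :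
    ∃ x : ℝ → ℝ, ∀ p ∈ Ioo 0 I, ∫⁻ r in Iic (x p), F r = ENNReal.ofReal p ∧
      0 < (F (x p)).toReal ∧ ContinuousAt (fun r => (F r).toReal) (x p) ∧
      HasDerivAt x ((F (x p)).toReal)⁻¹ p := by
  have hI0 : ∫⁻ x, F x ≠ 0 := by rw [hint]; simpa using hI
  have hIt : ∫⁻ x, F x ≠ ∞ := by rw [hint]; simp
  have hfin := hF.lt_top hI0 hIt
  have hφ : Integrable fun r => (F r).toReal :=
    integrable_toReal_of_lintegral_ne_top hFm.aemeasurable hIt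
  have hset : ∀ A : Set ℝ, ∫ r in A, (F r).toReal = (∫⁻ r in A, F r).toReal := fun A =>
    integral_toReal hFm.aemeasurable (Eventually.of_forall hfin)
  have hsett : ∀ A : Set ℝ, ∫⁻ r in A, F r ≠ ∞ := fun A =>
    ((setLIntegral_le_lintegral _ _).trans_lt hIt.lt_top).ne
  set Φ : ℝ → ℝ := fun s => ∫ r in Iic s, (F r).toReal with hΦ
  have hΦset : ∀ s, Φ s = (∫⁻ r in Iic s, F r).toReal := fun s => hset _
  have htot : ∫ r, (F r).toReal = I := by
    rw [integral_toReal hFm.aemeasurable (Eventually.of_forall hfin), hint,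
      ENNReal.toReal_ofReal hI.le]
  have hΦsub : ∀ a b, Φ b - Φ a = ∫ r in a..b, (F r).toReal := fun a b =>
    intervalIntegral.integral_Iic_sub_Iic hφ.integrableOn hφ.integrableOn
  have hΦmono : Monotone Φ := fun a b hab =>
    setIntegral_mono_set hφ.integrableOn (Eventually.of_forall fun _ => ENNReal.toReal_nonneg)
      (LE.le.eventuallyLE (Iic_subset_Iic.2 hab))
  have hcont : Continuous Φ := by
    have h := (intervalIntegral.continuous_primitive (fun a b => hφ.intervalIntegrable) 0).add_const
      (Φ 0)
    refine h.congr fun s => ?_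
    rw [← hΦsub 0 s]; ring
  have hbot : Tendsto Φ atBot (𝓝 0) := by
    have h1 := (intervalIntegral_tendsto_integral_Iic 0 hφ.integrableOn tendsto_id).const_sub (Φ 0)
    rw [sub_self] at h1
    refine h1.congr fun s => ?_
    rw [id, ← hΦsub s 0]; ring
  have htop : Tendsto Φ atTop (𝓝 I) := by
    have h1 := (intervalIntegral_tendsto_integral_Ioi 0 hφ.integrableOn tendsto_id).const_add (Φ 0)
    have h2 : Φ 0 + ∫ r in Ioi 0, (F r).toReal = I := by
      rw [hΦ, intervalIntegral.integral_Iic_add_Ioi hφ.integrableOn hφ.integrableOn, htot]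
    rw [h2] at h1
    refine h1.congr fun s => ?_
    rw [id, ← hΦsub 0 s]; ring
  have hex : ∀ p ∈ Ioo 0 I, ∃ s, Φ s = p := fun p hp =>
    mem_range_of_exists_le_of_exists_ge hcont (hbot.eventually_le_const hp.1).exists
      (htop.eventually_const_le hp.2).exists
  choose! x hx using hex
  have hsupp : ∀ p ∈ Ioo 0 I, ∃ a b, x p ∈ Ioo a b ∧ 0 < F a ∧ 0 < F b := by
    intro p hp
    have h1 : 0 < ∫⁻ r in Iio (x p), F r := by
      rw [setLIntegral_congr Iio_ae_eq_Iic]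
      have h := (hΦset (x p)).symm.trans (hx p hp)
      exact (ENNReal.toReal_pos_iff.1 (hp.1.trans_eq h.symm)).1
    have h2 : 0 < ∫⁻ r in Ioi (x p), F r := by
      have h3 := intervalIntegral.integral_Iic_add_Ioi (b := x p) hφ.integrableOn hφ.integrableOn
      have h4 : Φ (x p) = p := hx p hp
      rw [htot, show ∫ r in Iic (x p), (F r).toReal = p from h4, hset] at h3
      exact (ENNReal.toReal_pos_iff.1 (show 0 < (∫⁻ r in Ioi (x p), F r).toReal by
        linarith [hp.2])).1
    rw [setLIntegral_pos_iff hFm] at h1 h2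
    obtain ⟨a, ha, ha'⟩ := nonempty_of_measure_ne_zero h1.ne'
    obtain ⟨b, hb, hb'⟩ := nonempty_of_measure_ne_zero h2.ne'
    exact ⟨a, b, ⟨ha', hb'⟩, pos_iff_ne_zero.2 ha, pos_iff_ne_zero.2 hb⟩
  refine ⟨x, fun p hp => ?_⟩
  obtain ⟨a, b, hab, ha, hb⟩ := hsupp p hp
  have hpos : ∀ y ∈ Icc a b, 0 < (F y).toReal := fun y hy =>
    ENNReal.toReal_pos (hF.convex_pos.ordConnected.out ha hb hy).ne' (hfin y).ne
  have hcφ := hF.continuousAt hfin ha hb hab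
  have hder : HasDerivAt Φ (F (x p)).toReal (x p) := by
    have h := (intervalIntegral.integral_hasDerivAt_right (a := 0) (b := x p)
      hφ.intervalIntegrable hφ.aestronglyMeasurable.stronglyMeasurableAtFilter hcφ).add_const (Φ 0)
    refine h.congr_of_eventuallyEq (Eventually.of_forall fun s => ?_)
    simp only [← hΦsub 0 s]; ring
  have hlt : ∀ c d, a ≤ c → d ≤ b → c < d → Φ c < Φ d := by
    intro c d hc hd hcd
    rw [← sub_pos, hΦsub]
    refine intervalIntegral.intervalIntegral_pos_of_pos_on hφ.intervalIntegrable
      (fun y hy => hpos y ⟨hc.trans hy.1.le, hy.2.le.trans hd⟩) hcd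
  have hcx : ContinuousAt x p := by
    refine tendsto_order.2 ⟨fun c hc => ?_, fun d hd => ?_⟩
    · have h1 : Φ (max a c) < p := (hlt _ _ (le_max_left _ _) hab.2.le
        (max_lt hab.1 hc)).trans_eq (hx p hp)
      filter_upwards [isOpen_Ioo.mem_nhds hp, lt_mem_nhds h1] with q hq hq'
      rw [← hx q hq] at hq'
      exact (le_max_right _ _).trans_lt (hΦmono.reflect_lt hq')
    · have h1 : p < Φ (min b d) := (hx p hp).symm.trans_lt (hlt _ _ hab.1.le (min_le_left _ _)
        (lt_min hab.2 hd))
      filter_upwards [isOpen_Ioo.mem_nhds hp, gt_mem_nhds h1] with q hq hq'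
      rw [← hx q hq] at hq'
      exact (hΦmono.reflect_lt hq').trans_le (min_le_right _ _)
  refine ⟨?_, hpos _ (Ioo_subset_Icc_self hab), hcφ, ?_⟩
  · rw [← ENNReal.ofReal_toReal (hsett _), ← hset]
    exact congrArg _ (hx p hp)
  · refine HasDerivAt.of_local_left_inverse hcx hder (hpos _ (Ioo_subset_Icc_self hab)).ne' ?_
    filter_upwards [isOpen_Ioo.mem_nhds hp] with q hq using hx q hq

lemma setLIntegral_mul_le {G H : ℝ → ℝ≥0∞} (hF : Measurable F) (hG : Measurable G)
    (hH : Measurable H)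
    (hle : ∀ x y, F x ^ (1 / 2 : ℝ) * G y ^ (1 / 2 : ℝ) ≤ H (1 / 2 * x + 1 / 2 * y))
    {A B C : Set ℝ} (hA : MeasurableSet A) (hB : MeasurableSet B) (hC : MeasurableSet C)
    (hABC : ∀ x ∈ A, ∀ y ∈ B, 1 / 2 * x + 1 / 2 * y ∈ C) :
    (∫⁻ x in A, F x) ^ (1 / 2 : ℝ) * (∫⁻ x in B, G x) ^ (1 / 2 : ℝ) ≤ ∫⁻ x in C, H x := by
  rw [← lintegral_indicator hA, ← lintegral_indicator hB, ← lintegral_indicator hC]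
  refine (meanStep_geom one_half_pos one_half_pos (by norm_num)).lintegral_le one_half_pos
    one_half_pos (hF.indicator hA) (hG.indicator hB) (hH.indicator hC) fun x y => ?_
  by_cases hx : x ∈ A
  · by_cases hy : y ∈ B
    · rw [indicator_of_mem hx, indicator_of_mem hy, indicator_of_mem (hABC x hx y hy)]
      exact hle x y
    · rw [indicator_of_notMem hy, ENNReal.zero_rpow_of_pos one_half_pos, mul_zero]
      exact zero_le
  · rw [indicator_of_notMem hx, ENNReal.zero_rpow_of_pos one_half_pos, zero_mul]
    exact zero_le

lemma rpow_half_mul_rpow_half (a : ℝ≥0∞) : a ^ (1 / 2 : ℝ) * a ^ (1 / 2 : ℝ) = a := by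
  rw [← ENNReal.rpow_add_of_nonneg _ _ one_half_pos.le one_half_pos.le, add_halves,
    ENNReal.rpow_one]

lemma setLIntegral_Ioi_of_Iic (F : ℝ → ℝ≥0∞) {I p a : ℝ} (hp : 0 ≤ p)
    (hint : ∫⁻ x, F x = ENNReal.ofReal I) (h : ∫⁻ r in Iic a, F r = ENNReal.ofReal p) :
    ∫⁻ r in Ioi a, F r = ENNReal.ofReal (I - p) := by
  have := lintegral_add_compl (μ := volume) F (measurableSet_Iic (a := a))
  rw [compl_Iic, h, hint] at this
  rw [ENNReal.ofReal_sub _ hp, ← this, ENNReal.add_sub_cancel_left ENNReal.ofReal_ne_top]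

/-- Letting `t` tend to `1` says that the geometric mean is at most the harmonic mean, which forces
`A = B`. -/
lemma eq_of_mul_inv_add_inv_le {A B : ℝ} (hA : 0 < A) (hB : 0 < B)
    (h : ∀ t ∈ Ioo (0 : ℝ) 1, t * √(A * B) * ((A⁻¹ + B⁻¹) / 2) ≤ 1) : A = B := by
  have h1 : √(A * B) * ((A⁻¹ + B⁻¹) / 2) ≤ 1 := by
    have hC : 0 < √(A * B) * ((A⁻¹ + B⁻¹) / 2) := by positivity
    set C := √(A * B) * ((A⁻¹ + B⁻¹) / 2)
    by_contra! h2
    have h3 := h ((1 + C⁻¹) / 2) ⟨by positivity, by linarith [inv_lt_one_of_one_lt₀ h2]⟩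
    rw [mul_assoc, show √(A * B) * ((A⁻¹ + B⁻¹) / 2) = C from rfl] at h3
    have : C⁻¹ * C = 1 := inv_mul_cancel₀ hC.ne'
    nlinarith
  have hs : √(A * B) ^ 2 = A * B := Real.sq_sqrt (by positivity)
  have hs0 : 0 < √(A * B) := by positivity
  have h2 : A + B ≤ 2 * √(A * B) := by
    have e : √(A * B) * ((A⁻¹ + B⁻¹) / 2) * (2 * √(A * B)) = A + B := by
      calc _ = √(A * B) ^ 2 * (A⁻¹ + B⁻¹) := by ring
        _ = A + B := by rw [hs]; field_simp; ring
    nlinarith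
  have h3 : (A - B) ^ 2 ≤ 0 := by nlinarith
  nlinarith [pow_eq_zero_iff (two_ne_zero) |>.1 (le_antisymm h3 (sq_nonneg (A - B)))]

/-- The midpoint `z` of the quantiles is a quantile of `H`: Prékopa–Leindler on the two half-lines
gives masses at least `p` and `I - p`, and the total is `I`. On a short interval to the right of `z
p` the function `H` is nearly at least the geometric mean of the two densities, while the derivative
of `z` is the mean of their reciprocals. -/
lemma quantile_density_eq {G H : ℝ → ℝ≥0∞} (hF : Measurable F) (hG : Measurable G)
    (hH : Measurable H)
    (hle : ∀ x y, F x ^ (1 / 2 : ℝ) * G y ^ (1 / 2 : ℝ) ≤ H (1 / 2 * x + 1 / 2 * y))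
    {I : ℝ} (hFI : ∫⁻ x, F x = ENNReal.ofReal I) (hGI : ∫⁻ x, G x = ENNReal.ofReal I)
    (hHI : ∫⁻ x, H x = ENNReal.ofReal I) {x y : ℝ → ℝ}
    (hx : ∀ p ∈ Ioo 0 I, ∫⁻ r in Iic (x p), F r = ENNReal.ofReal p ∧
      0 < (F (x p)).toReal ∧ ContinuousAt (fun r => (F r).toReal) (x p) ∧
      HasDerivAt x ((F (x p)).toReal)⁻¹ p)
    (hy : ∀ p ∈ Ioo 0 I, ∫⁻ r in Iic (y p), G r = ENNReal.ofReal p ∧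
      0 < (G (y p)).toReal ∧ ContinuousAt (fun r => (G r).toReal) (y p) ∧
      HasDerivAt y ((G (y p)).toReal)⁻¹ p) {p : ℝ} (hp : p ∈ Ioo 0 I) :
    (F (x p)).toReal = (G (y p)).toReal := by
  set z : ℝ → ℝ := fun p => 1 / 2 * x p + 1 / 2 * y p with hz
  have hHz : ∀ p ∈ Ioo 0 I, ∫⁻ r in Iic (z p), H r = ENNReal.ofReal p := by
    intro p hp
    have h1 := setLIntegral_mul_le hF hG hH hle (measurableSet_Iic (a := x p))
      (measurableSet_Iic (a := y p)) (measurableSet_Iic (a := z p)) fun a ha b hb => by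
        have ha : a ≤ x p := ha
        have hb : b ≤ y p := hb
        show 1 / 2 * a + 1 / 2 * b ≤ 1 / 2 * x p + 1 / 2 * y p
        linarith
    have h2 := setLIntegral_mul_le hF hG hH hle (measurableSet_Ioi (a := x p))
      (measurableSet_Ioi (a := y p)) (measurableSet_Ioi (a := z p)) fun a ha b hb => by
        have ha : x p < a := ha
        have hb : y p < b := hb
        show 1 / 2 * x p + 1 / 2 * y p < 1 / 2 * a + 1 / 2 * b
        linarith
    rw [(hx p hp).1, (hy p hp).1, rpow_half_mul_rpow_half] at h1
    rw [setLIntegral_Ioi_of_Iic F hp.1.le hFI (hx p hp).1,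
      setLIntegral_Ioi_of_Iic G hp.1.le hGI (hy p hp).1, rpow_half_mul_rpow_half] at h2
    refine le_antisymm ?_ h1
    have h3 := lintegral_add_compl (μ := volume) H (measurableSet_Iic (a := z p))
    rw [compl_Iic, hHI] at h3
    refine (ENNReal.add_le_add_iff_right (ENNReal.ofReal_ne_top (r := I - p))).1 ?_
    calc _ ≤ _ := add_le_add le_rfl h2
      _ = _ := h3
      _ = _ := by rw [← ENNReal.ofReal_add hp.1.le (sub_nonneg.2 hp.2.le)]; congr 1; ring
  obtain ⟨hx1, hA, hxc, hxd⟩ := hx p hp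
  obtain ⟨hy1, hB, hyc, hyd⟩ := hy p hp
  set A := (F (x p)).toReal
  set B := (G (y p)).toReal
  refine eq_of_mul_inv_add_inv_le hA hB fun t ht => ?_
  have hzd : HasDerivAt z ((A⁻¹ + B⁻¹) / 2) p := by
    have h := (hxd.const_mul (1 / 2)).add (hyd.const_mul (1 / 2))
    have e : 1 / 2 * A⁻¹ + 1 / 2 * B⁻¹ = (A⁻¹ + B⁻¹) / 2 := by ring
    rwa [e] at h
  have hslope : Tendsto (slope z p) (𝓝[>] p) (𝓝 ((A⁻¹ + B⁻¹) / 2)) :=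
    (hasDerivAt_iff_tendsto_slope.1 hzd).mono_left
      (nhdsWithin_mono p (fun q (hq : p < q) => hq.ne'))
  have hlim := hslope.const_mul (t * √(A * B))
  refine le_of_tendsto hlim ?_
  have hlow : ∀ {φ : ℝ → ℝ} {a : ℝ → ℝ}, ContinuousAt φ (a p) → ContinuousAt a p → 0 < φ (a p) →
      ∀ᶠ q in 𝓝[>] p, ∀ r, a p ≤ r → r ≤ a q → t * φ (a p) ≤ φ r := by
    intro φ a hφ ha hpos
    have h1 : ∀ᶠ r in 𝓝 (a p), t * φ (a p) < φ r :=
      hφ.eventually (lt_mem_nhds (by nlinarith [ht.2]))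
    obtain ⟨ε, hε, h2⟩ := Metric.eventually_nhds_iff.1 h1
    have h3 : ∀ᶠ q in 𝓝 p, a q < a p + ε := ha.eventually (gt_mem_nhds (by linarith))
    filter_upwards [nhdsWithin_le_nhds h3] with q hq r hr hr'
    refine (h2 ?_).le
    rw [Real.dist_eq, abs_of_nonneg (sub_nonneg.2 hr)]
    linarith
  filter_upwards [hlow hxc hxd.continuousAt hA, hlow hyc hyd.continuousAt hB,
    Ioo_mem_nhdsGT hp.2] with q hFq hGq hq
  have hqI : q ∈ Ioo 0 I := ⟨hp.1.trans hq.1, hq.2⟩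
  have hmono : ∀ {K : ℝ → ℝ≥0∞} {a : ℝ → ℝ}, ∫⁻ r in Iic (a p), K r = ENNReal.ofReal p →
      ∫⁻ r in Iic (a q), K r = ENNReal.ofReal q → a p < a q := by
    intro K a h1 h2
    by_contra! h
    have h3 : ∫⁻ r in Iic (a q), K r ≤ ∫⁻ r in Iic (a p), K r :=
      lintegral_mono_set (Iic_subset_Iic.2 h)
    rw [h1, h2, ENNReal.ofReal_le_ofReal_iff hp.1.le] at h3
    exact hq.1.not_ge h3
  have hxpq := hmono hx1 (hx q hqI).1
  have hypq := hmono hy1 (hy q hqI).1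
  have hzpq : z p < z q := by simp only [hz]; linarith
  -- Such an `r` is the midpoint of the points dividing the two quantile intervals in the same
  -- proportion `l`.
  have hHr : ∀ r ∈ Ioc (z p) (z q), ENNReal.ofReal (t * √(A * B)) ≤ H r := by
    intro r hr
    set l := (r - z p) / (z q - z p) with hl
    have hl0 : 0 ≤ l := div_nonneg (by linarith [hr.1]) (by linarith)
    have hl1 : l ≤ 1 := (div_le_one (by linarith)).2 (by linarith [hr.2])
    have hlz : l * (z q - z p) = r - z p := div_mul_cancel₀ _ (by linarith)
    have e : r = 1 / 2 * (x p + l * (x q - x p)) + 1 / 2 * (y p + l * (y q - y p)) := by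
      simp only [hz] at hlz
      linarith
    rw [e]
    refine le_trans ?_ (hle _ _)
    have h1 := hFq (x p + l * (x q - x p)) (by nlinarith) (by nlinarith)
    have h2 := hGq (y p + l * (y q - y p)) (by nlinarith) (by nlinarith)
    have h3 := mul_le_mul' (ENNReal.rpow_le_rpow ((ENNReal.ofReal_le_ofReal h1).trans
      ENNReal.ofReal_toReal_le) one_half_pos.le) (ENNReal.rpow_le_rpow
      ((ENNReal.ofReal_le_ofReal h2).trans ENNReal.ofReal_toReal_le) one_half_pos.le)
    refine le_trans (le_of_eq ?_) h3
    rw [ENNReal.ofReal_rpow_of_nonneg (mul_nonneg ht.1.le hA.le) one_half_pos.le,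
      ENNReal.ofReal_rpow_of_nonneg (mul_nonneg ht.1.le hB.le) one_half_pos.le,
      ← ENNReal.ofReal_mul (by have := ht.1.le; positivity), ← Real.sqrt_eq_rpow,
      ← Real.sqrt_eq_rpow, ← Real.sqrt_mul (mul_nonneg ht.1.le hA.le)]
    congr 1
    rw [show t * A * (t * B) = t ^ 2 * (A * B) by ring, Real.sqrt_mul (sq_nonneg t),
      Real.sqrt_sq ht.1.le]
  have hkey : ENNReal.ofReal p + ENNReal.ofReal (t * √(A * B)) * ENNReal.ofReal (z q - z p) ≤
      ENNReal.ofReal q := by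
    rw [← hHz p hp, ← hHz q hqI, ← Iic_union_Ioc_eq_Iic hzpq.le,
      lintegral_union measurableSet_Ioc (Iic_disjoint_Ioc le_rfl), ← Real.volume_Ioc,
      ← setLIntegral_const]
    exact add_le_add le_rfl (setLIntegral_mono_ae hH.aemeasurable
      (Eventually.of_forall fun r hr => hHr r hr))
  have ht0 := ht.1.le
  rw [← ENNReal.ofReal_mul (by positivity), ← ENNReal.ofReal_add hp.1.le
    (mul_nonneg (by positivity) (sub_nonneg.2 hzpq.le)),
    ENNReal.ofReal_le_ofReal_iff hqI.1.le] at hkey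
  rw [slope_def_field, ← mul_div_assoc, div_le_one (sub_pos.2 hq.1)]
  linarith

/-- Every level strictly below the left side has its quantile for `F` to the left of `a`, hence its
quantile for `G` to the left of `a + c`. -/
lemma measure_Iic_le_of_quantile {G : ℝ → ℝ≥0∞} {I : ℝ}
    (hFI : ∫⁻ x, F x = ENNReal.ofReal I) {x y : ℝ → ℝ} {c : ℝ}
    (hx : ∀ p ∈ Ioo 0 I, ∫⁻ r in Iic (x p), F r = ENNReal.ofReal p)
    (hy : ∀ p ∈ Ioo 0 I, ∫⁻ r in Iic (y p), G r = ENNReal.ofReal p)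
    (hxy : ∀ p ∈ Ioo 0 I, y p = x p + c) (a : ℝ) :
    ∫⁻ r in Iic a, F r ≤ ∫⁻ r in Iic (a + c), G r := by
  have hle : ∫⁻ r in Iic a, F r ≤ ENNReal.ofReal I :=
    (setLIntegral_le_lintegral _ _).trans_eq hFI
  refine le_of_forall_lt fun w hw => ?_
  obtain ⟨v, hwv, hv⟩ := exists_between hw
  have hvt : v ≠ ∞ := hv.ne_top
  have hp : v.toReal ∈ Ioo 0 I :=
    ⟨ENNReal.toReal_pos (pos_of_gt hwv).ne' hvt, ENNReal.toReal_lt_of_lt_ofReal (hv.trans_le hle)⟩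
  have hxa : x v.toReal < a := by
    by_contra! h
    have := (lintegral_mono_set (μ := volume) (f := F) (Iic_subset_Iic.2 h)).trans_eq (hx _ hp)
    rw [ENNReal.ofReal_toReal hvt] at this
    exact hv.not_ge this
  refine hwv.trans_le ?_
  calc v = ∫⁻ r in Iic (y v.toReal), G r := by rw [hy _ hp, ENNReal.ofReal_toReal hvt]
    _ ≤ _ := lintegral_mono_set (Iic_subset_Iic.2 (by rw [hxy _ hp]; linarith))

/-- The equality case of the Prékopa–Leindler inequality on the line. -/
lemma exists_map_add_eq_withDensity {G H : ℝ → ℝ≥0∞} (hF : Measurable F) (hG : Measurable G)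
    (hH : Measurable H) (hFc : LogConcave F) (hGc : LogConcave G)
    (hle : ∀ x y, F x ^ (1 / 2 : ℝ) * G y ^ (1 / 2 : ℝ) ≤ H (1 / 2 * x + 1 / 2 * y))
    {I : ℝ} (hI : 0 < I) (hFI : ∫⁻ x, F x = ENNReal.ofReal I)
    (hGI : ∫⁻ x, G x = ENNReal.ofReal I) (hHI : ∫⁻ x, H x = ENNReal.ofReal I) :
    ∃ c : ℝ, (volume.withDensity F).map (· + c) = volume.withDensity G := by
  obtain ⟨x, hx⟩ := exists_quantile hF hFc hI hFI
  obtain ⟨y, hy⟩ := exists_quantile hG hGc hI hGI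
  -- Equal densities at corresponding quantiles mean equal derivatives, so the quantile functions
  -- differ by a constant.
  have hder : ∀ p ∈ Ioo 0 I, HasDerivAt (fun p => y p - x p) 0 p := by
    intro p hp
    have h := (hy p hp).2.2.2.sub (hx p hp).2.2.2
    rw [quantile_density_eq hF hG hH hle hFI hGI hHI hx hy hp, sub_self] at h
    exact h
  have hmid : I / 2 ∈ Ioo 0 I := ⟨by linarith, by linarith⟩
  set c := y (I / 2) - x (I / 2)
  have hc : ∀ p ∈ Ioo 0 I, y p = x p + c := by
    intro p hp
    have := isOpen_Ioo.is_const_of_deriv_eq_zero isPreconnected_Ioo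
      (fun q hq => (hder q hq).differentiableAt.differentiableWithinAt)
      (fun q hq => (hder q hq).deriv) hp hmid
    linarith
  have hc' : ∀ p ∈ Ioo 0 I, x p = y p + -c := fun p hp => by rw [hc p hp]; ring
  refine ⟨c, ?_⟩
  have : IsFiniteMeasure (volume.withDensity F) := isFiniteMeasure_withDensity (by simp [hFI])
  refine Measure.ext_of_Iic _ _ fun a => ?_
  have hpre : (fun x : ℝ => x + c) ⁻¹' Iic a = Iic (a + -c) := by
    ext r
    simp only [mem_preimage, mem_Iic]
    constructor <;> intro h <;> linarith
  rw [Measure.map_apply (by fun_prop) measurableSet_Iic, hpre, withDensity_apply _ measurableSet_Iic,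
    withDensity_apply _ measurableSet_Iic]
  refine le_antisymm ?_ ?_
  · have := measure_Iic_le_of_quantile hFI (fun p hp => (hx p hp).1) (fun p hp => (hy p hp).1)
      hc (a + -c)
    rwa [neg_add_cancel_right] at this
  · exact measure_Iic_le_of_quantile hGI (fun p hp => (hy p hp).1) (fun p hp => (hx p hp).1)
      hc' a

end Line

/-! ### Marginals -/

section Marginal

variable {m : ℕ}

/-- The point with coordinates `s` and `y` in the coordinate system given by `T`. -/
def consPt (T : E (m + 1) ≃ₗᵢ[ℝ] E (m + 1)) (s : ℝ) (y : Fin m → ℝ) : E (m + 1) :=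
  T (WithLp.toLp 2 (Fin.cons s y))

/-- The marginal of a function in the direction of the first coordinate axis of `T`. -/
def marginal (T : E (m + 1) ≃ₗᵢ[ℝ] E (m + 1)) (f : E (m + 1) → ℝ≥0∞) (s : ℝ) : ℝ≥0∞ :=
  ∫⁻ y : Fin m → ℝ, f (consPt T s y)

variable {T : E (m + 1) ≃ₗᵢ[ℝ] E (m + 1)} {f g h : E (m + 1) → ℝ≥0∞}

lemma measurable_consPt : Measurable fun p : ℝ × (Fin m → ℝ) => consPt T p.1 p.2 :=
  T.continuous.measurable.comp ((WithLp.measurable_toLp 2 _).comp measurable_cons)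

lemma measurable_marginal (hf : Measurable f) : Measurable (marginal T f) :=
  (hf.comp measurable_consPt).lintegral_prod_right'

/-- Fubini in the coordinates of `T`, where the first coordinate is the inner product with the image
of the first basis vector. -/
lemma lintegral_marginal_mul (hf : Measurable f) {w : ℝ → ℝ≥0∞} (hw : Measurable w) :
    ∫⁻ s, w s * marginal T f s =
      ∫⁻ x, w (inner ℝ x (T (EuclideanSpace.single 0 1))) * f x := by
  have hTi : ∀ x, inner ℝ (T x) (T (EuclideanSpace.single 0 1)) = x 0 := by
    intro x
    rw [T.inner_map_map, EuclideanSpace.inner_single_right]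
    simp
  rw [← lintegral_comp_linearIsometryEquiv T]
  simp only [hTi]
  rw [← lintegral_toLp, lintegral_fin_succ]
  · refine lintegral_congr fun s => ?_
    rw [marginal, ← lintegral_const_mul]
    · rfl
    · exact hf.comp (measurable_consPt.comp measurable_prodMk_left)
  · have h1 : Measurable fun x : Fin (m + 1) → ℝ => (WithLp.toLp 2 x : E (m + 1)) :=
      WithLp.measurable_toLp 2 _
    exact (hw.comp (measurable_pi_apply 0)).mul (hf.comp (T.continuous.measurable.comp h1))

lemma lintegral_marginal (hf : Measurable f) : ∫⁻ s, marginal T f s = ∫⁻ x, f x := by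
  simpa using lintegral_marginal_mul (T := T) hf (w := fun _ => 1) measurable_const

lemma map_inner_withDensity (hf : Measurable f) :
    (volume.withDensity f).map (fun x => inner ℝ x (T (EuclideanSpace.single 0 1))) =
      volume.withDensity (marginal T f) := by
  have hi : Measurable fun x : E (m + 1) =>
      (inner ℝ x (T (EuclideanSpace.single 0 1)) : ℝ) :=
    (continuous_id.inner continuous_const).measurable
  ext A hA
  rw [Measure.map_apply hi hA, withDensity_apply _ (hi hA), withDensity_apply _ hA,
    ← lintegral_indicator hA, ← lintegral_indicator (hi hA)]
  have h := lintegral_marginal_mul (T := T) hf (w := A.indicator fun _ => 1)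
    (measurable_const.indicator hA)
  calc _ = _ := lintegral_congr fun x => ?_
    _ = _ := h.symm
    _ = _ := lintegral_congr fun s => ?_
  · by_cases hx : inner ℝ x (T (EuclideanSpace.single 0 1)) ∈ A
    · simp [indicator, hx]
    · simp [indicator, hx]
  · by_cases hs : s ∈ A <;> simp [hs]

lemma marginal_prekopa_leindler (hf : Measurable f) (hg : Measurable g) (hh : Measurable h)
    {s t : ℝ} (hs : 0 < s) (ht : 0 < t) (hst : s + t = 1)
    (hle : ∀ x y, f x ^ s * g y ^ t ≤ h (s • x + t • y)) (a b : ℝ) :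
    marginal T f a ^ s * marginal T g b ^ t ≤ marginal T h (s * a + t * b) := by
  refine prekopa_leindler hs ht hst (hf.comp (measurable_consPt.comp measurable_prodMk_left))
    (hg.comp (measurable_consPt.comp measurable_prodMk_left))
    (hh.comp (measurable_consPt.comp measurable_prodMk_left)) fun x y => ?_
  refine (hle _ _).trans_eq ?_
  simp only [consPt]
  rw [← map_smul, ← map_smul, ← map_add]
  congr 2
  ext i
  refine Fin.cases ?_ (fun i => ?_) i <;> simp

lemma LogConcave.marginal (hf : Measurable f) (hfc : LogConcave f) :
    LogConcave (marginal T f) := fun a b _ _ hs ht hst =>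
  marginal_prekopa_leindler hf hf hf hs ht hst (fun x y => hfc x y _ _ hs ht hst) a b

end Marginal

/-! ### The equality case of the Prékopa–Leindler inequality -/

lemma exists_linearIsometryEquiv_apply_eq {v w : E n} (h : ‖v‖ = ‖w‖) :
    ∃ T : E n ≃ₗᵢ[ℝ] E n, T v = w :=
  ⟨(Submodule.span ℝ {v - w})ᗮ.reflection, Submodule.reflection_sub h⟩

lemma exists_map_inner_eq {f g h : E n → ℝ≥0∞} (hf : Measurable f) (hg : Measurable g)
    (hh : Measurable h) (hfc : LogConcave f) (hgc : LogConcave g)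
    (hle : ∀ x y, f x ^ (1 / 2 : ℝ) * g y ^ (1 / 2 : ℝ) ≤ h ((1 / 2 : ℝ) • x + (1 / 2 : ℝ) • y))
    {I : ℝ} (hI : 0 < I) (hfI : ∫⁻ x, f x = ENNReal.ofReal I)
    (hgI : ∫⁻ x, g x = ENNReal.ofReal I) (hhI : ∫⁻ x, h x = ENNReal.ofReal I) {v : E n}
    (hv : ‖v‖ = 1) :
    ∃ c : ℝ, (volume.withDensity f).map (fun x => inner ℝ x v + c) =
      (volume.withDensity g).map (fun x => inner ℝ x v) := by
  obtain ⟨m, rfl⟩ : ∃ m, n = m + 1 := by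
    refine Nat.exists_eq_succ_of_ne_zero ?_
    rintro rfl
    rw [Subsingleton.elim v 0, norm_zero] at hv
    exact zero_ne_one hv
  obtain ⟨T, hT⟩ := exists_linearIsometryEquiv_apply_eq
    (v := (EuclideanSpace.single 0 1 : E (m + 1))) (w := v) (by simp [hv])
  obtain ⟨c, hc⟩ := exists_map_add_eq_withDensity (measurable_marginal (T := T) hf)
    (measurable_marginal (T := T) hg) (measurable_marginal (T := T) hh) (hfc.marginal hf)
    (hgc.marginal hg) (marginal_prekopa_leindler hf hg hh one_half_pos one_half_pos
      (by norm_num) hle) hI ((lintegral_marginal hf).trans hfI) ((lintegral_marginal hg).trans hgI)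
    ((lintegral_marginal hh).trans hhI)
  refine ⟨c, ?_⟩
  have hi : Measurable fun x : E (m + 1) => (inner ℝ x v : ℝ) :=
    (continuous_id.inner continuous_const).measurable
  rw [← map_inner_withDensity hf, ← map_inner_withDensity hg, hT,
    Measure.map_map (by fun_prop) hi] at hc
  exact hc

/-- In the equality case of the Prékopa–Leindler inequality for log-concave densities of equal mass
the densities are translates of each other. -/
lemma exists_map_add_eq {f g h : E n → ℝ≥0∞} (hf : Measurable f) (hg : Measurable g)
    (hh : Measurable h) (hfc : LogConcave f) (hgc : LogConcave g)
    (hle : ∀ x y, f x ^ (1 / 2 : ℝ) * g y ^ (1 / 2 : ℝ) ≤ h ((1 / 2 : ℝ) • x + (1 / 2 : ℝ) • y))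
    {I : ℝ} (hI : 0 < I) (hfI : ∫⁻ x, f x = ENNReal.ofReal I)
    (hgI : ∫⁻ x, g x = ENNReal.ofReal I) (hhI : ∫⁻ x, h x = ENNReal.ofReal I)
    (hf1 : Integrable id (volume.withDensity f)) (hg1 : Integrable id (volume.withDensity g)) :
    ∃ b : E n, (volume.withDensity f).map (· + b) = volume.withDensity g := by
  set μ := volume.withDensity f with hμ
  set ν := volume.withDensity g with hν
  have : IsFiniteMeasure μ := isFiniteMeasure_withDensity (by simp [hfI])
  have : IsFiniteMeasure ν := isFiniteMeasure_withDensity (by simp [hgI])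
  have hνI : ν.real univ = I := by
    rw [measureReal_def, hν, withDensity_apply _ MeasurableSet.univ, Measure.restrict_univ, hgI,
      ENNReal.toReal_ofReal hI.le]
  have hμI : μ.real univ = I := by
    rw [measureReal_def, hμ, withDensity_apply _ MeasurableSet.univ, Measure.restrict_univ, hfI,
      ENNReal.toReal_ofReal hI.le]
  -- Comparing first moments of the projections identifies the shift in direction `v` as `⟨b, v⟩`,
  -- so one vector serves all directions.
  set b : E n := I⁻¹ • ((∫ x, x ∂ν) - ∫ x, x ∂μ) with hb
  refine ⟨b, ?_⟩
  have key : ∀ v : E n, ‖v‖ = 1 → μ.map (fun x => inner ℝ (x + b) v) =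
      ν.map (fun x => inner ℝ x v) := by
    intro v hv
    have hi : Continuous fun x : E n => (inner ℝ x v : ℝ) := continuous_id.inner continuous_const
    obtain ⟨c, hc⟩ := exists_map_inner_eq hf hg hh hfc hgc hle hI hfI hgI hhI hv
    rw [← hμ, ← hν] at hc
    have hin : ∀ ρ : Measure (E n), Integrable id ρ → ∫ x, inner ℝ x v ∂ρ = inner ℝ (∫ x, x ∂ρ) v := by
      intro ρ hρ
      simp_rw [real_inner_comm v]
      exact integral_inner (𝕜 := ℝ) hρ v
    have h1 : ∫ x, inner ℝ x v + c ∂μ = ∫ x, inner ℝ x v ∂ν := by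
      have h2 := congrArg (fun ρ : Measure ℝ => ∫ s, s ∂ρ) hc
      rwa [integral_map (hi.add_const c).measurable.aemeasurable (by fun_prop),
        integral_map hi.measurable.aemeasurable (by fun_prop)] at h2
    have hint : Integrable (fun x => inner ℝ x v) μ := hf1.inner_const v
    rw [integral_add hint (integrable_const c), hin μ hf1, hin ν hg1, integral_const, hμI] at h1
    have hc' : c = inner ℝ b v := by
      rw [hb, real_inner_smul_left, inner_sub_left, ← h1]
      simp only [smul_eq_mul]
      field_simp
      ring
    rw [← hc, hc']
    simp only [inner_add_left]
  have : IsFiniteMeasure (μ.map (· + b)) := inferInstance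
  refine Measure.ext_of_charFun ?_
  ext t
  rcases eq_or_ne t 0 with rfl | ht
  · rw [charFun_zero, charFun_zero, hνI, map_measureReal_apply (by fun_prop) MeasurableSet.univ,
      preimage_univ, hμI]
  · have ht0 : ‖t‖ ≠ 0 := norm_ne_zero_iff.2 ht
    set v := ‖t‖⁻¹ • t with hv
    have hv1 : ‖v‖ = 1 := by rw [hv, norm_smul, norm_inv, norm_norm, inv_mul_cancel₀ ht0]
    have htv : t = ‖t‖ • v := by rw [hv, smul_inv_smul₀ ht0]
    have hi : Continuous fun x : E n => (inner ℝ x v : ℝ) := continuous_id.inner continuous_const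
    -- Cramér–Wold: the characteristic function at `t` depends only on the projection to the
    -- direction of `t`.
    have hexp : ∀ ρ : Measure (E n),
        charFun ρ t = charFun (ρ.map fun x => inner ℝ x v) ‖t‖ := by
      intro ρ
      rw [charFun_apply, charFun_apply_real, integral_map hi.measurable.aemeasurable (by fun_prop)]
      refine integral_congr_ae (Eventually.of_forall fun x => ?_)
      have : (inner ℝ x t : ℝ) = ‖t‖ * inner ℝ x v := by
        conv_lhs => rw [htv]
        rw [real_inner_smul_right]
      simp [this]
    rw [hexp, hexp, ← key v hv1, Measure.map_map hi.measurable (by fun_prop)]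
    rfl

/-! ### Decay of log-concave functions -/

lemma alphaMean_zero (s t : ℝ≥0) (a b : ℝ≥0∞) :
    alphaMean 0 s t a b = a ^ (s : ℝ) * b ^ (t : ℝ) := by
  simp [alphaMean]

lemma AlphaConcave.logConcave {f : E n → ℝ≥0∞} (hf : AlphaConcave 0 f) : LogConcave f := by
  intro x y s t hs ht hst
  rcases eq_or_ne (f x) 0 with hx | hx
  · rw [hx, ENNReal.zero_rpow_of_pos hs, zero_mul]; exact zero_le
  rcases eq_or_ne (f y) 0 with hy | hy
  · rw [hy, ENNReal.zero_rpow_of_pos ht, mul_zero]; exact zero_le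
  lift s to ℝ≥0 using hs.le
  lift t to ℝ≥0 using ht.le
  have h := hf.2 x (pos_iff_ne_zero.2 hx) y (pos_iff_ne_zero.2 hy) s t (by exact_mod_cast hst)
  rwa [alphaMean_zero] at h

/-- Beyond some radius `r` about `x₀` the function is at most half of `f x₀`. Concavity of the
logarithm along rays from `x₀` continues this loss of `log 2` per length `r`; inside the ball
boundedness suffices. -/
lemma MemC.exists_exp_decay {f : E n → ℝ≥0∞} (hf : MemC 0 f) :
    ∃ x₀ : E n, ∃ C > 0, ∃ κ > 0, ∀ x, (f x).toReal ≤ C * Real.exp (-(κ * ‖x - x₀‖)) := by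
  obtain ⟨x₀, hx₀⟩ := hf.proper
  obtain ⟨M, hM, hfM⟩ := hf.tame.exists_bound
  set a := (f x₀).toReal
  have ha : 0 < a := ENNReal.toReal_pos (ne_of_gt hx₀) (hf.finite x₀).ne
  obtain ⟨r, hr, hfr⟩ : ∃ r > 0, ∀ x, r ≤ ‖x - x₀‖ → (f x).toReal ≤ a / 2 := by
    have hev : ∀ᶠ x in cocompact (E n), f x < ENNReal.ofReal (a / 2) :=
      hf.tendsto_zero.eventually_lt_const (by simpa using ha)
    rw [← Metric.cobounded_eq_cocompact] at hev
    obtain ⟨r, -, hr⟩ := (Metric.hasBasis_cobounded_compl_closedBall x₀).eventually_iff.1 hev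
    refine ⟨max r 0 + 1, by positivity, fun x hx => ?_⟩
    refine ENNReal.toReal_le_of_le_ofReal (by positivity) (hr ?_).le
    rw [mem_compl_iff, mem_closedBall_iff_norm, not_le]
    linarith [le_max_left r 0]
  set κ := Real.log 2 / r with hκ
  have hl2 : 0 < Real.log 2 := Real.log_pos one_lt_two
  have hκ0 : 0 < κ := by positivity
  set C := max a M.toReal * Real.exp (κ * r)
  have hC0 : 0 < max a M.toReal := lt_max_of_lt_left ha
  refine ⟨x₀, C, by positivity, κ, hκ0, fun x => ?_⟩
  rcases le_or_gt (‖x - x₀‖) r with hx | hx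
  · calc (f x).toReal ≤ max a M.toReal * 1 := by
          rw [mul_one]
          exact (ENNReal.toReal_mono hM (hfM x)).trans (le_max_right _ _)
      _ ≤ max a M.toReal * Real.exp (κ * r + -(κ * ‖x - x₀‖)) := by
          gcongr
          rw [← Real.exp_zero]
          exact Real.exp_le_exp.2 (by nlinarith)
      _ = _ := by rw [Real.exp_add, ← mul_assoc]
  · rcases eq_or_ne (f x) 0 with h0 | h0
    · rw [h0, ENNReal.toReal_zero]; positivity
    have hρ : 0 < ‖x - x₀‖ := hr.trans hx
    set l := r / ‖x - x₀‖ with hl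
    have hl0 : 0 < l := by positivity
    have hl1 : l < 1 := (div_lt_one hρ).2 hx
    have hφ : 0 < (f x).toReal := ENNReal.toReal_pos h0 (hf.finite x).ne
    have h1 := hf.alphaConcave.logConcave x x₀ l (1 - l) hl0 (by linarith) (by ring)
    have h2 := (ENNReal.toReal_mono (hf.finite _).ne h1).trans (hfr _ (by
      rw [show l • x + (1 - l) • x₀ - x₀ = l • (x - x₀) by module, norm_smul,
        Real.norm_of_nonneg hl0.le, hl, div_mul_cancel₀ _ hρ.ne']))
    rw [ENNReal.toReal_mul, ← ENNReal.toReal_rpow, ← ENNReal.toReal_rpow] at h2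
    have h3 := Real.log_le_log (mul_pos (Real.rpow_pos_of_pos hφ _) (Real.rpow_pos_of_pos ha _)) h2
    rw [Real.log_mul (Real.rpow_pos_of_pos hφ _).ne' (Real.rpow_pos_of_pos ha _).ne',
      Real.log_rpow hφ, Real.log_rpow ha, Real.log_div ha.ne' two_ne_zero] at h3
    have h4 : Real.log (f x).toReal ≤ Real.log a - κ * ‖x - x₀‖ := by
      have e : l * (κ * ‖x - x₀‖) = Real.log 2 := by
        rw [hl, hκ]; field_simp
      nlinarith
    rw [← Real.exp_log hφ]
    calc Real.exp (Real.log (f x).toReal) ≤ Real.exp (Real.log a - κ * ‖x - x₀‖) :=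
          Real.exp_le_exp.2 h4
      _ = a * Real.exp (-(κ * ‖x - x₀‖)) := by rw [sub_eq_add_neg, Real.exp_add, Real.exp_log ha]
      _ ≤ C * Real.exp (-(κ * ‖x - x₀‖)) := by
          refine mul_le_mul_of_nonneg_right ?_ (Real.exp_pos _).le
          calc a ≤ max a M.toReal * 1 := by rw [mul_one]; exact le_max_left _ _
            _ ≤ max a M.toReal * Real.exp (κ * r) := by
              gcongr; exact Real.one_le_exp (by positivity)

lemma MemC.exists_power_decay {f : E n → ℝ≥0∞} (hf : MemC 0 f) (k : ℕ) :
    ∃ C > 0, ∀ x, (f x).toReal * (1 + ‖x‖) ^ k ≤ C := by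
  obtain ⟨x₀, C, hC, κ, hκ, h⟩ := hf.exists_exp_decay
  set D := Real.exp (κ * (1 + ‖x₀‖))
  refine ⟨C * (D * (k.factorial / κ ^ k)), by positivity, fun x => ?_⟩
  have h1 := Real.pow_div_factorial_le_exp (κ * (1 + ‖x‖)) (by positivity) k
  have h2 : Real.exp (κ * (1 + ‖x‖)) ≤ D * Real.exp (κ * ‖x - x₀‖) := by
    rw [← Real.exp_add]
    refine Real.exp_le_exp.2 ?_
    have : ‖x‖ ≤ ‖x - x₀‖ + ‖x₀‖ := by simpa using norm_add_le (x - x₀) x₀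
    nlinarith
  have h3 : (1 + ‖x‖) ^ k ≤ D * Real.exp (κ * ‖x - x₀‖) * (k.factorial / κ ^ k) := by
    have h4 := h1.trans h2
    rw [mul_pow, div_le_iff₀ (by positivity)] at h4
    rw [← mul_div_assoc, le_div_iff₀ (by positivity), mul_comm]
    exact h4
  calc (f x).toReal * (1 + ‖x‖) ^ k
      ≤ (C * Real.exp (-(κ * ‖x - x₀‖))) * (D * Real.exp (κ * ‖x - x₀‖) * (k.factorial / κ ^ k)) :=
        mul_le_mul (h x) h3 (by positivity) (by positivity)
    _ = C * (D * (k.factorial / κ ^ k)) *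
        (Real.exp (-(κ * ‖x - x₀‖)) * Real.exp (κ * ‖x - x₀‖)) := by ring
    _ = _ := by rw [← Real.exp_add, neg_add_cancel, Real.exp_zero, mul_one]

lemma MemC.integrable_toReal_smul {f : E n → ℝ≥0∞} (hf : MemC 0 f) {F : Type*}
    [NormedAddCommGroup F] [NormedSpace ℝ F] {w : E n → F} (hw : AEStronglyMeasurable w volume)
    (hb : ∀ x, ‖w x‖ ≤ 1 + ‖x‖) : Integrable fun x => (f x).toReal • w x := by
  -- One power absorbs the growth of `w`; the remaining `n + 1` make the dominating function
  -- integrable in dimension `n`.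
  obtain ⟨C, hC, h⟩ := hf.exists_power_decay (n + 2)
  have hint : Integrable fun x : E n => (1 + ‖x‖) ^ (-((n : ℝ) + 1)) :=
    integrable_one_add_norm (by simp)
  refine (hint.const_mul C).mono' (hf.usc.measurable.ennreal_toReal.aestronglyMeasurable.smul hw)
    (Eventually.of_forall fun x => ?_)
  have hp : (0 : ℝ) < 1 + ‖x‖ := by positivity
  rw [norm_smul, Real.norm_of_nonneg ENNReal.toReal_nonneg, Real.rpow_neg hp.le,
    ← div_eq_mul_inv, le_div_iff₀ (Real.rpow_pos_of_pos hp _)]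
  calc (f x).toReal * ‖w x‖ * (1 + ‖x‖) ^ ((n : ℝ) + 1)
      = (f x).toReal * (‖w x‖ * (1 + ‖x‖) ^ (n + 1)) := by rw [mul_assoc]; norm_cast
    _ ≤ (f x).toReal * ((1 + ‖x‖) * (1 + ‖x‖) ^ (n + 1)) :=
        mul_le_mul_of_nonneg_left (mul_le_mul_of_nonneg_right (hb x) (by positivity))
          ENNReal.toReal_nonneg
    _ = (f x).toReal * (1 + ‖x‖) ^ (n + 2) := by ring
    _ ≤ C := h x

lemma MemC.integrable_toReal {f : E n → ℝ≥0∞} (hf : MemC 0 f) :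
    Integrable fun x => (f x).toReal := by
  simpa using hf.integrable_toReal_smul (w := fun _ => (1 : ℝ)) aestronglyMeasurable_const
    (fun x => by simp)

lemma MemC.lintegral_ne_top {f : E n → ℝ≥0∞} (hf : MemC 0 f) : ∫⁻ x, f x ≠ ∞ := by
  have h := hf.integrable_toReal.lintegral_lt_top
  simp_rw [fun x => ENNReal.ofReal_toReal (hf.finite x).ne] at h
  exact h.ne

lemma MemC.lintegral_pos {α : EReal} {f : E n → ℝ≥0∞} (hf : MemC α f) : 0 < ∫⁻ x, f x := by
  obtain ⟨y₁, c, hc, δ, hδ, hball⟩ := hf.exists_closedBall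
  calc 0 < ∫⁻ x in Metric.closedBall y₁ c, δ := by
        rw [setLIntegral_const]
        exact ENNReal.mul_pos hδ.ne' (Metric.measure_closedBall_pos volume y₁ hc).ne'
    _ ≤ ∫⁻ x in Metric.closedBall y₁ c, f x :=
        setLIntegral_mono_ae hf.usc.measurable.aemeasurable (Eventually.of_forall hball)
    _ ≤ _ := setLIntegral_le_lintegral _ _

lemma MemC.integrable_id_withDensity {f : E n → ℝ≥0∞} (hf : MemC 0 f) :
    Integrable id (volume.withDensity f) := by
  rw [integrable_withDensity_iff_integrable_smul' hf.usc.measurable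
    (Eventually.of_forall hf.finite)]
  exact hf.integrable_toReal_smul aestronglyMeasurable_id fun x => by simp

/-! ### Almost everywhere equal log-concave functions -/

/-- If `g x < k < f x`, contracting the ball slightly short of `x` gives small balls near `x` on
which log-concavity keeps `f` above `k`. Each contains a point where `f = g`, against the upper
semicontinuity of `g` at `x`. -/
lemma LogConcave.le_of_ae_eq {f g : E n → ℝ≥0∞} (hf : LogConcave f) (hfin : ∀ x, f x < ∞)
    {y₁ : E n} {c : ℝ} (hc : 0 < c) {δ : ℝ≥0∞} (hδ : 0 < δ)
    (hball : ∀ y ∈ Metric.closedBall y₁ c, δ ≤ f y) (hg : UpperSemicontinuous g)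
    (hfg : f =ᵐ[volume] g) (x : E n) : f x ≤ g x := by
  by_contra! hlt
  obtain ⟨k, hk, hkf⟩ := exists_between hlt
  have hδt : δ ≠ ∞ := ((hball y₁ (Metric.mem_closedBall_self hc.le)).trans_lt (hfin y₁)).ne
  set a := (f x).toReal
  set d := δ.toReal
  have ha : 0 < a := ENNReal.toReal_pos (pos_of_gt hkf).ne' (hfin x).ne
  have hd : 0 < d := ENNReal.toReal_pos hδ.ne' hδt
  have hlim : Tendsto (fun l : ℝ => f x ^ (1 - l) * δ ^ l) (𝓝[>] 0) (𝓝 (f x)) := by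
    have h1 : Continuous fun l : ℝ => ENNReal.ofReal (a ^ (1 - l) * d ^ l) :=
      ENNReal.continuous_ofReal.comp (((Real.continuous_const_rpow ha.ne').comp (by fun_prop)).mul
        (Real.continuous_const_rpow hd.ne'))
    have h2 := (h1.tendsto 0).mono_left (nhdsWithin_le_nhds (s := Ioi 0))
    simp only [sub_zero, Real.rpow_one, Real.rpow_zero, mul_one] at h2
    rw [ENNReal.ofReal_toReal (hfin x).ne] at h2
    refine h2.congr fun l => ?_
    rw [ENNReal.ofReal_mul (by positivity), ← ENNReal.ofReal_rpow_of_pos ha,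
      ← ENNReal.ofReal_rpow_of_pos hd, ENNReal.ofReal_toReal (hfin x).ne, ENNReal.ofReal_toReal hδt]
  obtain ⟨ε, hε, hgk⟩ := Metric.eventually_nhds_iff.1 (hg x k hk)
  have hnorm : ∀ᶠ l : ℝ in 𝓝[>] 0, l * (‖y₁ - x‖ + c) < ε := by
    have h1 : Continuous fun l : ℝ => l * (‖y₁ - x‖ + c) := by fun_prop
    refine nhdsWithin_le_nhds ((h1.tendsto 0).eventually (gt_mem_nhds ?_))
    rwa [zero_mul]
  obtain ⟨l, ⟨hl, hle⟩, hl0, hl1⟩ := (((hlim.eventually (lt_mem_nhds hkf)).and hnorm).and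
    (Ioo_mem_nhdsGT (zero_lt_one' ℝ))).exists
  obtain ⟨w, hw, hwfg⟩ := (Measure.dense_of_ae hfg).inter_open_nonempty
    (Metric.ball ((1 - l) • x + l • y₁) (l * c)) Metric.isOpen_ball
    (Metric.nonempty_ball.2 (mul_pos hl0 hc))
  rw [mem_ball_iff_norm] at hw
  -- The preimage of `w` under the contraction towards `x` with ratio `l`.
  set y := y₁ + l⁻¹ • (w - ((1 - l) • x + l • y₁)) with hy
  have hyb : y ∈ Metric.closedBall y₁ c := by
    rw [hy, mem_closedBall_iff_norm, add_sub_cancel_left, norm_smul, norm_inv,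
      Real.norm_of_nonneg hl0.le, inv_mul_le_iff₀ hl0]
    exact hw.le
  have hwy : w = (1 - l) • x + l • y := by
    rw [hy, smul_add, smul_inv_smul₀ hl0.ne']; abel
  have h1 : k < f w := by
    refine hl.trans_le (le_trans ?_ (hwy ▸ hf x y (1 - l) l (by linarith) hl0 (by ring)))
    exact mul_le_mul' le_rfl (ENNReal.rpow_le_rpow (hball y hyb) hl0.le)
  have h2 : g w < k := by
    refine hgk ?_
    rw [dist_eq_norm]
    refine lt_of_le_of_lt ?_ hle
    have h3 : ‖y - x‖ ≤ ‖y₁ - x‖ + c := by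
      have h4 := norm_add_le (y - y₁) (y₁ - x)
      rw [sub_add_sub_cancel] at h4
      have h5 := mem_closedBall_iff_norm.1 hyb
      linarith
    rw [hwy, show (1 - l) • x + l • y - x = l • (y - x) by module, norm_smul,
      Real.norm_of_nonneg hl0.le]
    gcongr
  have h3 : f w = g w := hwfg
  exact (h1.trans_eq h3).not_gt h2

/-! ### The equality case for the exponent zero -/

lemma map_add_withDensity {f : E n → ℝ≥0∞} (hf : Measurable f) (b : E n) :
    (volume.withDensity f).map (· + b) = volume.withDensity fun x => f (x - b) := by
  ext A hA
  have hm : Measurable fun x : E n => x + b := by fun_prop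
  rw [Measure.map_apply hm hA, withDensity_apply _ (hm hA), withDensity_apply _ hA,
    ← (measurePreserving_add_right volume b).setLIntegral_comp_preimage hA (by fun_prop)]
  simp

/-- Equal masses are the equality case of Prékopa–Leindler for `f`, its reflection and the
symmetral. The resulting almost everywhere identity is upgraded in both directions by
`LogConcave.le_of_ae_eq`. -/
lemma MemC.exists_translate {u : E n} (hu : ‖u‖ = 1) {f : E n → ℝ≥0∞} (hf : MemC 0 f)
    (hm : mass (symm 0 u f) = mass f) : ∃ x₀, ∀ x, f x = refl u f (x - x₀) := by
  have hfm := hf.usc.measurable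
  have hfc := hf.alphaConcave.logConcave
  have hR : Measurable (reflIso u) := (reflIso u).continuous.measurable
  have hgc : LogConcave fun x => f (reflIso u x) := by
    intro x y s t hs ht hst
    simpa using hfc (reflIso u x) (reflIso u y) s t hs ht hst
  have hgI : ∫⁻ x, f (reflIso u x) = ∫⁻ x, f x := lintegral_comp_linearIsometryEquiv _ f
  have hI : ENNReal.ofReal (∫⁻ x, f x).toReal = ∫⁻ x, f x := ENNReal.ofReal_toReal hf.lintegral_ne_top
  have hg1 : Integrable id (volume.withDensity fun x => f (reflIso u x)) := by
    refine (integrable_withDensity_iff_integrable_smul' (f := fun x => f (reflIso u x))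
      (hfm.comp hR) (Eventually.of_forall fun x => hf.finite _)).2 ?_
    have h := hf.integrable_toReal_smul (w := reflIso u) hR.aestronglyMeasurable fun x => by simp
    have h2 := ((reflIso u).measurePreserving.integrable_comp_emb
      (reflIso u).toHomeomorph.measurableEmbedding).2 h
    refine h2.congr (Eventually.of_forall fun x => ?_)
    simp [reflIso_reflIso]
  obtain ⟨b, hb⟩ := exists_map_add_eq hfm (hfm.comp hR) (hf.tame.measurable_symm hu) hfc hgc
    (fun x y => by
      rcases eq_or_ne (f x) 0 with hx | hx
      · rw [hx, ENNReal.zero_rpow_of_pos one_half_pos, zero_mul]; exact zero_le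
      rcases eq_or_ne (f (reflIso u y)) 0 with hy | hy
      · rw [Function.comp_apply, hy, ENNReal.zero_rpow_of_pos one_half_pos, mul_zero]
        exact zero_le
      have h := midMean_le_symm hu hf.finite hf.tame.isClosed_supp
        (supp_subset_dom 0 f (pos_iff_ne_zero.2 hx)) (supp_subset_dom 0 f (pos_iff_ne_zero.2 hy))
      rw [midMean_zero, mixPt, reflIso_reflIso, smul_add] at h
      simpa using h)
    (ENNReal.toReal_pos hf.lintegral_pos.ne' hf.lintegral_ne_top) hI.symm (hgI.trans hI.symm)
    (hm.trans hI.symm) hf.integrable_id_withDensity hg1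
  rw [map_add_withDensity hfm, withDensity_eq_iff (by fun_prop) (hfm.comp hR).aemeasurable
    (by rw [lintegral_sub_right_eq_self]; exact hf.lintegral_ne_top)] at hb
  obtain ⟨y₁, c, hc, δ, hδ, hball⟩ := hf.exists_closedBall
  have h1 := LogConcave.le_of_ae_eq (f := fun x => f (x - b)) (y₁ := y₁ + b)
    (g := fun x => f (reflIso u x)) (fun x y s t hs ht hst => by
      have h := hfc (x - b) (y - b) s t hs ht hst
      rwa [show s • (x - b) + t • (y - b) = s • x + t • y - b by
        rw [smul_sub, smul_sub, sub_add_sub_comm, ← add_smul, hst, one_smul]] at h)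
    (fun x => hf.finite _) hc hδ (fun y hy => hball _ (by
      rw [mem_closedBall_iff_norm] at hy ⊢
      rwa [sub_sub, add_comm b y₁])) (fun x k hk => ((reflIso u).continuous.tendsto x).eventually (hf.usc _ k hk)) hb
  have h2 := LogConcave.le_of_ae_eq (y₁ := reflIso u y₁) hgc (fun x => hf.finite _) hc hδ
    (fun y hy => hball _ (by
      rw [mem_closedBall_iff_norm] at hy ⊢
      rwa [← reflIso_reflIso u y₁, ← map_sub, LinearIsometryEquiv.norm_map]))
    (fun x k hk => ((continuous_sub_right b).tendsto x).eventually (hf.usc _ k hk)) hb.symm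
  refine ⟨-b, fun x => ?_⟩
  rw [refl_eq hu, Function.comp_apply, sub_neg_eq_add]
  have := le_antisymm (h1 (x + b)) (h2 (x + b))
  simpa using this

/-- The symmetry moves `z` to `reflIso u z + x₀` without changing the value, so concavity bounds the
symmetral by a translate of `f` by half of `x₀`, which has the same mass. -/
lemma MemC.mass_symm_of_translate {u : E n} (hu : ‖u‖ = 1) {f : E n → ℝ≥0∞} (hf : MemC 0 f)
    {x₀ : E n} (h : ∀ x, f x = refl u f (x - x₀)) : mass (symm 0 u f) = mass f := by
  refine le_antisymm ?_ (hf.tame.mass_le_mass_symm hu ?_)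
  · have hle : ∀ x, symm 0 u f x ≤ f (x + (2⁻¹ : ℝ) • x₀) := by
      intro x
      refine symm_le hu hf.finite hf.tame.isClosed_supp fun y hy z hz hx => ?_
      have hz' : f (reflIso u z + x₀) = f z := by
        rw [h, add_sub_cancel_right, refl_eq hu, Function.comp_apply, reflIso_reflIso]
      rw [dom_of_nonpos le_rfl] at hy hz
      have hz2 : reflIso u z + x₀ ∈ supp f := by
        show 0 < f _
        rw [hz']; exact hz
      have h1 := (hf.midConcave y (supp_subset_dom _ _ hy) _ (supp_subset_dom _ _ hz2)).2
      rw [hz'] at h1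
      rwa [← hx, mixPt, ← smul_add, add_assoc]
    calc mass (symm 0 u f) ≤ ∫⁻ x, f (x + (2⁻¹ : ℝ) • x₀) := lintegral_mono hle
      _ = mass f := lintegral_add_right_eq_self f _
  · have : (-(1 / (n : ℝ))) ≤ 0 := neg_nonpos.2 (by positivity)
    exact_mod_cast this

end MinkSymm

end

/-! ### Assembly of the proposition -/

open MinkSymm in
theorem proposition3p4 (n : ℕ) (α : EReal) (u : EuclideanSpace ℝ (Fin n)) (hu : ‖u‖ = 1)
    (f g : EuclideanSpace ℝ (Fin n) → ℝ≥0∞) (hf : MemC α f) (hg : MemC α g) :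
    -- preservation of the mean width
    (α ≠ ⊤ → alphaMeanWidth α (symm α u f) = alphaMeanWidth α f) ∧
    -- monotonicity
    ((∀ x, f x ≤ g x) → ∀ x, symm α u f x ≤ symm α u g x) ∧
    -- symmetry
    refl u (symm α u f) = symm α u f ∧
    -- idempotence
    symm α u (symm α u f) = symm α u f ∧
    -- invariance on symmetric functions
    (∀ f' : EuclideanSpace ℝ (Fin n) → ℝ≥0∞, MemC α f' → refl u f' = f' → symm α u f' = f') ∧
    -- projection invariance
    proj u (symm α u f) = proj u f ∧
    -- the total mass does not decrease, with the equality case for the exponent zero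
    (((-(1 / (n : ℝ)) : ℝ) : EReal) ≤ α →
      ∀ φ : EuclideanSpace ℝ (Fin n) → ℝ≥0∞, (MemC α φ ∨ (α ≤ 0 ∧ MemLCc φ)) →
        mass φ ≤ mass (symm α u φ)) ∧
    (α = 0 → (mass (symm α u f) = mass f ↔ ∃ x₀, ∀ x, f x = refl u f (x - x₀))) ∧
    -- superlevel sets
    (∀ t : ℝ, 0 < t → superlevel t (symm ⊥ u f) = symmSet u (superlevel t f)) := by
  refine ⟨fun hα => hf.alphaMeanWidth_symm hα hu, ?_, ?_, ?_, ?_, ?_, ?_, ?_, ?_⟩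
  · exact symm_mono hu hf.finite hf.tame.isClosed_supp hg.finite hg.tame.isClosed_supp
  · exact refl_symm hu hf.finite hf.tame.isClosed_supp
  · exact hf.tame.symm_symm hu hf.midConcave
  · exact fun f' hf' hR => symm_eq_self hu hf'.finite hf'.tame.isClosed_supp hf'.midConcave hR
  · exact proj_symm hu hf.finite hf.tame.isClosed_supp hf.midConcave
  · rintro hα φ (hφ | ⟨hα0, hφ⟩)
    · exact hφ.tame.mass_le_mass_symm hu hα
    · exact (hφ.tame_of_nonpos hα0).mass_le_mass_symm hu hα
  · rintro rfl
    exact ⟨hf.exists_translate hu, fun ⟨_, h⟩ => hf.mass_symm_of_translate hu h⟩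
  · exact fun t ht => superlevel_symm_bot hu (hf.tame_of_nonpos bot_le) ht
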